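/- All objects are over $\mathbb C$, and Sweedler notation is used. A $*$-Hopf algebra is a Hopf algebra $B$ with a conjugate linear involution $*$ such that $(xy)^*=y^*x^*$ and $\Delta(x^*)=\sum x_1^*\otimes x_2^*$. A cocycle linked pair of bialgebras $(A,H,\blacktriangleright,\rho,\chi,\psi)$ consists of bialgebras $A,H$ and linear maps $\blacktriangleright:H\otimes A\to A$, $\rho:H\to H\otimes A$, $\rho(x)=\sum x_H\otimes x_A$, $\chi:H\otimes H\to A$, $\psi:H\to A\otimes A$, $\psi(x)=\sum x_I\otimes x_{II}$, such that for all $x,y,z\in H$, $a,b\in A$: (1) $x\blacktriangleright 1=\varepsilon(x)1$; $x\blacktriangleright ab=\sum(x_1\blacktriangleright a)(x_2\blacktriangleright b)$; $1\blacktriangleright a=a$; $\sum(x_1\blacktriangleright(y_1\blacktriangleright a))\chi(x_2,y_2)=\sum\chi(x_1,y_1)((x_2y_2)\blacktriangleright a)$; $\sum(x_1\blacktriangleright\chi(y_1,z_1))\chi(x_2,y_2z_2)=\sum\chi(x_1,y_1)\chi(x_2y_2,z)$; $\chi(x,1)=\chi(1,x)=\varepsilon(x)1$. (2) $\sum\varepsilon(x_H)x_A=\varepsilon(x)1$;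 $\sum x_{H1}\otimes x_{H2}\otimes x_A=\sum x_{1H}\otimes x_{2H}\otimes x_{1A}x_{2A}$; $\sum x_H\varepsilon(x_A)=x$; $\sum x_{2HH}\otimes x_{1I}x_{2HA}\otimes x_{1II}x_{2A}=\sum x_{1H}\otimes x_{1A1}x_{2I}\otimes x_{1A2}x_{2II}$; $\sum x_{1I1}x_{2HI}\otimes x_{1I2}x_{2HII}\otimes x_{1II}x_{2A}=\sum x_{1I}\otimes x_{1II1}x_{2I}\otimes x_{1II2}x_{2II}$; $\sum\varepsilon(x_I)x_{II}=\sum x_I\varepsilon(x_{II})=\varepsilon(x)1$. (3) $\varepsilon(x\blacktriangleright a)=\varepsilon(x)\varepsilon(a)$; $\rho(1)=1\otimes1$; $\varepsilon(\chi(x,y))=\varepsilon(x)\varepsilon(y)$; $\psi(1)=1\otimes1$; $\sum(x_1\blacktriangleright a)_1x_{2I}\otimes(x_1\blacktriangleright a)_2x_{2II}=\sum x_{1I}(x_{2H}\blacktriangleright a_1)\otimes x_{1II}x_{2A}(x_3\blacktriangleright a_2)$; $\sum(x_2y_2)_H\otimes\chi(x_1,y_1)(x_2y_2)_A=\sum x_{1H}y_{1H}\otimes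 x_{1A}(x_2\blacktriangleright y_{1A})\chi(x_3,y_2)$; $\sum x_{2H}\otimes(x_1\blacktriangleright a)x_{2A}=\sum x_{1H}\otimes x_{1A}(x_2\blacktriangleright a)$; $\sum\chi(x_1,y_1)_1(x_2y_2)_I\otimes\chi(x_1,y_1)_2(x_2y_2)_{II}=\sum x_{1I}(x_{2H}\blacktriangleright y_{1I})\chi(x_{4H},y_{2H})\otimes x_{1II}x_{2A}(x_3\blacktriangleright y_{1II})x_{4A}(x_5\blacktriangleright y_{2A})\chi(x_6,y_3)$. **Theorem.** Let $(A,H,\blacktriangleright,\rho,\chi,\psi)$ be a cocycle linked pair of bialgebras where $A$ and $H$ are $*$-Hopf algebras and $\chi$, $\psi$ are convolution invertible. Let $\gamma:H\to A$ be a linear map with $\gamma(1)=1$ and $\varepsilon\gamma=\varepsilon$. The cocycle bismash product $A^\psi\#_\chi H$, that is, the vector space $A\otimes H$ (with $a\# x=a\otimes x$) with unit $1\#1$, counit $\varepsilon\otimes\varepsilon$, $$(a\# x)(b\# y)=\sum a(x_1\blacktriangleright b)\chi(x_2,y_1)\# x_3y_2,\qquad \Delta(a\# x)=\sum a_1x_{1I}\#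 x_{2H}\otimes a_2x_{1II}x_{2A}\# x_3,$$ is a Hopf algebra, and the formula $$(a\# x)^*=\sum\gamma(x_1^*)(x_2^*\blacktriangleright a^*)\# x_3^*$$ defines a $*$-Hopf algebra structure on it if and only if, for all $x,y\in H$, $a\in A$, - (cero) $\sum\gamma(x_2^*)(x_3^*\blacktriangleright\gamma(x_1)^*)=\varepsilon(x^*)1$, - (uno) $\sum\gamma(x_2^*)(x_3^*\blacktriangleright(x_1\blacktriangleright a)^*)=a^*\gamma(x^*)$, - (dos) $\sum\gamma(y_1^*)(y_2^*\blacktriangleright\gamma(x_1^*))\chi(y_3^*,x_2^*)=\sum\gamma(y_2^*x_2^*)((y_3^*x_3^*)\blacktriangleright\chi(x_1,y_1)^*)$, - (tres) $\sum(x_2^*)_H\otimes\gamma(x_1^*)(x_2^*)_A=\sum(x_{1H})^*\otimes\gamma(x_2^*)(x_3^*\blacktriangleright(x_{1A})^*)$, - (cuatro) $\sum(\gamma(x_1^*))_1(x_2^*)_I\otimes(\gamma(x_1^*))_2(x_2^*)_{II}=\sum\gamma((x_{2H})^*)\big((x_{3H})^*\blacktriangleright(x_{1I})^*\big)\otimes\gamma(x_4^*)\big(x_5^*\blacktriangleright(x_{1II}x_{2A}x_{3A})^*\big)$.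 In that case $A\xrightarrow{\iota}A^\psi\#_\chi H\xrightarrow{\pi}H$, $\iota(a)=a\#1$, $\pi(a\# x)=\varepsilon(a)x$, is an extension of $*$-Hopf algebras: $\iota$ and $\pi$ are Hopf algebra maps commuting with $*$, $\iota$ is injective, $\pi$ is surjective, $\iota(A)=\{m:\sum m_1\otimes\pi(m_2)=m\otimes1\}$, and $\ker\pi=M\,\iota(A^+)$, where $M=A^\psi\#_\chi H$ and $A^+=\ker\varepsilon_A$. -/

import Mathlib

open scoped TensorProduct ComplexConjugate

universe u v w

section Sweedler

variable {V W X : Type*} [AddCommGroup V] [Module ℂ V] [AddCommGroup W] [Module ℂ W]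

/-- Sweedler summation. A tensor `t = ∑ i, v i ⊗ w i` is written as a finite sum of pure tensors,
and `sw t F = ∑ i, F (v i) (w i)`. Whenever `F` is biadditive and `ℂ`-balanced (in particular
bilinear or conjugate-bilinear), the value does not depend on the chosen expression of `t`, see
`sw_eq_liftAddHom`; it is only used for such `F`. -/
noncomputable def sw [AddCommMonoid X] (t : V ⊗[ℂ] W) (F : V → W → X) : X :=
  ∑ p ∈ (TensorProduct.exists_finset t).choose, F p.1 p.2

theorem sw_eq_liftAddHom [AddCommMonoid X] (f : V →+ W →+ X)
    (hf : ∀ (c : ℂ) (v : V) (w : W), f (c • v) w = f v (c • w)) (t : V ⊗[ℂ] W) :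
    sw t (fun v w => f v w) = TensorProduct.liftAddHom f hf t := by
  conv_rhs => rw [(TensorProduct.exists_finset t).choose_spec]
  simp [sw]

end Sweedler

section Comultiplication

variable {C X : Type*} [AddCommGroup C] [Module ℂ C] [Coalgebra ℂ C] [AddCommMonoid X]

/-- `sw2 x F = ∑ F(x₁, x₂)`. -/
noncomputable def sw2 (x : C) (F : C → C → X) : X :=
  sw (Coalgebra.comul (R := ℂ) x) F

/-- `sw3 x F = ∑ F(x₁, x₂, x₃)`. -/
noncomputable def sw3 (x : C) (F : C → C → C → X) : X :=
  sw2 x fun x1 x' => sw2 x' fun x2 x3 => F x1 x2 x3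

/-- `sw4 x F = ∑ F(x₁, …, x₄)`. -/
noncomputable def sw4 (x : C) (F : C → C → C → C → X) : X :=
  sw2 x fun x1 x' => sw3 x' fun x2 x3 x4 => F x1 x2 x3 x4

/-- `sw5 x F = ∑ F(x₁, …, x₅)`. -/
noncomputable def sw5 (x : C) (F : C → C → C → C → C → X) : X :=
  sw2 x fun x1 x' => sw4 x' fun x2 x3 x4 x5 => F x1 x2 x3 x4 x5

/-- `sw6 x F = ∑ F(x₁, …, x₆)`. -/
noncomputable def sw6 (x : C) (F : C → C → C → C → C → C → X) : X :=
  sw2 x fun x1 x' => sw5 x' fun x2 x3 x4 x5 x6 => F x1 x2 x3 x4 x5 x6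

end Comultiplication

/-- The counit of a complex coalgebra. -/
noncomputable abbrev eps {C : Type*} [AddCommGroup C] [Module ℂ C] [Coalgebra ℂ C] : C →ₗ[ℂ] ℂ :=
  Coalgebra.counit (R := ℂ) (A := C)

/-- The `*`-bialgebra axioms for a conjugate linear antimultiplicative involution on a complex
bialgebra (`StarRing` provides the additive antimultiplicative involution, `StarModule` the
conjugate linearity): the comultiplication commutes with the involution, where
`(x ⊗ y)* = x* ⊗ y*`. A `*`-Hopf algebra is a `*`-bialgebra that is a Hopf algebra. -/
class IsStarBialgebra (B : Type*) [Ring B] [Bialgebra ℂ B] [StarRing B] : Prop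
    extends StarModule ℂ B where
  comul_star : ∀ x : B,
    Coalgebra.comul (R := ℂ) (star x) = star (Coalgebra.comul (R := ℂ) x)

/-- A cocycle linked pair of bialgebras `(A, H, ▸, ρ, χ, ψ)`: `act x a = x ▸ a`,
`rho x = ∑ x_H ⊗ x_A`, `chi (x ⊗ y) = χ(x, y)`, `psi x = ∑ x_I ⊗ x_II`. -/
structure CocycleLinkedPair (A : Type u) (H : Type v) [Ring A] [Bialgebra ℂ A]
    [Ring H] [Bialgebra ℂ H] where
  act : H →ₗ[ℂ] A →ₗ[ℂ] A
  rho : H →ₗ[ℂ] H ⊗[ℂ] A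
  chi : H ⊗[ℂ] H →ₗ[ℂ] A
  psi : H →ₗ[ℂ] A ⊗[ℂ] A
  -- `(A, ▸, χ)` is a cocycle left `H`-module algebra
  act_one : ∀ x, act x 1 = eps x • (1 : A)
  act_mul : ∀ x a b, act x (a * b) = sw2 x fun x1 x2 => act x1 a * act x2 b
  one_act : ∀ a, act 1 a = a
  act_act : ∀ x y a,
    (sw2 x fun x1 x2 => sw2 y fun y1 y2 => act x1 (act y1 a) * chi (x2 ⊗ₜ y2)) =
      sw2 x fun x1 x2 => sw2 y fun y1 y2 => chi (x1 ⊗ₜ y1) * act (x2 * y2) a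
  chi_cocycle : ∀ x y z,
    (sw2 x fun x1 x2 => sw2 y fun y1 y2 => sw2 z fun z1 z2 =>
      act x1 (chi (y1 ⊗ₜ z1)) * chi (x2 ⊗ₜ (y2 * z2))) =
      sw2 x fun x1 x2 => sw2 y fun y1 y2 => chi (x1 ⊗ₜ y1) * chi ((x2 * y2) ⊗ₜ z)
  chi_one_right : ∀ x, chi (x ⊗ₜ 1) = eps x • (1 : A)
  chi_one_left : ∀ x, chi (1 ⊗ₜ x) = eps x • (1 : A)
  -- `(H, ρ, ψ)` is a cocycle right `A`-comodule coalgebra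
  rho_counit_left : ∀ x, (sw (rho x) fun xH xA => eps xH • xA) = eps x • (1 : A)
  rho_comul : ∀ x,
    (sw (rho x) fun xH xA => sw2 xH fun xH1 xH2 => xH1 ⊗ₜ[ℂ] xH2 ⊗ₜ[ℂ] xA) =
      sw2 x fun x1 x2 => sw (rho x1) fun x1H x1A => sw (rho x2) fun x2H x2A =>
        x1H ⊗ₜ[ℂ] x2H ⊗ₜ[ℂ] (x1A * x2A)
  rho_counit_right : ∀ x, (sw (rho x) fun xH xA => eps xA • xH) = x
  rho_rho : ∀ x,
    (sw2 x fun x1 x2 => sw (psi x1) fun x1I x1II => sw (rho x2) fun x2H x2A =>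
      sw (rho x2H) fun x2HH x2HA =>
        x2HH ⊗ₜ[ℂ] (x1I * x2HA) ⊗ₜ[ℂ] (x1II * x2A)) =
      sw2 x fun x1 x2 => sw (rho x1) fun x1H x1A => sw2 x1A fun x1A1 x1A2 =>
        sw (psi x2) fun x2I x2II =>
          x1H ⊗ₜ[ℂ] (x1A1 * x2I) ⊗ₜ[ℂ] (x1A2 * x2II)
  psi_cocycle : ∀ x,
    (sw2 x fun x1 x2 => sw (psi x1) fun x1I x1II => sw2 x1I fun x1I1 x1I2 =>
      sw (rho x2) fun x2H x2A => sw (psi x2H) fun x2HI x2HII =>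
        (x1I1 * x2HI) ⊗ₜ[ℂ] (x1I2 * x2HII) ⊗ₜ[ℂ] (x1II * x2A)) =
      sw2 x fun x1 x2 => sw (psi x1) fun x1I x1II => sw2 x1II fun x1II1 x1II2 =>
        sw (psi x2) fun x2I x2II =>
          x1I ⊗ₜ[ℂ] (x1II1 * x2I) ⊗ₜ[ℂ] (x1II2 * x2II)
  psi_counit_left : ∀ x, (sw (psi x) fun xI xII => eps xI • xII) = eps x • (1 : A)
  psi_counit_right : ∀ x, (sw (psi x) fun xI xII => eps xII • xI) = eps x • (1 : A)
  -- compatibility relations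
  counit_act : ∀ x a, eps (act x a) = eps x * eps a
  rho_one : rho 1 = 1 ⊗ₜ 1
  counit_chi : ∀ x y, eps (chi (x ⊗ₜ y)) = eps x * eps y
  psi_one : psi 1 = 1 ⊗ₜ 1
  act_psi : ∀ x a,
    (sw2 x fun x1 x2 => sw2 (act x1 a) fun b1 b2 => sw (psi x2) fun x2I x2II =>
      (b1 * x2I) ⊗ₜ[ℂ] (b2 * x2II)) =
      sw3 x fun x1 x2 x3 => sw (psi x1) fun x1I x1II => sw (rho x2) fun x2H x2A =>
        sw2 a fun a1 a2 =>
          (x1I * act x2H a1) ⊗ₜ[ℂ] (x1II * x2A * act x3 a2)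
  rho_mul : ∀ x y,
    (sw2 x fun x1 x2 => sw2 y fun y1 y2 => sw (rho (x2 * y2)) fun zH zA =>
      zH ⊗ₜ[ℂ] (chi (x1 ⊗ₜ y1) * zA)) =
      sw3 x fun x1 x2 x3 => sw2 y fun y1 y2 => sw (rho x1) fun x1H x1A =>
        sw (rho y1) fun y1H y1A =>
          (x1H * y1H) ⊗ₜ[ℂ] (x1A * act x2 y1A * chi (x3 ⊗ₜ y2))
  act_rho : ∀ x a,
    (sw2 x fun x1 x2 => sw (rho x2) fun x2H x2A => x2H ⊗ₜ[ℂ] (act x1 a * x2A)) =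
      sw2 x fun x1 x2 => sw (rho x1) fun x1H x1A => x1H ⊗ₜ[ℂ] (x1A * act x2 a)
  chi_psi : ∀ x y,
    (sw2 x fun x1 x2 => sw2 y fun y1 y2 => sw2 (chi (x1 ⊗ₜ y1)) fun c1 c2 =>
      sw (psi (x2 * y2)) fun zI zII => (c1 * zI) ⊗ₜ[ℂ] (c2 * zII)) =
      sw6 x fun x1 x2 x3 x4 x5 x6 => sw3 y fun y1 y2 y3 =>
        sw (psi x1) fun x1I x1II => sw (rho x2) fun x2H x2A => sw (rho x4) fun x4H x4A =>
        sw (psi y1) fun y1I y1II => sw (rho y2) fun y2H y2A =>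
          (x1I * act x2H y1I * chi (x4H ⊗ₜ y2H)) ⊗ₜ[ℂ]
            (x1II * x2A * act x3 y1II * x4A * act x5 y2A * chi (x6 ⊗ₜ y3))

namespace CocycleLinkedPair

variable {A : Type u} {H : Type v} [Ring A] [HopfAlgebra ℂ A] [Ring H] [HopfAlgebra ℂ H]

/-- `M` is the cocycle bismash product `A^ψ #_χ H`, as a Hopf algebra: the underlying vector space
of `M` is `A ⊗ H` (through `e`, and `a # x = e (a ⊗ x)`), and its unit, product, counit and
coproduct are the ones of the cocycle bismash product. -/
structure BismashProduct (L : CocycleLinkedPair A H) (M : Type w) [Ring M] [HopfAlgebra ℂ M] where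
  e : A ⊗[ℂ] H ≃ₗ[ℂ] M
  one_eq : (1 : M) = e (1 ⊗ₜ 1)
  mul_eq : ∀ a x b y, e (a ⊗ₜ x) * e (b ⊗ₜ y) =
    sw3 x fun x1 x2 x3 => sw2 y fun y1 y2 =>
      e ((a * L.act x1 b * L.chi (x2 ⊗ₜ y1)) ⊗ₜ (x3 * y2))
  counit_eq : ∀ a x, eps (e (a ⊗ₜ x)) = eps a * eps x
  comul_eq : ∀ a x, Coalgebra.comul (R := ℂ) (e (a ⊗ₜ x)) =
    sw2 a fun a1 a2 => sw3 x fun x1 x2 x3 =>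
      sw (L.psi x1) fun x1I x1II => sw (L.rho x2) fun x2H x2A =>
        e ((a1 * x1I) ⊗ₜ x2H) ⊗ₜ[ℂ] e ((a2 * x1II * x2A) ⊗ₜ x3)

variable [StarRing A] [StarRing H]

/-- The compatibility conditions (cero), (uno), (dos), (tres), (cuatro) between the star
structures of `A` and `H`, the cocycle linked pair and the linear map `γ : H → A`. -/
structure StarConditions (L : CocycleLinkedPair A H) (γ : H →ₗ[ℂ] A) : Prop where
  cero : ∀ x,
    (sw3 x fun x1 x2 x3 => γ (star x2) * L.act (star x3) (star (γ x1))) =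
      eps (star x) • (1 : A)
  uno : ∀ x a,
    (sw3 x fun x1 x2 x3 => γ (star x2) * L.act (star x3) (star (L.act x1 a))) =
      star a * γ (star x)
  dos : ∀ x y,
    (sw2 x fun x1 x2 => sw3 y fun y1 y2 y3 =>
      γ (star y1) * L.act (star y2) (γ (star x1)) * L.chi (star y3 ⊗ₜ star x2)) =
      sw3 x fun x1 x2 x3 => sw3 y fun y1 y2 y3 =>
        γ (star y2 * star x2) * L.act (star y3 * star x3) (star (L.chi (x1 ⊗ₜ y1)))
  tres : ∀ x,
    (sw2 x fun x1 x2 => sw (L.rho (star x2)) fun zH zA => zH ⊗ₜ[ℂ] (γ (star x1) * zA)) =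
      sw3 x fun x1 x2 x3 => sw (L.rho x1) fun x1H x1A =>
        star x1H ⊗ₜ[ℂ] (γ (star x2) * L.act (star x3) (star x1A))
  cuatro : ∀ x,
    (sw2 x fun x1 x2 => sw2 (γ (star x1)) fun g1 g2 => sw (L.psi (star x2)) fun zI zII =>
      (g1 * zI) ⊗ₜ[ℂ] (g2 * zII)) =
      sw5 x fun x1 x2 x3 x4 x5 => sw (L.psi x1) fun x1I x1II =>
        sw (L.rho x2) fun x2H x2A => sw (L.rho x3) fun x3H x3A =>
          (γ (star x2H) * L.act (star x3H) (star x1I)) ⊗ₜ[ℂ]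
            (γ (star x4) * L.act (star x5) (star (x1II * x2A * x3A)))

/-- The star `S` on the cocycle bismash product `M` is given by
`(a # x)* = ∑ γ(x₁*) (x₂* ▸ a*) # x₃*`. -/
def BismashProduct.StarFormula {L : CocycleLinkedPair A H} {M : Type w} [Ring M]
    [HopfAlgebra ℂ M] (B : L.BismashProduct M) (γ : H →ₗ[ℂ] A) (S : StarRing M) : Prop :=
  ∀ a x, S.star (B.e (a ⊗ₜ x)) =
    sw3 x fun x1 x2 x3 => B.e ((γ (star x1) * L.act (star x2) (star a)) ⊗ₜ star x3)

end CocycleLinkedPair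

section Extension

variable {A M H : Type*} [Ring A] [HopfAlgebra ℂ A] [Ring M] [HopfAlgebra ℂ M]
  [Ring H] [HopfAlgebra ℂ H]

/-- `A → M → H` is an extension of Hopf algebras (an exact sequence of Hopf algebras). -/
structure IsHopfExtension (ι : A →ₐc[ℂ] M) (π : M →ₐc[ℂ] H) : Prop where
  antipode_ι : ∀ a, ι (HopfAlgebra.antipode ℂ a) = HopfAlgebra.antipode ℂ (ι a)
  antipode_π : ∀ m, π (HopfAlgebra.antipode ℂ m) = HopfAlgebra.antipode ℂ (π m)
  injective : Function.Injective ι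
  surjective : Function.Surjective π
  range_eq_coinvariants : ∀ m : M, m ∈ Set.range ι ↔
    (sw2 m fun m1 m2 => m1 ⊗ₜ[ℂ] π m2) = m ⊗ₜ[ℂ] 1
  ker_eq : ∀ m : M, π m = 0 ↔
    m ∈ Submodule.span ℂ {n : M | ∃ (m' : M) (a : A), eps a = 0 ∧ n = m' * ι a}

/-- `A → M → H` is an extension of `*`-Hopf algebras. -/
structure IsStarHopfExtension [StarRing A] [StarRing M] [StarRing H]
    (ι : A →ₐc[ℂ] M) (π : M →ₐc[ℂ] H) : Prop extends IsHopfExtension ι π where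
  star_left : IsStarBialgebra A
  star_mid : IsStarBialgebra M
  star_right : IsStarBialgebra H
  ι_star : ∀ a, ι (star a) = star (ι a)
  π_star : ∀ m, π (star m) = star (π m)

end Extension

/-! The Sweedler identities are handled as equations in convolution algebras Hom(C, R), for C = H, H
⊗ H or H ⊗ H ⊗ H and varying R. The coaction becomes an algebra map `hat`, f ↦ (f ⊗ id)ρ, and each
axiom of a cocycle linked pair becomes a commutation rule between short products. Long nested sums
are expanded only to identify these products with the stated formulas.

The algebra: A ⊗ H carries operators representing a # 1 and 1 # x. They satisfy the crossed product
relations (`opJ_mul_opJ`), so their span M is an algebra, associative because composition of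
operators is. Evaluation at 1 ⊗ 1 identifies M with A ⊗ H. With i(a) = a # 1 and j(x) = 1 # x,
algebra maps out of M are given by the images of i and j subject to the same relations
(`CrossedProduct.lift`). The coproduct and counit are constructed this way, so they are
multiplicative from the start; coassociativity and counitality are compared on i and j only
(`map_comulLeftHom_comulJ`).

The antipode: in Hom(M, M) the identity factors as (i ∘ p) * (j ∘ π), with p(a # x) = ε(x)a and π(a
# x) = ε(a)x (`id_eq_mul`). A map f : C → R is convolution invertible exactly when r ⊗ c ↦ ∑ r f(c₁)
⊗ c₂ is bijective. For j this shift is built from the shift of χ and that of the identity of H; for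
p, from the shift of ψ and that of the identity of A. Invertibility of χ and ψ and the two antipodes
thus make the identity of M invertible.

The star: put θ = (i ∘ γ) * j. The proposed involution sends i(a)j(x) to θ(x*)i(a*). Since M is free
over A along j, the conditions can be read off as coefficients: (cero) says that the map squares to
the identity on j(x), (uno) that it reverses the products j(x)i(a), (dos) that it reverses j(x)j(y).
Given that the map is a star, (tres) and (cuatro) together say that Δ commutes with it on j(x):
applying π ⊗ id to that equation gives (tres), and once (tres) is known a common right factor
cancels and leaves (cuatro) (`comul_star_j_iff`). As i and j generate M, these cases suffice.

The extension: the factorization of the identity computes the coinvariants. For the kernel, the star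
turns A-coefficients on the left into A-coefficients on the right, which exhibits ker π as M ι(A⁺)
(`toH_eq_zero_iff`). -/

set_option linter.unusedSectionVars false
set_option linter.unusedSimpArgs false

/-! ### Formal rules for Sweedler sums. -/

section SweedlerSums

variable {V W V' W' X Y : Type*} [AddCommGroup V] [Module ℂ V] [AddCommGroup W] [Module ℂ W]
  [AddCommGroup V'] [Module ℂ V'] [AddCommGroup W'] [Module ℂ W']

theorem sw_congr [AddCommMonoid X] {t : V ⊗[ℂ] W} {F G : V → W → X}
    (h : ∀ v w, F v w = G v w) : sw t F = sw t G := by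
  rw [funext₂ h]

theorem map_sw [AddCommMonoid X] [AddCommMonoid Y] {G : Type*} [FunLike G X Y]
    [AddMonoidHomClass G X Y] (g : G) (t : V ⊗[ℂ] W) (F : V → W → X) :
    g (sw t F) = sw t fun v w => g (F v w) :=
  map_sum g _ _

/-- An additive map sees only the total of the chosen pure tensors, which is `t`. Read from right to
left, this expands any value of a linear map as a Sweedler sum. -/
theorem sw_tmul_apply [AddCommMonoid X] {G : Type*} [FunLike G (V ⊗[ℂ] W) X]
    [AddMonoidHomClass G (V ⊗[ℂ] W) X] (g : G) (t : V ⊗[ℂ] W) :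
    (sw t fun v w => g (v ⊗ₜ w)) = g t := by
  rw [← map_sw g]
  congr 1
  exact (TensorProduct.exists_finset t).choose_spec.symm

theorem sw_self (t : V ⊗[ℂ] W) : (sw t fun v w => v ⊗ₜ[ℂ] w) = t :=
  sw_tmul_apply (LinearMap.id (R := ℂ) (M := V ⊗[ℂ] W)) t

/-- Each decomposition depends only on its tensor, so independent sums can be exchanged without any
linearity of `F`. -/
theorem sw_comm [AddCommMonoid X] (t : V ⊗[ℂ] W) (s : V' ⊗[ℂ] W') (F : V → W → V' → W' → X) :
    (sw t fun v w => sw s fun v' w' => F v w v' w') =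
      sw s fun v' w' => sw t fun v w => F v w v' w' :=
  Finset.sum_comm

theorem mul_sw [NonUnitalNonAssocSemiring X] (r : X) (t : V ⊗[ℂ] W) (F : V → W → X) :
    r * sw t F = sw t fun v w => r * F v w :=
  Finset.mul_sum _ _ _

theorem sw_mul [NonUnitalNonAssocSemiring X] (r : X) (t : V ⊗[ℂ] W) (F : V → W → X) :
    sw t F * r = sw t fun v w => F v w * r :=
  Finset.sum_mul _ _ _

theorem tmul_sw [AddCommGroup X] [Module ℂ X] [AddCommGroup Y] [Module ℂ Y]
    (r : Y) (t : V ⊗[ℂ] W) (F : V → W → X) :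
    r ⊗ₜ[ℂ] sw t F = sw t fun v w => r ⊗ₜ[ℂ] F v w :=
  TensorProduct.tmul_sum _ _ _

theorem sw_tmul [AddCommGroup X] [Module ℂ X] [AddCommGroup Y] [Module ℂ Y]
    (r : Y) (t : V ⊗[ℂ] W) (F : V → W → X) :
    sw t F ⊗ₜ[ℂ] r = sw t fun v w => F v w ⊗ₜ[ℂ] r :=
  TensorProduct.sum_tmul _ _ _

theorem sw_apply [AddCommGroup X] [Module ℂ X] [AddCommGroup Y] [Module ℂ Y]
    (r : Y) (t : V ⊗[ℂ] W) (F : V → W → Y →ₗ[ℂ] X) :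
    sw t F r = sw t fun v w => F v w r :=
  LinearMap.sum_apply _ _ _

end SweedlerSums

/-! ### Convolution algebras, pullbacks and slices. -/

section Convolution

open WithConv

variable {C D R S : Type*} [AddCommGroup C] [Module ℂ C] [Coalgebra ℂ C]
  [AddCommGroup D] [Module ℂ D] [Coalgebra ℂ D] [Ring R] [Algebra ℂ R] [Ring S] [Algebra ℂ S]

theorem sw2_tmul_apply {X : Type*} [AddCommMonoid X] {G : Type*} [FunLike G (C ⊗[ℂ] C) X]
    [AddMonoidHomClass G (C ⊗[ℂ] C) X] (g : G) (x : C) :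
    (sw2 x fun a b => g (a ⊗ₜ b)) = g (Coalgebra.comul x) :=
  sw_tmul_apply g _

theorem sw2_self (x : C) : (sw2 x fun a b => a ⊗ₜ[ℂ] b) = Coalgebra.comul x :=
  sw_self _

/-- The chosen decomposition of Δ(x ⊗ y) is unrelated to those of Δ(x) and Δ(y); the comparison is
possible because `g` is linear. -/
theorem sw2_tmul {X : Type*} [AddCommGroup X] [Module ℂ X]
    (g : (C ⊗[ℂ] D) ⊗[ℂ] (C ⊗[ℂ] D) →ₗ[ℂ] X) (x : C) (y : D) :
    (sw2 (x ⊗ₜ[ℂ] y) fun p q => g (p ⊗ₜ q)) =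
      sw2 x fun x1 x2 => sw2 y fun y1 y2 => g ((x1 ⊗ₜ y1) ⊗ₜ (x2 ⊗ₜ y2)) := by
  rw [sw2_tmul_apply, TensorProduct.comul_tmul, ← sw2_self x, ← sw2_self y]
  simp only [sw2, map_sw, sw_tmul, tmul_sw]
  rw [sw_comm]
  rfl

/-- The convolution algebra of linear maps from a complex coalgebra to a complex algebra. -/
abbrev Conv (C R : Type*) [AddCommGroup C] [Module ℂ C] [Ring R] [Algebra ℂ R] :=
  WithConv (C →ₗ[ℂ] R)

theorem Conv.ext' {f g : Conv C R} (h : ∀ x, f x = g x) : f = g :=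
  WithConv.ext (LinearMap.ext h)

theorem Conv.mul_apply (f g : Conv C R) (x : C) :
    (f * g) x = sw2 x fun x1 x2 => f x1 * g x2 :=
  (sw2_tmul_apply (LinearMap.mul' ℂ R ∘ₗ TensorProduct.map f.ofConv g.ofConv) x).symm

theorem Conv.mul_apply_tmul (f g : Conv (C ⊗[ℂ] D) R) (x : C) (y : D) :
    (f * g) (x ⊗ₜ y) = sw2 x fun x1 x2 => sw2 y fun y1 y2 => f (x1 ⊗ₜ y1) * g (x2 ⊗ₜ y2) :=
  (Conv.mul_apply f g _).trans
    (sw2_tmul (LinearMap.mul' ℂ R ∘ₗ TensorProduct.map f.ofConv g.ofConv) x y)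

theorem Conv.one_apply (x : C) : (1 : Conv C R) x = eps x • (1 : R) := by
  rw [LinearMap.convOne_apply, Algebra.algebraMap_eq_smul_one]

/-- Composition with an algebra map. -/
noncomputable def Conv.map (φ : R →ₐ[ℂ] S) : Conv C R →ₐ[ℂ] Conv C S :=
  AlgHom.ofLinearMap
    { toFun := fun f => toConv (φ.toLinearMap ∘ₗ f.ofConv)
      map_add' := fun f g => Conv.ext' fun x => by simp
      map_smul' := fun c f => Conv.ext' fun x => by simp }
    (Conv.ext' fun x => by simp)
    fun f g => WithConv.ext (LinearMap.algHom_comp_convMul_distrib φ f g)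

/-- Composition with a coalgebra map. -/
noncomputable def Conv.comap (φ : C →ₗc[ℂ] D) : Conv D R →ₐ[ℂ] Conv C R :=
  AlgHom.ofLinearMap
    { toFun := fun f => toConv (f.ofConv ∘ₗ φ.toLinearMap)
      map_add' := fun f g => Conv.ext' fun x => by simp
      map_smul' := fun c f => Conv.ext' fun x => by simp }
    (Conv.ext' fun x => by simp)
    fun f g => WithConv.ext (LinearMap.convMul_comp_coalgHom_distrib f g φ)

@[simp] theorem Conv.map_apply (φ : R →ₐ[ℂ] S) (f : Conv C R) (x : C) :
    Conv.map φ f x = φ (f x) := rfl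

@[simp] theorem Conv.comap_apply (φ : C →ₗc[ℂ] D) (f : Conv D R) (x : C) :
    Conv.comap φ f x = f (φ x) := rfl

theorem sw2_counit_left (x : C) : (sw2 x fun x1 x2 => eps x1 • x2) = x := by
  have h := sw2_tmul_apply ((TensorProduct.lid ℂ C).toLinearMap ∘ₗ LinearMap.rTensor C (eps (C := C))) x
  simpa using h

theorem sw2_counit_right (x : C) : (sw2 x fun x1 x2 => eps x2 • x1) = x := by
  have h := sw2_tmul_apply ((TensorProduct.rid ℂ C).toLinearMap ∘ₗ LinearMap.lTensor C (eps (C := C))) x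
  simpa using h

variable (C) in
/-- The constant convolution elements `x ↦ ε(x) r`. -/
noncomputable def Conv.const : R →ₗ[ℂ] Conv C R where
  toFun r := toConv (LinearMap.toSpanSingleton ℂ R r ∘ₗ eps)
  map_add' r s := Conv.ext' fun x => by simp
  map_smul' c r := Conv.ext' fun x => smul_comm _ _ _

@[simp] theorem Conv.const_apply (r : R) (x : C) : Conv.const C r x = eps x • r := rfl

/-- The counit axiom makes convolution with a constant a pointwise product, so a fixed element of
the target can be moved through a convolution identity. -/
theorem Conv.const_mul_apply (r : R) (f : Conv C R) (x : C) :
    (Conv.const C r * f) x = r * f x := by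
  conv_rhs => rw [← sw2_counit_left x]
  simp [-LinearMap.convMul_apply, Conv.mul_apply, sw2, map_sw, mul_sw]

theorem Conv.mul_const_apply (r : R) (f : Conv C R) (x : C) :
    (f * Conv.const C r) x = f x * r := by
  conv_rhs => rw [← sw2_counit_right x]
  simp [-LinearMap.convMul_apply, Conv.mul_apply, sw2, map_sw, sw_mul]

@[simp] theorem Conv.const_one : Conv.const C (1 : R) = 1 :=
  Conv.ext' fun x => by rw [Conv.one_apply, Conv.const_apply]

theorem Conv.const_mul (r s : R) : Conv.const C (r * s) = Conv.const C r * Conv.const C s :=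
  Conv.ext' fun x => by simp [-LinearMap.convMul_apply, Conv.const_mul_apply]

@[simp] theorem Conv.map_const (φ : R →ₐ[ℂ] S) (r : R) :
    Conv.map φ (Conv.const C r) = Conv.const C (φ r) :=
  Conv.ext' fun x => by simp

@[simp] theorem Conv.map_toConv (φ : R →ₐ[ℂ] S) (f : C →ₗ[ℂ] R) (x : C) :
    (Conv.map φ (toConv f)) x = φ (f x) := rfl

theorem Conv.map_map {T : Type*} [Ring T] [Algebra ℂ T] (φ : R →ₐ[ℂ] S) (θ : S →ₐ[ℂ] T)
    (f : Conv C R) : Conv.map θ (Conv.map φ f) = Conv.map (θ.comp φ) f := rfl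

theorem Conv.map_injective {φ : R →ₐ[ℂ] S} (h : Function.Injective φ) :
    Function.Injective (Conv.map (C := C) φ) := fun _ _ hfg =>
  Conv.ext' fun x => h (LinearMap.congr_fun (congrArg WithConv.ofConv hfg) x)

theorem Conv.map_comap (φ : R →ₐ[ℂ] S) (θ : C →ₗc[ℂ] D) (f : Conv D R) :
    Conv.map φ (Conv.comap θ f) = Conv.comap θ (Conv.map φ f) := rfl

variable (C D) in
/-- The projection `x ⊗ y ↦ ε(y) x`. -/
noncomputable def tensorFst : C ⊗[ℂ] D →ₗc[ℂ] C :=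
  (Coalgebra.TensorProduct.rid ℂ ℂ C : C ⊗[ℂ] ℂ →ₗc[ℂ] C).comp
    (Coalgebra.TensorProduct.map (CoalgHom.id ℂ C) (Coalgebra.counitCoalgHom ℂ D))

variable (C D) in
/-- The projection `x ⊗ y ↦ ε(x) y`. -/
noncomputable def tensorSnd : C ⊗[ℂ] D →ₗc[ℂ] D :=
  (Coalgebra.TensorProduct.lid ℂ D : ℂ ⊗[ℂ] D →ₗc[ℂ] D).comp
    (Coalgebra.TensorProduct.map (Coalgebra.counitCoalgHom ℂ C) (CoalgHom.id ℂ D))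

@[simp] theorem tensorFst_tmul (x : C) (y : D) : tensorFst C D (x ⊗ₜ y) = eps y • x := rfl

@[simp] theorem tensorSnd_tmul (x : C) (y : D) : tensorSnd C D (x ⊗ₜ y) = eps x • y := rfl

/-- The restrictions `f(- ⊗ y)` of a linear map on a tensor product. -/
noncomputable def Conv.slice (f : Conv (C ⊗[ℂ] D) R) : D →ₗ[ℂ] Conv C R where
  toFun y := toConv (f.ofConv ∘ₗ (TensorProduct.mk ℂ C D).flip y)
  map_add' y z := Conv.ext' fun x => by simp
  map_smul' c y := Conv.ext' fun x => by simp

@[simp] theorem Conv.slice_apply (f : Conv (C ⊗[ℂ] D) R) (y : D) (x : C) :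
    f.slice y x = f (x ⊗ₜ y) := rfl

theorem Conv.ext_slice {f g : Conv (C ⊗[ℂ] D) R} (h : ∀ y, f.slice y = g.slice y) : f = g :=
  WithConv.ext <| TensorProduct.ext' fun x y => congrArg (fun k : Conv C R => k x) (h y)

theorem Conv.ext_tmul {f g : Conv (C ⊗[ℂ] D) R} (h : ∀ x y, f (x ⊗ₜ y) = g (x ⊗ₜ y)) : f = g :=
  WithConv.ext <| TensorProduct.ext' h

/-- The first factor involves `y` only through its counit, so the coproduct of `y` collapses. -/
theorem Conv.comap_fst_mul_tmul (f : Conv C R) (g : Conv (C ⊗[ℂ] D) R) (x : C) (y : D) :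
    (Conv.comap (tensorFst C D) f * g) (x ⊗ₜ y) = sw2 x fun x1 x2 => f x1 * g (x2 ⊗ₜ y) := by
  conv_rhs => rw [← sw2_counit_left y]
  simp [-LinearMap.convMul_apply, Conv.mul_apply_tmul, sw2, map_sw, tmul_sw, mul_sw]

theorem Conv.mul_comap_fst_tmul (f : Conv C R) (g : Conv (C ⊗[ℂ] D) R) (x : C) (y : D) :
    (g * Conv.comap (tensorFst C D) f) (x ⊗ₜ y) = sw2 x fun x1 x2 => g (x1 ⊗ₜ y) * f x2 := by
  conv_rhs => rw [← sw2_counit_right y]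
  simp [-LinearMap.convMul_apply, Conv.mul_apply_tmul, sw2, map_sw, tmul_sw, sw_mul]

theorem Conv.mul_comap_snd_tmul (f : Conv D R) (g : Conv (C ⊗[ℂ] D) R) (x : C) (y : D) :
    (g * Conv.comap (tensorSnd C D) f) (x ⊗ₜ y) = sw2 y fun y1 y2 => g (x ⊗ₜ y1) * f y2 := by
  conv_rhs => rw [← sw2_counit_right x]
  simp only [Conv.mul_apply_tmul, sw2, map_sw, sw_tmul, sw_mul]
  rw [sw_comm]
  simp [← TensorProduct.smul_tmul']

theorem Conv.comap_fst_mul_comap_snd_tmul (f : Conv C R) (g : Conv D R) (x : C) (y : D) :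
    (Conv.comap (tensorFst C D) f * Conv.comap (tensorSnd C D) g) (x ⊗ₜ y) = f x * g y := by
  rw [Conv.comap_fst_mul_tmul, ← Conv.mul_const_apply, Conv.mul_apply]
  exact sw_congr fun x1 x2 => by simp

/-- Fixing the second variable turns an identity in two variables into one in the convolution
algebra of `C`, where the one-variable commutation rules apply. -/
theorem Conv.slice_comap_fst_mul (f : Conv C R) (g : Conv (C ⊗[ℂ] D) R) (y : D) :
    (Conv.comap (tensorFst C D) f * g).slice y = f * g.slice y :=
  Conv.ext' fun x => by
    rw [Conv.slice_apply, Conv.comap_fst_mul_tmul, Conv.mul_apply]; rfl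

/-- The linear map `x ⊗ y ↦ g y x`. -/
noncomputable def Conv.uncurry (g : D →ₗ[ℂ] Conv C R) : Conv (C ⊗[ℂ] D) R :=
  toConv (TensorProduct.lift ((WithConv.linearEquiv ℂ (C →ₗ[ℂ] R)).toLinearMap ∘ₗ g).flip)

@[simp] theorem Conv.slice_uncurry (g : D →ₗ[ℂ] Conv C R) (y : D) :
    (Conv.uncurry g).slice y = g y := rfl

theorem Conv.sw_apply {V W : Type*} [AddCommGroup V] [Module ℂ V] [AddCommGroup W] [Module ℂ W]
    (t : V ⊗[ℂ] W) (F : V → W → Conv C R) (x : C) :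
    (sw t F : Conv C R) x = sw t fun v w => F v w x := by
  change WithConv.linearEquiv ℂ (C →ₗ[ℂ] R) (sw _ _) x = _
  rw [map_sw, _root_.sw_apply]
  rfl

theorem Conv.slice_mul_comap_fst (f : Conv C R) (g : Conv (C ⊗[ℂ] D) R) (y : D) :
    (g * Conv.comap (tensorFst C D) f).slice y = g.slice y * f :=
  Conv.ext' fun x => by
    rw [Conv.slice_apply, Conv.mul_comap_fst_tmul, Conv.mul_apply]; rfl

theorem Conv.slice_comap_snd (f : Conv D R) (y : D) :
    (Conv.comap (tensorSnd C D) f).slice y = Conv.const C (f y) :=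
  Conv.ext' fun x => by simp

theorem Conv.slice_mul (f g : Conv (C ⊗[ℂ] D) R) (y : D) :
    (f * g).slice y = sw2 y fun y1 y2 => f.slice y1 * g.slice y2 :=
  Conv.ext' fun x => by
    rw [Conv.slice_apply, Conv.mul_apply_tmul]
    simp only [sw2]
    rw [sw_comm]
    rw [Conv.sw_apply]
    refine sw_congr fun y1 y2 => ?_
    exact (Conv.mul_apply (f.slice y1) (g.slice y2) x).symm

end Convolution

/-! ### Action, cocycle and coaction in the convolution algebras. -/

namespace CocycleLinkedPair

open WithConv

variable {A : Type u} {H : Type v} [Ring A] [Bialgebra ℂ A] [Ring H] [Bialgebra ℂ H]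
  (L : CocycleLinkedPair A H) {R S : Type*} [Ring R] [Algebra ℂ R] [Ring S] [Algebra ℂ S]

/-- The inclusion `r ↦ r ⊗ 1`. -/
noncomputable abbrev inl (R S : Type*) [Ring R] [Algebra ℂ R] [Ring S] [Algebra ℂ S] :
    R →ₐ[ℂ] R ⊗[ℂ] S := Algebra.TensorProduct.includeLeft

/-- The inclusion `s ↦ 1 ⊗ s`. -/
noncomputable abbrev inr (R S : Type*) [Ring R] [Algebra ℂ R] [Ring S] [Algebra ℂ S] :
    S →ₐ[ℂ] R ⊗[ℂ] S := Algebra.TensorProduct.includeRight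

/-- The maps `x ↦ x ▸ a`. -/
noncomputable def actBy : A →ₗ[ℂ] Conv H A :=
  (WithConv.linearEquiv ℂ (H →ₗ[ℂ] A)).symm.toLinearMap ∘ₗ L.act.flip

@[simp] theorem actBy_apply (a : A) (x : H) : L.actBy a x = L.act x a := rfl

theorem actBy_one : L.actBy 1 = 1 :=
  Conv.ext' fun x => by rw [actBy_apply, L.act_one, Conv.one_apply]

theorem actBy_mul (a b : A) : L.actBy (a * b) = L.actBy a * L.actBy b :=
  Conv.ext' fun x => by simp only [actBy_apply, L.act_mul, Conv.mul_apply]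

/-- The map `x ⊗ y ↦ x ▸ f y`. -/
noncomputable def actOn {D : Type*} [AddCommGroup D] [Module ℂ D] (f : D →ₗ[ℂ] A) :
    Conv (H ⊗[ℂ] D) A :=
  toConv (TensorProduct.lift (L.act.compl₂ f))

theorem slice_actOn {D : Type*} [AddCommGroup D] [Module ℂ D] [Coalgebra ℂ D]
    (f : D →ₗ[ℂ] A) (d : D) : (L.actOn f).slice d = L.actBy (f d) := rfl

/-- The cocycle `χ` in the convolution algebra. -/
noncomputable def chiC : Conv (H ⊗[ℂ] H) A := toConv L.chi

@[simp] theorem chiC_apply (t : H ⊗[ℂ] H) : L.chiC t = L.chi t := rfl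

/-- The cocycle `ψ` in the convolution algebra. -/
noncomputable def psiC : Conv H (A ⊗[ℂ] A) := toConv L.psi

theorem psiC_apply (x : H) : L.psiC x = sw (L.psi x) fun a b => a ⊗ₜ[ℂ] b :=
  (sw_self (L.psi x)).symm

theorem comulAlgHom_apply_eq_sw (a : A) :
    Bialgebra.comulAlgHom ℂ A a =
      sw (Coalgebra.comul (R := ℂ) a) fun a1 a2 => a1 ⊗ₜ[ℂ] a2 :=
  (sw_self (Coalgebra.comul a)).symm

/-- The multiplication of `H` as a coalgebra map. -/
noncomputable abbrev mulH (H : Type v) [Ring H] [Bialgebra ℂ H] : H ⊗[ℂ] H →ₗc[ℂ] H :=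
  Bialgebra.mulCoalgHom ℂ H

theorem actOn_mul_chiC (a : A) :
    L.actOn (L.act.flip a) * L.chiC = L.chiC * Conv.comap (mulH H) (L.actBy a) :=
  Conv.ext_tmul fun x y => by
    simp only [Conv.mul_apply_tmul]
    exact L.act_act x y a

/-- The map `x ⊗ (y ⊗ z) ↦ x ⊗ y`, twisted by the counit. -/
noncomputable def triFst (H : Type v) [Ring H] [Bialgebra ℂ H] :
    H ⊗[ℂ] (H ⊗[ℂ] H) →ₗc[ℂ] H ⊗[ℂ] H :=
  Coalgebra.TensorProduct.map (CoalgHom.id ℂ H) (tensorFst H H)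

/-- The map `x ⊗ (y ⊗ z) ↦ x ⊗ y z`. -/
noncomputable def triMulRight (H : Type v) [Ring H] [Bialgebra ℂ H] :
    H ⊗[ℂ] (H ⊗[ℂ] H) →ₗc[ℂ] H ⊗[ℂ] H :=
  Coalgebra.TensorProduct.map (CoalgHom.id ℂ H) (mulH H)

/-- The map `x ⊗ (y ⊗ z) ↦ x y ⊗ z`. -/
noncomputable def triMulLeft (H : Type v) [Ring H] [Bialgebra ℂ H] :
    H ⊗[ℂ] (H ⊗[ℂ] H) →ₗc[ℂ] H ⊗[ℂ] H :=
  (Coalgebra.TensorProduct.map (mulH H) (CoalgHom.id ℂ H)).comp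
    ((Coalgebra.TensorProduct.assoc ℂ ℂ H H H).symm : H ⊗[ℂ] (H ⊗[ℂ] H) →ₗc[ℂ] (H ⊗[ℂ] H) ⊗[ℂ] H)

@[simp] theorem triFst_tmul (x y z : H) : triFst H (x ⊗ₜ (y ⊗ₜ z)) = x ⊗ₜ (eps z • y) := rfl
@[simp] theorem triMulRight_tmul (x y z : H) :
    triMulRight H (x ⊗ₜ (y ⊗ₜ z)) = x ⊗ₜ (y * z) := rfl
@[simp] theorem triMulLeft_tmul (x y z : H) :
    triMulLeft H (x ⊗ₜ (y ⊗ₜ z)) = (x * y) ⊗ₜ z := rfl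

theorem conv_mul_apply_tmul₃ (f g : Conv (H ⊗[ℂ] (H ⊗[ℂ] H)) R) (x y z : H) :
    (f * g) (x ⊗ₜ (y ⊗ₜ z)) = sw2 x fun x1 x2 => sw2 y fun y1 y2 => sw2 z fun z1 z2 =>
      f (x1 ⊗ₜ (y1 ⊗ₜ z1)) * g (x2 ⊗ₜ (y2 ⊗ₜ z2)) := by
  rw [Conv.mul_apply_tmul]
  refine sw_congr fun x1 x2 => ?_
  exact sw2_tmul (LinearMap.mul' ℂ R ∘ₗ TensorProduct.map
    (f.ofConv ∘ₗ TensorProduct.mk ℂ _ _ x1) (g.ofConv ∘ₗ TensorProduct.mk ℂ _ _ x2)) y z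

theorem comap_triFst_mul_apply (f : Conv (H ⊗[ℂ] H) R) (g : Conv (H ⊗[ℂ] (H ⊗[ℂ] H)) R)
    (x y z : H) : (Conv.comap (triFst H) f * g) (x ⊗ₜ (y ⊗ₜ z)) =
      sw2 x fun x1 x2 => sw2 y fun y1 y2 => f (x1 ⊗ₜ y1) * g (x2 ⊗ₜ (y2 ⊗ₜ z)) := by
  conv_rhs => rw [← sw2_counit_left z]
  simp [-LinearMap.convMul_apply, conv_mul_apply_tmul₃, sw2, map_sw, tmul_sw, mul_sw]

/-- This is `chi_cocycle` with all factors pulled back to H ⊗ H ⊗ H; the pullback along `triFst`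
supplies the counit in the third variable that χ(x, y) does not see. -/
theorem chi_cocycle_conv :
    L.actOn L.chi * Conv.comap (triMulRight H) L.chiC =
      Conv.comap (triFst H) L.chiC * Conv.comap (triMulLeft H) L.chiC :=
  WithConv.ext <| TensorProduct.ext' fun x t => by
    induction t with
    | zero => simp
    | add s t hs ht => rw [TensorProduct.tmul_add, map_add, map_add, hs, ht]
    | tmul y z =>
      rw [comap_triFst_mul_apply, conv_mul_apply_tmul₃]
      exact L.chi_cocycle x y z

/-- The map `f ↦ (f ⊗ id) ρ`. -/
noncomputable def hatLinear : Conv H R →ₗ[ℂ] Conv H (R ⊗[ℂ] A) where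
  toFun f := toConv (LinearMap.rTensor A f.ofConv ∘ₗ L.rho)
  map_add' f g := Conv.ext' fun x => by simp [LinearMap.rTensor_add]
  map_smul' c f := Conv.ext' fun x => by simp [LinearMap.rTensor_smul]

theorem hatLinear_apply (f : Conv H R) (x : H) :
    L.hatLinear f x = sw (L.rho x) fun xH xA => f xH ⊗ₜ[ℂ] xA := by
  refine Eq.trans ?_ (sw_tmul_apply (LinearMap.rTensor A f.ofConv) (L.rho x)).symm
  rfl

theorem hatLinear_const (r : R) : L.hatLinear (Conv.const H r) = Conv.const H (r ⊗ₜ 1) :=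
  Conv.ext' fun x => by
    have h := congrArg (TensorProduct.mk ℂ R A r) (L.rho_counit_left x)
    simp only [map_sw, map_smul, TensorProduct.mk_apply] at h
    rw [Conv.const_apply, ← h, hatLinear_apply]
    simp [TensorProduct.smul_tmul']

/-- `rho_comul` says that splitting the H-leg of ρ(x) produces the H-legs of ρ(x₁) and ρ(x₂) while
their A-legs multiply, which is multiplicativity. -/
theorem hatLinear_mul (f g : Conv H R) :
    L.hatLinear (f * g) = L.hatLinear f * L.hatLinear g :=
  Conv.ext' fun x => by
    have h := congrArg (LinearMap.rTensor A
      (LinearMap.mul' ℂ R ∘ₗ TensorProduct.map f.ofConv g.ofConv)) (L.rho_comul x)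
    simp only [sw2, map_sw, TensorProduct.map_tmul, LinearMap.comp_apply,
      LinearMap.rTensor_tmul, LinearMap.mul'_apply] at h
    simp only [Conv.mul_apply, hatLinear_apply, sw2, sw_tmul, sw_mul, mul_sw,
      Algebra.TensorProduct.tmul_mul_tmul]
    refine h.trans ?_
    refine sw_congr fun a b => ?_
    rw [sw_comm]

/-- The multiplicative map `f ↦ (f ⊗ id) ρ`. -/
noncomputable def hat : Conv H R →ₐ[ℂ] Conv H (R ⊗[ℂ] A) :=
  AlgHom.ofLinearMap L.hatLinear
    (by rw [← Conv.const_one, hatLinear_const, ← Algebra.TensorProduct.one_def, Conv.const_one])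
    L.hatLinear_mul

theorem hat_apply (f : Conv H R) (x : H) :
    L.hat f x = sw (L.rho x) fun xH xA => f xH ⊗ₜ[ℂ] xA :=
  L.hatLinear_apply f x

theorem hat_const (r : R) : L.hat (Conv.const H r) = Conv.const H (r ⊗ₜ 1) :=
  L.hatLinear_const r

theorem map_hat (φ : R →ₐ[ℂ] S) (f : Conv H R) :
    L.hat (Conv.map φ f) = Conv.map (Algebra.TensorProduct.map φ (AlgHom.id ℂ A)) (L.hat f) :=
  Conv.ext' fun x => by simp [hat_apply, map_sw]

/-- This is `act_rho` after applying `f` to the H-leg. It allows A-legs coming from ρ to be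
reordered with those coming from the action. -/
theorem hat_mul_actBy (f : Conv H R) (a : A) :
    L.hat f * Conv.map (inr R A) (L.actBy a) = Conv.map (inr R A) (L.actBy a) * L.hat f :=
  Conv.ext' fun x => by
    have h := congrArg (LinearMap.rTensor A f.ofConv) (L.act_rho x a)
    simp only [sw2, map_sw, LinearMap.rTensor_tmul] at h
    simp only [Conv.mul_apply, sw2, hat_apply, sw_mul, mul_sw, Conv.map_apply, actBy_apply,
      Algebra.TensorProduct.includeRight_apply, Algebra.TensorProduct.tmul_mul_tmul, one_mul,
      mul_one]
    exact h.symm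

end CocycleLinkedPair

/-! ### The coaction in two variables and the compatibilities with Δ, χ and ψ. -/

namespace CocycleLinkedPair

open WithConv

variable {A : Type u} {H : Type v} [Ring A] [Bialgebra ℂ A] [Ring H] [Bialgebra ℂ H]
  (L : CocycleLinkedPair A H) {R S : Type*} [Ring R] [Algebra ℂ R] [Ring S] [Algebra ℂ S]

/-- The map `F ↦ (h ⊗ a ↦ (x ↦ ∑ F(x_{1H} ⊗ h) ⊗ x_{1A} (x₂ ▸ a)))`. -/
noncomputable def hatSlice (F : Conv (H ⊗[ℂ] H) R) : H ⊗[ℂ] A →ₗ[ℂ] Conv H (R ⊗[ℂ] A) :=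
  LinearMap.mul' ℂ (Conv H (R ⊗[ℂ] A)) ∘ₗ TensorProduct.map (L.hat.toLinearMap ∘ₗ F.slice)
    ((Conv.map (inr R A)).toLinearMap ∘ₗ L.actBy)

/-- The multiplicative map sending `F` to
`x ⊗ y ↦ ∑ F(x_{1H} ⊗ y_H) ⊗ x_{1A} (x₂ ▸ y_A)`. -/
noncomputable def hat₂ (F : Conv (H ⊗[ℂ] H) R) : Conv (H ⊗[ℂ] H) (R ⊗[ℂ] A) :=
  Conv.uncurry (L.hatSlice F ∘ₗ L.rho)

theorem slice_hat₂ (F : Conv (H ⊗[ℂ] H) R) (y : H) :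
    (L.hat₂ F).slice y =
      sw (L.rho y) fun yH yA => L.hat (F.slice yH) * Conv.map (inr R A) (L.actBy yA) :=
  (sw_tmul_apply (L.hatSlice F) (L.rho y)).symm

/-- On slices, `rho_comul` splits ρ(y) and `actBy_mul` splits the action on the product of the
A-legs; the two inner factors are then in the wrong order, which `hat_mul_actBy` corrects. -/
theorem hat₂_mul (F G : Conv (H ⊗[ℂ] H) R) : L.hat₂ (F * G) = L.hat₂ F * L.hat₂ G :=
  Conv.ext_slice fun y => by
    have h := congrArg (LinearMap.mul' ℂ (Conv H (R ⊗[ℂ] A)) ∘ₗ TensorProduct.map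
      (L.hat.toLinearMap ∘ₗ LinearMap.mul' ℂ (Conv H R) ∘ₗ TensorProduct.map F.slice G.slice)
      ((Conv.map (inr R A)).toLinearMap ∘ₗ L.actBy)) (L.rho_comul y)
    simp only [sw2, map_sw, TensorProduct.map_tmul, LinearMap.comp_apply,
      LinearMap.mul'_apply, AlgHom.toLinearMap_apply] at h
    simp only [Conv.slice_mul, slice_hat₂, sw2, map_sw, sw_mul, mul_sw]
    refine h.trans ?_
    refine sw_congr fun a b => ?_
    rw [sw_comm]
    refine sw_congr fun c d => ?_
    refine sw_congr fun e f => ?_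
    rw [actBy_mul, map_mul, map_mul, mul_assoc, mul_assoc,
      ← mul_assoc (Conv.map (inr R A) (L.actBy _)) (L.hat _), ← hat_mul_actBy]
    simp only [mul_assoc]

theorem map_hat₂ (φ : R →ₐ[ℂ] S) (F : Conv (H ⊗[ℂ] H) R) :
    L.hat₂ (Conv.map φ F) = Conv.map (Algebra.TensorProduct.map φ (AlgHom.id ℂ A)) (L.hat₂ F) :=
  Conv.ext_slice fun y => by
    have h : (Conv.map (Algebra.TensorProduct.map φ (AlgHom.id ℂ A)) (L.hat₂ F)).slice y =
      Conv.map (Algebra.TensorProduct.map φ (AlgHom.id ℂ A)) ((L.hat₂ F).slice y) := rfl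
    rw [h, slice_hat₂, slice_hat₂, map_sw]
    refine sw_congr fun a b => ?_
    rw [map_mul, ← map_hat, Conv.map_map]
    congr 2
    ext
    simp

theorem hat₂_comap_mulH (f : Conv H R) :
    L.hat₂ (Conv.comap (mulH H) f) * Conv.map (inr R A) L.chiC =
      Conv.map (inr R A) L.chiC * Conv.comap (mulH H) (L.hat f) :=
  Conv.ext_slice fun y => Conv.ext' fun x => by
    have h := congrArg (LinearMap.rTensor A f.ofConv) (L.rho_mul x y)
    simp only [sw2, sw3, map_sw, LinearMap.rTensor_tmul] at h
    trans sw (Coalgebra.comul (R := ℂ) x) fun x1 x2 =>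
      sw (Coalgebra.comul (R := ℂ) y) fun y1 y2 =>
      sw (L.rho (x2 * y2)) fun v w => f v ⊗ₜ[ℂ] (L.chi (x1 ⊗ₜ[ℂ] y1) * w)
    · refine Eq.trans ?_ h.symm
      rw [Conv.slice_mul]
      simp only [slice_hat₂, sw2, sw_mul, Conv.sw_apply]
      simp only [sw_comm _ (Coalgebra.comul y)]
      refine sw_congr fun y1 y2 => ?_
      simp only [sw_comm _ (L.rho y1)]
      refine sw_congr fun y3 y4 => ?_
      simp only [mul_assoc, Conv.mul_apply, sw2, hat_apply, sw_mul, mul_sw, Conv.map_apply,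
        Conv.slice_apply, Conv.comap_apply, Bialgebra.coe_mulCoalgHom, LinearMap.mul'_apply,
        actBy_apply, chiC_apply, Algebra.TensorProduct.includeRight_apply,
        Algebra.TensorProduct.tmul_mul_tmul, one_mul, mul_one]
    · rw [Conv.slice_apply, Conv.mul_apply_tmul]
      simp only [sw2, Conv.map_apply, chiC_apply, Conv.comap_apply, Bialgebra.coe_mulCoalgHom,
        LinearMap.mul'_apply, hat_apply, mul_sw, Algebra.TensorProduct.includeRight_apply,
        Algebra.TensorProduct.tmul_mul_tmul, one_mul]

/-- The map `b ⊗ c ↦ (x ↦ ∑ (x_{1H} ▸ b) ⊗ x_{1A} (x₂ ▸ c))`. -/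
noncomputable def actTensor : A ⊗[ℂ] A →ₗ[ℂ] Conv H (A ⊗[ℂ] A) :=
  LinearMap.mul' ℂ (Conv H (A ⊗[ℂ] A)) ∘ₗ TensorProduct.map (L.hat.toLinearMap ∘ₗ L.actBy)
    ((Conv.map (inr A A)).toLinearMap ∘ₗ L.actBy)

theorem actTensor_tmul (b c : A) :
    L.actTensor (b ⊗ₜ c) = L.hat (L.actBy b) * Conv.map (inr A A) (L.actBy c) := rfl

theorem actTensor_apply (t : A ⊗[ℂ] A) :
    L.actTensor t = sw t fun b c => L.hat (L.actBy b) * Conv.map (inr A A) (L.actBy c) :=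
  (sw_tmul_apply L.actTensor t).symm

theorem map_comul_actBy_mul_psiC (a : A) :
    Conv.map (Bialgebra.comulAlgHom ℂ A) (L.actBy a) * L.psiC =
      L.psiC * L.actTensor (Coalgebra.comul a) :=
  Conv.ext' fun x => by
    have h := L.act_psi x a
    simp only [sw2, sw3] at h
    trans
    · refine Eq.trans ?_ h
      simp only [Conv.mul_apply, sw2, psiC_apply, Conv.map_apply, comulAlgHom_apply_eq_sw,
        actBy_apply, mul_sw, sw_mul, Algebra.TensorProduct.tmul_mul_tmul]
      refine sw_congr fun x1 x2 => ?_
      rw [sw_comm]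
    · rw [actTensor_apply, mul_sw, Conv.sw_apply]
      simp only [sw_comm _ (Coalgebra.comul a)]
      refine sw_congr fun a1 a2 => ?_
      simp only [Conv.mul_apply, sw2, psiC_apply, hat_apply, Conv.map_apply,
        actBy_apply, mul_sw, sw_mul, Algebra.TensorProduct.includeRight_apply,
        Algebra.TensorProduct.tmul_mul_tmul, one_mul, mul_one, mul_assoc]
      refine sw_congr fun x1 x2 => ?_
      simp only [sw_comm _ (L.psi x1)]

/-- The six-fold sum of `chi_psi` is a product of four factors: ψ takes x₁, the twisted action on
ψ(y₁) takes x₂ and x₃, `hat₂` of χ takes x₄, x₅ and y₂, and χ takes x₆ and y₃. -/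
theorem map_comul_chiC_mul_psiC :
    Conv.map (Bialgebra.comulAlgHom ℂ A) L.chiC * Conv.comap (mulH H) L.psiC =
      Conv.comap (tensorFst H H) L.psiC * Conv.uncurry (L.actTensor ∘ₗ L.psi) *
        (L.hat₂ L.chiC * Conv.map (inr A A) L.chiC) :=
  Conv.ext_slice fun y => Conv.ext' fun x => by
    have h := L.chi_psi x y
    simp only [sw2, sw3, sw4, sw5, sw6] at h
    trans
    · refine Eq.trans ?_ h
      simp only [Conv.slice_apply, Conv.mul_apply_tmul, sw2, psiC_apply, Conv.map_apply,
        Conv.comap_apply, Bialgebra.coe_mulCoalgHom, LinearMap.mul'_apply, chiC_apply,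
        comulAlgHom_apply_eq_sw, mul_sw, sw_mul, Algebra.TensorProduct.tmul_mul_tmul]
      refine sw_congr fun x1 x2 => ?_
      refine sw_congr fun y1 y2 => ?_
      rw [sw_comm]
    · rw [mul_assoc, Conv.slice_comap_fst_mul, Conv.slice_mul]
      simp only [Conv.slice_mul, Conv.slice_uncurry, slice_hat₂, LinearMap.comp_apply,
        actTensor_apply, sw2, sw_mul, mul_sw, Conv.sw_apply, mul_assoc]
      simp only [sw_comm _ (Coalgebra.comul y)]
      refine sw_congr fun y1 y2 => ?_
      simp only [sw_comm _ (Coalgebra.comul y2)]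
      refine sw_congr fun y3 y4 => ?_
      simp only [sw_comm _ (L.psi y1)]
      simp only [sw_comm _ (L.rho y3)]
      refine sw_congr fun y5 y6 => ?_
      refine sw_congr fun y7 y8 => ?_
      simp only [Conv.mul_apply, sw2, psiC_apply, hat_apply, Conv.map_apply, Conv.slice_apply,
        actBy_apply, chiC_apply, mul_sw, sw_mul, Algebra.TensorProduct.includeRight_apply,
        Algebra.TensorProduct.tmul_mul_tmul, one_mul, mul_one, mul_assoc]
      refine sw_congr fun x1 x2 => ?_
      simp only [sw_comm _ (L.psi x1)]
      refine sw_congr fun _ _ => ?_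
      refine sw_congr fun _ _ => ?_
      refine sw_congr fun _ _ => ?_
      refine sw_congr fun _ _ => ?_
      refine sw_congr fun _ _ => ?_
      rw [sw_comm]

/-- The algebra map `r ⊗ a ↦ ∑ (r ⊗ a₁) ⊗ a₂`. -/
noncomputable def comulRight (R : Type*) [Ring R] [Algebra ℂ R] (A : Type u) [Ring A]
    [Bialgebra ℂ A] : R ⊗[ℂ] A →ₐ[ℂ] (R ⊗[ℂ] A) ⊗[ℂ] A :=
  (Algebra.TensorProduct.assoc ℂ ℂ ℂ R A A).symm.toAlgHom.comp
    (Algebra.TensorProduct.map (AlgHom.id ℂ R) (Bialgebra.comulAlgHom ℂ A))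

theorem comulRight_tmul (r : R) (a : A) :
    comulRight R A (r ⊗ₜ a) =
      sw (Coalgebra.comul (R := ℂ) a) fun a1 a2 => (r ⊗ₜ[ℂ] a1) ⊗ₜ[ℂ] a2 := by
  simp only [comulRight, AlgHom.comp_apply, Algebra.TensorProduct.map_tmul,
    comulAlgHom_apply_eq_sw, tmul_sw, map_sw]
  rfl

/-- The map `x ↦ ∑ (1 ⊗ x_I) ⊗ x_{II}`. -/
noncomputable def psiRight (R : Type*) [Ring R] [Algebra ℂ R] : Conv H ((R ⊗[ℂ] A) ⊗[ℂ] A) :=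
  Conv.map (Algebra.TensorProduct.map (inr R A) (AlgHom.id ℂ A)) L.psiC

/-- From `rho_rho`: the coaction is coassociative only up to ψ, so ψ intertwines the iterated `hat`
with Δ applied to the A-leg. -/
theorem psiRight_mul_hat_hat (f : Conv H R) :
    L.psiRight R * L.hat (L.hat f) = Conv.map (comulRight R A) (L.hat f) * L.psiRight R :=
  Conv.ext' fun x => by
    have h := congrArg (LinearMap.rTensor A (LinearMap.rTensor A f.ofConv)) (L.rho_rho x)
    simp only [sw2, map_sw, LinearMap.rTensor_tmul] at h
    trans
    · refine Eq.trans ?_ h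
      simp only [Conv.mul_apply, sw2, psiRight, psiC_apply, hat_apply, Conv.map_apply, mul_sw,
        sw_mul, sw_tmul, map_sw, Algebra.TensorProduct.map_tmul, AlgHom.id_apply,
        Algebra.TensorProduct.includeRight_apply,
        Algebra.TensorProduct.tmul_mul_tmul, one_mul, mul_one]
      refine sw_congr fun x1 x2 => ?_
      simp only [sw_comm _ (L.psi x1)]
    · simp only [Conv.mul_apply, sw2, psiRight, psiC_apply, hat_apply, Conv.map_apply, mul_sw,
        sw_mul, sw_tmul, map_sw, Algebra.TensorProduct.map_tmul, AlgHom.id_apply,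
        Algebra.TensorProduct.includeRight_apply, comulRight_tmul,
        Algebra.TensorProduct.tmul_mul_tmul, one_mul, mul_one]
      refine sw_congr fun x1 x2 => ?_
      simp only [sw_comm _ (L.psi x2)]

theorem map_comul_psiC_mul_hat_psiC :
    Conv.map (Algebra.TensorProduct.map (Bialgebra.comulAlgHom ℂ A) (AlgHom.id ℂ A)) L.psiC *
      L.hat L.psiC = Conv.map (comulRight A A) L.psiC * L.psiRight A :=
  Conv.ext' fun x => by
    have h := L.psi_cocycle x
    simp only [sw2] at h
    trans
    · refine Eq.trans ?_ h
      simp only [Conv.mul_apply, sw2, psiC_apply, hat_apply, Conv.map_apply, mul_sw,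
        sw_mul, sw_tmul, map_sw, Algebra.TensorProduct.map_tmul, AlgHom.id_apply,
        comulAlgHom_apply_eq_sw, Algebra.TensorProduct.tmul_mul_tmul]
      refine sw_congr fun x1 x2 => ?_
      simp only [sw_comm _ (L.psi x1)]
      refine sw_congr fun x3 x4 => ?_
      simp only [sw_comm _ (Coalgebra.comul x3)]
    · simp only [Conv.mul_apply, sw2, psiRight, psiC_apply, hat_apply, Conv.map_apply, mul_sw,
        sw_mul, sw_tmul, map_sw, Algebra.TensorProduct.map_tmul, AlgHom.id_apply,
        Algebra.TensorProduct.includeRight_apply, comulRight_tmul,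
        Algebra.TensorProduct.tmul_mul_tmul, one_mul, mul_one]
      refine sw_congr fun x1 x2 => ?_
      rw [sw_comm]
      refine sw_congr fun x3 x4 => ?_
      rw [sw_comm]

end CocycleLinkedPair

/-! ### The crossed product as an algebra of operators on A ⊗ H. -/

namespace CocycleLinkedPair

open WithConv

variable {A : Type u} {H : Type v} [Ring A] [Bialgebra ℂ A] [Ring H] [Bialgebra ℂ H]

theorem conv_mul_apply_one {R : Type*} [Ring R] [Algebra ℂ R] (f g : Conv H R) :
    (f * g) 1 = f 1 * g 1 := by
  change LinearMap.mul' ℂ R (TensorProduct.map f.ofConv g.ofConv (Coalgebra.comul (1 : H))) = _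
  rw [Bialgebra.comul_one]
  simp [Algebra.TensorProduct.one_def]

/-- The presentation of an algebra `M` as the crossed product `A #_χ H`: the elements
`i a` and `j x` multiply like `a # 1` and `1 # x`, and `a # x = i a * j x`. -/
structure CrossedProduct (L : CocycleLinkedPair A H) (M : Type w) [Ring M] [Algebra ℂ M] where
  i : A →ₐ[ℂ] M
  j : H →ₗ[ℂ] M
  e : A ⊗[ℂ] H ≃ₗ[ℂ] M
  e_tmul : ∀ a x, e (a ⊗ₜ x) = i a * j x
  j_one : j 1 = 1
  j_mul_i : ∀ a, toConv j * Conv.const H (i a) = Conv.map i (L.actBy a) * toConv j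
  j_mul_j : Conv.comap (tensorFst H H) (toConv j) * Conv.comap (tensorSnd H H) (toConv j) =
    Conv.map i L.chiC * Conv.comap (mulH H) (toConv j)

variable (L : CocycleLinkedPair A H)

/-- The product `(1 # x)(1 # y)` of the crossed product. -/
noncomputable def crossMul : Conv (H ⊗[ℂ] H) (A ⊗[ℂ] H) :=
  Conv.map (inl A H) L.chiC * Conv.comap (mulH H) (Conv.map (inr A H) (toConv LinearMap.id))

theorem crossMul_apply (q : H ⊗[ℂ] H) : L.crossMul q =
    sw2 q fun q1 q2 => L.chi q1 ⊗ₜ[ℂ] LinearMap.mul' ℂ H q2 := by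
  simp only [crossMul, Conv.mul_apply, Conv.map_apply, Conv.comap_apply, chiC_apply,
    Algebra.TensorProduct.includeLeft_apply, Algebra.TensorProduct.includeRight_apply,
    Bialgebra.coe_mulCoalgHom, Algebra.TensorProduct.tmul_mul_tmul, mul_one, one_mul,
    LinearMap.id_apply]

theorem crossMul_one_right (x : H) : L.crossMul (x ⊗ₜ 1) = 1 ⊗ₜ x := by
  rw [crossMul, Conv.mul_apply_tmul]
  -- The chosen decomposition of Δ(1) need not be the single term 1 ⊗ 1, so the sum has to be
  -- evaluated through a linear map.
  have h (F : H ⊗[ℂ] H →ₗ[ℂ] A ⊗[ℂ] H) : (sw2 (1 : H) fun y1 y2 => F (y1 ⊗ₜ y2)) = F (1 ⊗ₜ 1) := by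
    rw [sw2_tmul_apply, Bialgebra.comul_one, Algebra.TensorProduct.one_def]
  have h' (x1 x2 : H) := h (LinearMap.mul' ℂ (A ⊗[ℂ] H) ∘ₗ TensorProduct.map
    ((Conv.map (inl A H) L.chiC).ofConv ∘ₗ TensorProduct.mk ℂ H H x1)
    ((Conv.comap (mulH H) (Conv.map (inr A H) (toConv LinearMap.id))).ofConv ∘ₗ
      TensorProduct.mk ℂ H H x2))
  simp only [LinearMap.comp_apply, TensorProduct.map_tmul, LinearMap.mul'_apply,
    TensorProduct.mk_apply] at h'
  simp only [h']
  conv_rhs => rw [← sw2_counit_left x]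
  simp only [sw2, tmul_sw, Conv.map_apply, Conv.comap_apply, chiC_apply, L.chi_one_right,
    Bialgebra.coe_mulCoalgHom, LinearMap.mul'_apply, mul_one, map_smul, map_one,
    LinearMap.id_apply, Algebra.TensorProduct.includeRight_apply, smul_mul_assoc, one_mul,
    TensorProduct.tmul_smul]

theorem crossMul_one_left (y : H) : L.crossMul (1 ⊗ₜ y) = 1 ⊗ₜ y := by
  rw [crossMul, Conv.mul_apply_tmul]
  have h (F : H ⊗[ℂ] H →ₗ[ℂ] A ⊗[ℂ] H) : (sw2 (1 : H) fun y1 y2 => F (y1 ⊗ₜ y2)) = F (1 ⊗ₜ 1) := by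
    rw [sw2_tmul_apply, Bialgebra.comul_one, Algebra.TensorProduct.one_def]
  have h' (y1 y2 : H) := h (LinearMap.mul' ℂ (A ⊗[ℂ] H) ∘ₗ TensorProduct.map
    ((Conv.map (inl A H) L.chiC).slice y1).ofConv
    ((Conv.comap (mulH H) (Conv.map (inr A H) (toConv LinearMap.id))).slice y2).ofConv)
  simp only [LinearMap.comp_apply, TensorProduct.map_tmul, LinearMap.mul'_apply,
    Conv.slice_apply] at h'
  simp only [sw2] at h' ⊢
  rw [sw_comm]
  simp only [h']
  conv_rhs => rw [← sw2_counit_left y]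
  simp only [sw2, tmul_sw, Conv.map_apply, Conv.comap_apply, chiC_apply, L.chi_one_left,
    Bialgebra.coe_mulCoalgHom, LinearMap.mul'_apply, one_mul, map_smul, map_one,
    LinearMap.id_apply, Algebra.TensorProduct.includeRight_apply, smul_mul_assoc, one_mul,
    TensorProduct.tmul_smul]

/-- The left multiplication by `1 # x`, as a function of `x`. -/
noncomputable def crossAct : A ⊗[ℂ] H →ₗ[ℂ] Conv H (A ⊗[ℂ] H) :=
  LinearMap.mul' ℂ (Conv H (A ⊗[ℂ] H)) ∘ₗ
    TensorProduct.map ((Conv.map (inl A H)).toLinearMap ∘ₗ L.actBy) L.crossMul.slice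

theorem crossAct_tmul (b : A) (y : H) :
    L.crossAct (b ⊗ₜ y) = Conv.map (inl A H) (L.actBy b) * L.crossMul.slice y := rfl

theorem crossAct_inl_mul (c : A) (t : A ⊗[ℂ] H) :
    L.crossAct (inl A H c * t) = Conv.map (inl A H) (L.actBy c) * L.crossAct t := by
  induction t with
  | zero => simp
  | add s t hs ht => rw [mul_add, map_add, map_add, hs, ht, mul_add]
  | tmul b y =>
    rw [Algebra.TensorProduct.includeLeft_apply, Algebra.TensorProduct.tmul_mul_tmul, one_mul,
      crossAct_tmul, crossAct_tmul, actBy_mul, map_mul, mul_assoc]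

/-- For q = y ⊗ z this is associativity of (1 # x)(1 # y)(1 # z), and follows from the cocycle
identity for χ together with associativity of H. -/
theorem crossAct_crossMul (q : H ⊗[ℂ] H) :
    L.crossAct (L.crossMul q) =
      (Conv.comap (triFst H) (Conv.map (inl A H) L.chiC) *
        Conv.comap (triMulLeft H) L.crossMul).slice q := by
  have h : L.crossAct (L.crossMul q) = (Conv.map (inl A H) (L.actOn L.chi) *
      Conv.comap (triMulRight H) L.crossMul).slice q := by
    rw [crossMul_apply, Conv.slice_mul]
    simp only [sw2, map_sw]
    rfl
  have hm : Conv.comap (triMulRight H) (Conv.comap (mulH H)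
      (Conv.map (inr A H) (toConv LinearMap.id))) = Conv.comap (triMulLeft H)
      (Conv.comap (mulH H) (Conv.map (inr A H) (toConv LinearMap.id))) := by
    refine WithConv.ext <| TensorProduct.ext <| LinearMap.ext fun x =>
      TensorProduct.ext' fun y z => ?_
    change inr A H (x * (y * z)) = inr A H (x * y * z)
    rw [mul_assoc]
  rw [h, crossMul, map_mul, map_mul, ← mul_assoc, ← mul_assoc, ← Conv.map_comap,
    ← map_mul, chi_cocycle_conv, map_mul, Conv.map_comap, Conv.map_comap, hm]

/-- The operators `a # 1` on `A ⊗ H`. -/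
noncomputable def opI : A →ₐ[ℂ] Module.End ℂ (A ⊗[ℂ] H) :=
  (Algebra.lmul ℂ (A ⊗[ℂ] H)).comp (inl A H)

/-- The operators `1 # x` on `A ⊗ H`. -/
noncomputable def opJ : H →ₗ[ℂ] Module.End ℂ (A ⊗[ℂ] H) :=
  ((WithConv.linearEquiv ℂ (H →ₗ[ℂ] A ⊗[ℂ] H)).toLinearMap ∘ₗ L.crossAct).flip

theorem opI_apply (a : A) (t : A ⊗[ℂ] H) : opI (H := H) a t = inl A H a * t := rfl

theorem opJ_apply (x : H) (t : A ⊗[ℂ] H) : L.opJ x t = L.crossAct t x := rfl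

theorem opJ_mul_opI (a : A) :
    toConv L.opJ * Conv.const H (opI a) = Conv.map opI (L.actBy a) * toConv L.opJ :=
  Conv.ext' fun x => LinearMap.ext fun t => by
    rw [Conv.mul_const_apply, Conv.mul_apply, sw2, sw_apply]
    change L.crossAct (inl A H a * t) x = _
    rw [crossAct_inl_mul, Conv.mul_apply]
    rfl

/-- Both sides pass the operators b # 1 by the same rule, on the left by `opJ_mul_opI` used twice
and on the right by `act_act`. Since b ⊗ z is the image of 1 ⊗ z under b # 1, it suffices to compare
them on 1 ⊗ z, where the equality is `crossAct_crossMul`. -/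
theorem opJ_mul_opJ :
    Conv.comap (tensorFst H H) (toConv L.opJ) * Conv.comap (tensorSnd H H) (toConv L.opJ) =
      Conv.map opI L.chiC * Conv.comap (mulH H) (toConv L.opJ) := by
  set F := Conv.comap (tensorFst H H) (toConv L.opJ) * Conv.comap (tensorSnd H H) (toConv L.opJ)
    with hF
  set G := Conv.map opI L.chiC * Conv.comap (mulH H) (toConv L.opJ) with hG
  have hone (z : H) : L.crossAct (1 ⊗ₜ z) = L.crossMul.slice z := by
    rw [crossAct_tmul, actBy_one, map_one, one_mul]
  have hconst (D : H ⊗[ℂ] H →ₗc[ℂ] H) (b : A) :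
      Conv.const (H ⊗[ℂ] H) (opI (H := H) b) = Conv.comap D (Conv.const H (opI b)) :=
    Conv.ext' fun x => by simp
  have hact (b : A) : Conv.comap (tensorFst H H) (toConv L.opJ) *
      Conv.comap (tensorSnd H H) (Conv.map opI (L.actBy b)) =
      Conv.map opI (L.actOn (L.act.flip b)) * Conv.comap (tensorFst H H) (toConv L.opJ) :=
    Conv.ext_slice fun y => by
      rw [Conv.slice_comap_fst_mul, Conv.slice_mul_comap_fst, Conv.slice_comap_snd]
      exact L.opJ_mul_opI _
  have hFc (b : A) : F * Conv.const _ (opI b) = Conv.map opI (L.actOn (L.act.flip b)) * F := by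
    rw [hF, mul_assoc, hconst (tensorSnd H H), ← map_mul, opJ_mul_opI, map_mul, ← mul_assoc, hact,
      mul_assoc]
  have hGc (b : A) : G * Conv.const _ (opI b) = Conv.map opI (L.actOn (L.act.flip b)) * G := by
    rw [hG, mul_assoc, hconst (mulH H), ← map_mul, opJ_mul_opI, map_mul, ← mul_assoc, ← mul_assoc,
      ← Conv.map_comap, ← map_mul, ← map_mul, actOn_mul_chiC]
  have h1 (q : H ⊗[ℂ] H) (z : H) : F q (1 ⊗ₜ z) = G q (1 ⊗ₜ z) := by
    induction q with
    | zero => simp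
    | add s t hs ht =>
      rw [map_add, map_add, LinearMap.add_apply, LinearMap.add_apply, hs, ht]
    | tmul x y =>
      have hx : F (x ⊗ₜ y) = L.opJ x * L.opJ y := Conv.comap_fst_mul_comap_snd_tmul _ _ x y
      rw [hx, Module.End.mul_apply, opJ_apply, opJ_apply, hone, Conv.slice_apply,
        crossAct_crossMul, Conv.slice_apply, comap_triFst_mul_apply, hG, Conv.mul_apply_tmul]
      simp only [sw2, sw_apply]
      refine sw_congr fun x1 x2 => sw_congr fun y1 y2 => ?_
      change _ = inl A H _ * L.opJ (x2 * y2) (1 ⊗ₜ z)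
      rw [opJ_apply, hone]
      rfl
  refine Conv.ext' fun q => TensorProduct.ext' fun b z => ?_
  have hb (K : Conv (H ⊗[ℂ] H) (Module.End ℂ (A ⊗[ℂ] H))) :
      K q (b ⊗ₜ z) = (K * Conv.const (H ⊗[ℂ] H) (opI b) :
        Conv (H ⊗[ℂ] H) (Module.End ℂ (A ⊗[ℂ] H))) q (1 ⊗ₜ z) := by
    rw [Conv.mul_const_apply, Module.End.mul_apply, opI_apply]
    simp
  rw [hb, hb, hFc, hGc]
  simp only [Conv.mul_apply, sw2, sw_apply, Module.End.mul_apply, h1]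

theorem opJ_one : L.opJ 1 = 1 :=
  TensorProduct.ext' fun b y => by
    rw [opJ_apply, crossAct_tmul, conv_mul_apply_one, Conv.slice_apply, crossMul_one_left,
      Conv.map_apply, actBy_apply, L.one_act]
    simp

/-- The map `a ⊗ x ↦ (a # 1)(1 # x)` into the operators on `A ⊗ H`. -/
noncomputable def opE : A ⊗[ℂ] H →ₗ[ℂ] Module.End ℂ (A ⊗[ℂ] H) :=
  LinearMap.mul' ℂ _ ∘ₗ TensorProduct.map opI.toLinearMap L.opJ

theorem opE_tmul (a : A) (x : H) : L.opE (a ⊗ₜ x) = opI a * L.opJ x := rfl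

/-- The operator attached to a ⊗ x sends 1 ⊗ 1 to a ⊗ x. -/
theorem opE_injective : Function.Injective L.opE := by
  refine Function.LeftInverse.injective (g := fun f => f (1 ⊗ₜ 1)) fun t => ?_
  induction t with
  | zero => simp
  | add s t hs ht => simp only [map_add, LinearMap.add_apply] at hs ht ⊢; rw [hs, ht]
  | tmul a x =>
    change L.opE (a ⊗ₜ x) (1 ⊗ₜ 1) = _
    rw [opE_tmul, Module.End.mul_apply, opJ_apply, crossAct_tmul, actBy_one, map_one, one_mul,
      Conv.slice_apply, crossMul_one_right, opI_apply]
    simp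

theorem opI_mul_opE (a : A) (t : A ⊗[ℂ] H) : opI a * L.opE t = L.opE (inl A H a * t) := by
  induction t with
  | zero => simp
  | add s t hs ht => simp only [map_add, mul_add, hs, ht]
  | tmul b x => simp [opE_tmul, mul_assoc]

theorem sw_mem_range {V W X Y : Type*} [AddCommGroup V] [Module ℂ V] [AddCommGroup W] [Module ℂ W]
    [AddCommGroup X] [Module ℂ X] [AddCommGroup Y] [Module ℂ Y] (f : X →ₗ[ℂ] Y) (t : V ⊗[ℂ] W)
    {F : V → W → Y} (h : ∀ v w, F v w ∈ LinearMap.range f) : sw t F ∈ LinearMap.range f :=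
  Submodule.sum_mem _ fun _ _ => h _ _

theorem opJ_mul_opJ_mem (x y : H) : L.opJ x * L.opJ y ∈ LinearMap.range L.opE := by
  have h := congrArg (fun f : Conv (H ⊗[ℂ] H) (Module.End ℂ (A ⊗[ℂ] H)) => f (x ⊗ₜ y)) L.opJ_mul_opJ
  have h' := Conv.comap_fst_mul_comap_snd_tmul (toConv L.opJ) (toConv L.opJ) x y
  rw [← show _ = L.opJ x * L.opJ y from h']
  refine h ▸ ?_
  rw [Conv.mul_apply_tmul]
  refine sw_mem_range _ _ fun x1 x2 => sw_mem_range _ _ fun y1 y2 => ?_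
  exact ⟨L.chi (x1 ⊗ₜ y1) ⊗ₜ (x2 * y2), rfl⟩

theorem opI_mul_mem (a : A) {f : Module.End ℂ (A ⊗[ℂ] H)} (hf : f ∈ LinearMap.range L.opE) :
    opI a * f ∈ LinearMap.range L.opE := by
  obtain ⟨t, rfl⟩ := hf
  exact ⟨_, (L.opI_mul_opE a t).symm⟩

/-- In (a # 1)(1 # x)(b # 1)(1 # y) the relation `opJ_mul_opI` brings the A-operators to the left,
and `opJ_mul_opJ` merges the two H-operators. -/
theorem opE_mul_opE_mem (s t : A ⊗[ℂ] H) : L.opE s * L.opE t ∈ LinearMap.range L.opE := by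
  induction s with
  | zero => simp
  | add s s' hs hs' => rw [map_add, add_mul]; exact add_mem hs hs'
  | tmul a x =>
    induction t with
    | zero => simp
    | add t t' ht ht' => rw [map_add, mul_add]; exact add_mem ht ht'
    | tmul b y =>
      have h := congrArg (fun f : Conv H (Module.End ℂ (A ⊗[ℂ] H)) => f x) (L.opJ_mul_opI b)
      rw [Conv.mul_const_apply, Conv.mul_apply] at h
      rw [opE_tmul, opE_tmul, mul_assoc, ← mul_assoc (L.opJ x)]
      refine L.opI_mul_mem a ?_
      rw [show L.opJ x * opI b = _ from h, sw2, sw_mul]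
      refine sw_mem_range _ _ fun x1 x2 => ?_
      rw [mul_assoc]
      exact L.opI_mul_mem _ (L.opJ_mul_opJ_mem x2 y)

/-- The crossed product `A #_χ H` as a subalgebra of the operators on `A ⊗ H`. -/
noncomputable def crossedSubalgebra : Subalgebra ℂ (Module.End ℂ (A ⊗[ℂ] H)) where
  carrier := LinearMap.range L.opE
  mul_mem' := by
    rintro _ _ ⟨s, rfl⟩ ⟨t, rfl⟩
    exact L.opE_mul_opE_mem s t
  add_mem' ha hb := add_mem ha hb
  algebraMap_mem' c := by
    refine ⟨c • (1 ⊗ₜ 1), ?_⟩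
    rw [map_smul, opE_tmul, map_one, opJ_one, Algebra.algebraMap_eq_smul_one, mul_one]

/-- The presentation of the subalgebra `crossedSubalgebra` as a crossed product. -/
noncomputable def crossedSubalgebraPresentation : L.CrossedProduct L.crossedSubalgebra where
  i := opI.codRestrict L.crossedSubalgebra fun a => ⟨a ⊗ₜ 1, by rw [opE_tmul, opJ_one, mul_one]⟩
  j := L.opJ.codRestrict (Subalgebra.toSubmodule L.crossedSubalgebra) fun x =>
    ⟨1 ⊗ₜ x, by rw [opE_tmul, map_one, one_mul]⟩
  e := LinearEquiv.ofInjective L.opE L.opE_injective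
  e_tmul a x := rfl
  j_one := Subtype.ext L.opJ_one
  j_mul_i a := Conv.map_injective (φ := L.crossedSubalgebra.val) Subtype.val_injective <| by
    rw [map_mul, map_mul, Conv.map_const]
    exact L.opJ_mul_opI a
  j_mul_j := Conv.map_injective (φ := L.crossedSubalgebra.val) Subtype.val_injective <| by
    rw [map_mul, map_mul]
    exact L.opJ_mul_opJ

end CocycleLinkedPair

/-! ### Universal property of the crossed product; its coproduct and counit. -/

namespace CocycleLinkedPair

open WithConv

variable {A : Type u} {H : Type v} [Ring A] [Bialgebra ℂ A] [Ring H] [Bialgebra ℂ H]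
  {L : CocycleLinkedPair A H} {M : Type w} [Ring M] [Algebra ℂ M]

namespace CrossedProduct

variable (X : L.CrossedProduct M)

/-- The map `j` in the convolution algebra. -/
noncomputable def jC : Conv H M := toConv X.j

@[simp] theorem jC_apply (x : H) : X.jC x = X.j x := rfl

theorem jC_mul_const (a : A) :
    X.jC * Conv.const H (X.i a) = Conv.map X.i (L.actBy a) * X.jC :=
  X.j_mul_i a

theorem jC_mul_jC : Conv.comap (tensorFst H H) X.jC * Conv.comap (tensorSnd H H) X.jC =
    Conv.map X.i L.chiC * Conv.comap (mulH H) X.jC :=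
  X.j_mul_j

theorem j_mul_i_apply (x : H) (a : A) :
    X.j x * X.i a = sw2 x fun x1 x2 => X.i (L.act x1 a) * X.j x2 := by
  have h := X.jC_mul_const a
  rw [← X.jC_apply, ← Conv.mul_const_apply, h, Conv.mul_apply]
  rfl

theorem j_mul_j_apply (x y : H) : X.j x * X.j y =
    sw2 x fun x1 x2 => sw2 y fun y1 y2 => X.i (L.chi (x1 ⊗ₜ y1)) * X.j (x2 * y2) := by
  rw [← X.jC_apply, ← X.jC_apply, ← Conv.comap_fst_mul_comap_snd_tmul, jC_mul_jC,
    Conv.mul_apply_tmul]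
  rfl

theorem linearMap_ext {Y : Type*} [AddCommGroup Y] [Module ℂ Y] {f g : M →ₗ[ℂ] Y}
    (h : ∀ a x, f (X.i a * X.j x) = g (X.i a * X.j x)) : f = g := by
  have h' : f ∘ₗ X.e.toLinearMap = g ∘ₗ X.e.toLinearMap := TensorProduct.ext' fun a x => by
    simpa [X.e_tmul] using h a x
  ext m
  simpa using LinearMap.congr_fun h' (X.e.symm m)

theorem algHom_ext {R : Type*} [Ring R] [Algebra ℂ R] {f g : M →ₐ[ℂ] R}
    (hi : f.comp X.i = g.comp X.i) (hj : Conv.map f X.jC = Conv.map g X.jC) : f = g := by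
  refine AlgHom.toLinearMap_injective (X.linearMap_ext fun a x => ?_)
  have h1 := AlgHom.congr_fun hi a
  have h2 := LinearMap.congr_fun (congrArg ofConv hj) x
  simp only [AlgHom.comp_apply] at h1
  simp only [Conv.map_apply, jC_apply] at h2
  rw [AlgHom.toLinearMap_apply, AlgHom.toLinearMap_apply, map_mul, map_mul, h1, h2]

section Lift

variable {R : Type*} [Ring R] [Algebra ℂ R] (φ : A →ₐ[ℂ] R) (D : Conv H R)

/-- The linear map `i a * j x ↦ φ a * D x`. -/
noncomputable def liftLinear : M →ₗ[ℂ] R :=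
  LinearMap.mul' ℂ R ∘ₗ TensorProduct.map φ.toLinearMap D.ofConv ∘ₗ X.e.symm.toLinearMap

theorem liftLinear_apply (a : A) (x : H) : X.liftLinear φ D (X.i a * X.j x) = φ a * D x := by
  rw [← X.e_tmul]
  simp [liftLinear]

theorem liftLinear_i_mul (a : A) (m : M) :
    X.liftLinear φ D (X.i a * m) = φ a * X.liftLinear φ D m := by
  refine LinearMap.congr_fun (f := X.liftLinear φ D ∘ₗ LinearMap.mulLeft ℂ (X.i a))
    (g := LinearMap.mulLeft ℂ (φ a) ∘ₗ X.liftLinear φ D) (X.linearMap_ext fun b x => ?_) m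
  simp only [LinearMap.comp_apply, LinearMap.mulLeft_apply]
  rw [← mul_assoc, ← map_mul, liftLinear_apply, liftLinear_apply, map_mul, mul_assoc]

theorem liftLinear_j (x : H) : X.liftLinear φ D (X.j x) = D x := by
  simpa using X.liftLinear_apply φ D 1 x

variable (h1 : D 1 = 1) (hi : ∀ a, D * Conv.const H (φ a) = Conv.map φ (L.actBy a) * D)
  (hj : Conv.comap (tensorFst H H) D * Conv.comap (tensorSnd H H) D =
    Conv.map φ L.chiC * Conv.comap (mulH H) D)

include hi hj in
-- The map is left A-linear, so only left multiplication by j(x) needs work: `hi` handles j(x)i(b)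
-- and `hj` handles j(x)j(y).
theorem liftLinear_mul (m n : M) :
    X.liftLinear φ D (m * n) = X.liftLinear φ D m * X.liftLinear φ D n := by
  have hjj (x y : H) : X.liftLinear φ D (X.j x * X.j y) = D x * D y := by
    rw [j_mul_j_apply, ← Conv.comap_fst_mul_comap_snd_tmul, hj, Conv.mul_apply_tmul]
    simp only [sw2, map_sw, liftLinear_apply]
    rfl
  have hjm (x : H) (n : M) : X.liftLinear φ D (X.j x * n) = D x * X.liftLinear φ D n := by
    refine LinearMap.congr_fun (f := X.liftLinear φ D ∘ₗ LinearMap.mulLeft ℂ (X.j x))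
      (g := LinearMap.mulLeft ℂ (D x) ∘ₗ X.liftLinear φ D) (X.linearMap_ext fun b y => ?_) n
    simp only [LinearMap.comp_apply, LinearMap.mulLeft_apply]
    rw [← mul_assoc, j_mul_i_apply, liftLinear_apply, ← mul_assoc, ← Conv.mul_const_apply, hi,
      Conv.mul_apply]
    simp only [sw2, sw_mul, map_sw, mul_assoc, liftLinear_i_mul, hjj]
    rfl
  refine LinearMap.congr_fun (f := X.liftLinear φ D ∘ₗ LinearMap.mulRight ℂ n)
    (g := LinearMap.mulRight ℂ (X.liftLinear φ D n) ∘ₗ X.liftLinear φ D)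
    (X.linearMap_ext fun b y => ?_) m
  simp only [LinearMap.comp_apply, LinearMap.mulRight_apply]
  rw [mul_assoc, liftLinear_i_mul, hjm, liftLinear_apply, mul_assoc]

/-- The universal property of the crossed product. -/
noncomputable def lift : M →ₐ[ℂ] R :=
  AlgHom.ofLinearMap (X.liftLinear φ D)
    (by simpa [X.j_one, h1] using X.liftLinear_apply φ D 1 1) (X.liftLinear_mul φ D hi hj)

theorem lift_mul (a : A) (x : H) : X.lift φ D h1 hi hj (X.i a * X.j x) = φ a * D x :=
  X.liftLinear_apply φ D a x

theorem map_lift_jC : Conv.map (X.lift φ D h1 hi hj) X.jC = D :=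
  Conv.ext' fun x => X.liftLinear_j φ D x

theorem lift_comp_i : (X.lift φ D h1 hi hj).comp X.i = φ :=
  AlgHom.ext fun a => by
    simpa [X.j_one, h1] using X.lift_mul φ D h1 hi hj a 1

end Lift

/-- The map `i ⊗ i`. -/
noncomputable def ii : A ⊗[ℂ] A →ₐ[ℂ] M ⊗[ℂ] M := Algebra.TensorProduct.map X.i X.i

/-- The map `id ⊗ i`. -/
noncomputable def idI (R : Type*) [Ring R] [Algebra ℂ R] : R ⊗[ℂ] A →ₐ[ℂ] R ⊗[ℂ] M :=
  Algebra.TensorProduct.map (AlgHom.id ℂ R) X.i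

/-- The map `x ↦ ∑ (1 # x_H) ⊗ (x_A # 1)`. -/
noncomputable def comulP : Conv H (M ⊗[ℂ] M) := Conv.map (X.idI M) (L.hat X.jC)

/-- The map `x ↦ 1 ⊗ (1 # x)`. -/
noncomputable def comulQ : Conv H (M ⊗[ℂ] M) := Conv.map (inr M M) X.jC

/-- The map `x ↦ ∑ (1 # x_{1H}) ⊗ (x_{1A} # x₂)`. -/
noncomputable def comulPQ : Conv H (M ⊗[ℂ] M) := X.comulP * X.comulQ

/-- The coproduct of `1 # x`. -/
noncomputable def comulJ : Conv H (M ⊗[ℂ] M) := Conv.map X.ii L.psiC * X.comulPQ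

theorem comulQ_mul_const_inl (m : M) :
    X.comulQ * Conv.const H (inl M M m) = Conv.const H (inl M M m) * X.comulQ :=
  Conv.ext' fun x => by
    rw [Conv.mul_const_apply, Conv.const_mul_apply]
    simp [comulQ]

theorem comulQ_mul_const_inr (a : A) : X.comulQ * Conv.const H (inr M M (X.i a)) =
    Conv.map (inr M M) (Conv.map X.i (L.actBy a)) * X.comulQ := by
  rw [comulQ, ← Conv.map_const, ← map_mul, jC_mul_const, map_mul]

theorem comulP_mul_const_inl (m : M) : X.comulP * Conv.const H (inl M M m) =
    Conv.map (X.idI M) (L.hat (X.jC * Conv.const H m)) := by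
  rw [comulP, map_mul, map_mul, hat_const, Conv.map_const]
  simp [idI]

theorem comulP_mul_actBy (a : A) :
    X.comulP * Conv.map (inr M M) (Conv.map X.i (L.actBy a)) =
      Conv.map (inr M M) (Conv.map X.i (L.actBy a)) * X.comulP := by
  have h : Conv.map (inr M M) (Conv.map X.i (L.actBy a)) =
      Conv.map (X.idI M) (Conv.map (inr M A) (L.actBy a)) := Conv.ext' fun x => by simp [idI]
  rw [h, comulP, ← map_mul, hat_mul_actBy, map_mul]

/-- The right leg i(a) passes Q and becomes an action; the left leg m commutes with Q and is
absorbed into the argument of `hat`. -/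
theorem comulPQ_mul_const (m : M) (a : A) :
    X.comulPQ * Conv.const H (m ⊗ₜ X.i a) =
      Conv.map (X.idI M) (L.hat (X.jC * Conv.const H m)) *
        Conv.map (inr M M) (Conv.map X.i (L.actBy a)) * X.comulQ := by
  have h : m ⊗ₜ X.i a = inl M M m * inr M M (X.i a) := by simp
  rw [h, Conv.const_mul, comulPQ, ← mul_assoc, mul_assoc X.comulP, comulQ_mul_const_inl,
    ← mul_assoc, comulP_mul_const_inl, mul_assoc, comulQ_mul_const_inr, ← mul_assoc]

theorem comulPQ_mul_const_ii (t : A ⊗[ℂ] A) :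
    X.comulPQ * Conv.const H (X.ii t) = Conv.map X.ii (L.actTensor t) * X.comulPQ := by
  induction t with
  | zero => simp
  | add s t hs ht => simp only [map_add, mul_add, add_mul, hs, ht]
  | tmul b c =>
    have h1 : Conv.map X.ii (Conv.map (inr A A) (L.actBy c)) =
        Conv.map (inr M M) (Conv.map X.i (L.actBy c)) := Conv.ext' fun x => by simp [ii]
    have h2 : Conv.map X.ii (L.hat (L.actBy b)) =
        Conv.map (X.idI M) (L.hat (Conv.map X.i (L.actBy b))) := by
      rw [map_hat, Conv.map_map]
      congr 2
      ext <;> simp [ii, idI]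
    rw [show X.ii (b ⊗ₜ c) = X.i b ⊗ₜ X.i c from rfl, comulPQ_mul_const, jC_mul_const,
      actTensor_tmul, map_mul (Conv.map X.ii), h1, h2, map_mul, map_mul]
    change _ * X.comulP * _ * _ = _
    rw [mul_assoc (Conv.map (X.idI M) _), comulP_mul_actBy, comulPQ]
    simp only [mul_assoc]

/-- Write PQ for `comulPQ`. Moving P(y) past (PQ)(x) gives `hat₂` of j(x)j(y) followed by Q(x), and
Q(x)Q(y) is again j(x)j(y) in the right leg. Both occurrences of j(x)j(y) are replaced by χ times
j(xy); `hat₂_mul` and `hat₂_comap_mulH` then collect the χ-factors on the left and leave (PQ)(xy).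
-/
theorem comulPQ_mul_comulPQ :
    Conv.comap (tensorFst H H) X.comulPQ * Conv.comap (tensorSnd H H) X.comulPQ =
      Conv.map X.ii (L.hat₂ L.chiC * Conv.map (inr A A) L.chiC) *
        Conv.comap (mulH H) X.comulPQ := by
  have h1 : Conv.comap (tensorFst H H) X.comulPQ * Conv.comap (tensorSnd H H) X.comulP =
      Conv.map (X.idI M) (L.hat₂ (Conv.comap (tensorFst H H) X.jC *
        Conv.comap (tensorSnd H H) X.jC)) * Conv.comap (tensorFst H H) X.comulQ :=
    Conv.ext_slice fun y => by
      rw [Conv.slice_comap_fst_mul, Conv.slice_mul_comap_fst, Conv.slice_comap_snd]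
      have h : (Conv.map (X.idI M) (L.hat₂ (Conv.comap (tensorFst H H) X.jC *
        Conv.comap (tensorSnd H H) X.jC))).slice y = Conv.map (X.idI M) ((L.hat₂
        (Conv.comap (tensorFst H H) X.jC * Conv.comap (tensorSnd H H) X.jC)).slice y) := rfl
      rw [h, slice_hat₂, comulP, Conv.map_apply, hat_apply]
      simp only [map_sw, mul_sw, sw_mul]
      refine sw_congr fun h a => ?_
      rw [map_mul, Conv.slice_comap_fst_mul, Conv.slice_comap_snd]
      refine (X.comulPQ_mul_const _ _).trans ?_
      congr 2
  have h2 : Conv.comap (tensorFst H H) X.comulQ * Conv.comap (tensorSnd H H) X.comulQ =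
      Conv.map (inr M M) (Conv.comap (tensorFst H H) X.jC * Conv.comap (tensorSnd H H) X.jC) := by
    rw [map_mul]; rfl
  have h3 : Conv.map (inr M M) (Conv.map X.i L.chiC) =
      Conv.map (X.idI M) (Conv.map (inr M A) L.chiC) := Conv.ext' fun x => by simp [idI]
  have h4 : Conv.map X.ii (L.hat₂ L.chiC) = Conv.map (X.idI M) (L.hat₂ (Conv.map X.i L.chiC)) := by
    rw [map_hat₂, Conv.map_map]
    congr 2
    ext <;> simp [ii, idI]
  have h5 : Conv.map X.ii (Conv.map (inr A A) L.chiC) =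
      Conv.map (inr M M) (Conv.map X.i L.chiC) := Conv.ext' fun x => by simp [ii]
  conv_lhs => rw [comulPQ, map_mul (Conv.comap (tensorSnd H H)), ← mul_assoc]
  change Conv.comap (tensorFst H H) X.comulPQ * _ * _ = _
  rw [h1, mul_assoc, h2, jC_mul_jC, hat₂_mul, map_mul, map_mul, mul_assoc,
    ← mul_assoc (Conv.map (X.idI M) (L.hat₂ (Conv.comap _ _))), h3, ← map_mul, hat₂_comap_mulH,
    map_mul, ← h3, map_mul, h4, h5, comulPQ, map_mul, comulP, comulQ, Conv.map_comap,
    Conv.map_comap]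
  simp only [mul_assoc]

theorem comulJ_mul_const (a : A) :
    X.comulJ * Conv.const H (X.ii (Coalgebra.comul a)) =
      Conv.map X.ii (Conv.map (Bialgebra.comulAlgHom ℂ A) (L.actBy a)) * X.comulJ := by
  rw [comulJ, mul_assoc, comulPQ_mul_const_ii, ← mul_assoc, ← map_mul,
    ← map_comul_actBy_mul_psiC, map_mul, mul_assoc]

/-- The factor ψ(y) passes (PQ)(x) by the twisted action, and (PQ)(x)(PQ)(y) is reduced by
`comulPQ_mul_comulPQ`. The A ⊗ A coefficients that accumulate are the right-hand side of
`map_comul_chiC_mul_psiC`. -/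
theorem comulJ_mul_comulJ :
    Conv.comap (tensorFst H H) X.comulJ * Conv.comap (tensorSnd H H) X.comulJ =
      Conv.map X.ii (Conv.map (Bialgebra.comulAlgHom ℂ A) L.chiC) *
        Conv.comap (mulH H) X.comulJ := by
  have h1 : Conv.comap (tensorFst H H) X.comulPQ *
      Conv.comap (tensorSnd H H) (Conv.map X.ii L.psiC) =
      Conv.map X.ii (Conv.uncurry (L.actTensor ∘ₗ L.psi)) * Conv.comap (tensorFst H H) X.comulPQ :=
    Conv.ext_slice fun y => by
      rw [Conv.slice_comap_fst_mul, Conv.slice_mul_comap_fst, Conv.slice_comap_snd]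
      exact X.comulPQ_mul_const_ii (L.psi y)
  rw [comulJ, map_mul, map_mul, map_mul, mul_assoc, ← mul_assoc (Conv.comap _ X.comulPQ), h1,
    mul_assoc (Conv.map X.ii _), comulPQ_mul_comulPQ, ← Conv.map_comap, ← mul_assoc, ← mul_assoc,
    ← map_mul, ← map_mul, ← map_comul_chiC_mul_psiC, map_mul, Conv.map_comap, mul_assoc]

theorem comulJ_one : X.comulJ 1 = 1 := by
  rw [comulJ, comulPQ, conv_mul_apply_one, conv_mul_apply_one, comulP, comulQ]
  simp only [Conv.map_apply, jC_apply, X.j_one, map_one, mul_one]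
  have h1 : L.psiC 1 = 1 := L.psi_one
  have h2 : L.hat X.jC 1 = 1 := by
    change LinearMap.rTensor A X.j (L.rho 1) = 1
    rw [L.rho_one, LinearMap.rTensor_tmul, X.j_one, Algebra.TensorProduct.one_def]
  rw [h1, h2, map_one, map_one, mul_one]

/-- The coproduct of the cocycle bismash product. -/
noncomputable def comulHom : M →ₐ[ℂ] M ⊗[ℂ] M :=
  X.lift (X.ii.comp (Bialgebra.comulAlgHom ℂ A)) X.comulJ X.comulJ_one X.comulJ_mul_const
    X.comulJ_mul_comulJ

/-- The counit of the cocycle bismash product. -/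
noncomputable def counitHom : M →ₐ[ℂ] ℂ :=
  X.lift (Bialgebra.counitAlgHom ℂ A) (1 : Conv H ℂ) (by simp)
    (fun a => Conv.ext' fun x => by
      rw [one_mul, mul_one]
      simp [L.counit_act])
    (by
      rw [map_one, map_one, mul_one, map_one, mul_one]
      exact Conv.ext_tmul fun x y => by simp [L.counit_chi, mul_comm])

theorem comulHom_comp_i : X.comulHom.comp X.i = X.ii.comp (Bialgebra.comulAlgHom ℂ A) :=
  X.lift_comp_i _ _ _ _ _

theorem map_comulHom_jC : Conv.map X.comulHom X.jC = X.comulJ :=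
  X.map_lift_jC _ _ _ _ _

theorem counitHom_comp_i : X.counitHom.comp X.i = Bialgebra.counitAlgHom ℂ A :=
  X.lift_comp_i _ _ _ _ _

theorem map_counitHom_jC : Conv.map X.counitHom X.jC = 1 :=
  X.map_lift_jC _ _ _ _ _

end CrossedProduct

end CocycleLinkedPair

/-! ### Coassociativity and counitality. -/

namespace CocycleLinkedPair

open WithConv

variable {A : Type u} {H : Type v} [Ring A] [Bialgebra ℂ A] [Ring H] [Bialgebra ℂ H]
  {L : CocycleLinkedPair A H} {M : Type w} [Ring M] [Algebra ℂ M]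

namespace CrossedProduct

variable (X : L.CrossedProduct M)

/-- The map `(m ⊗ a) ⊗ b ↦ (m ⊗ i a) ⊗ i b`. -/
noncomputable def idII : (M ⊗[ℂ] A) ⊗[ℂ] A →ₐ[ℂ] (M ⊗[ℂ] M) ⊗[ℂ] M :=
  Algebra.TensorProduct.map (X.idI M) X.i

/-- The map `(a ⊗ b) ⊗ c ↦ (i a ⊗ i b) ⊗ i c`. -/
noncomputable def iii : (A ⊗[ℂ] A) ⊗[ℂ] A →ₐ[ℂ] (M ⊗[ℂ] M) ⊗[ℂ] M :=
  Algebra.TensorProduct.map X.ii X.i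

/-- The map `m ⊗ n ↦ (1 ⊗ m) ⊗ n`. -/
noncomputable def shiftRight (M : Type w) [Ring M] [Algebra ℂ M] :
    M ⊗[ℂ] M →ₐ[ℂ] (M ⊗[ℂ] M) ⊗[ℂ] M :=
  Algebra.TensorProduct.map (inr M M) (AlgHom.id ℂ M)

/-- The map `Δ ⊗ id`. -/
noncomputable def comulLeftHom : M ⊗[ℂ] M →ₐ[ℂ] (M ⊗[ℂ] M) ⊗[ℂ] M :=
  Algebra.TensorProduct.map X.comulHom (AlgHom.id ℂ M)

/-- The map `id ⊗ Δ`, with values in the left associated tensor product. -/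
noncomputable def comulRightHom : M ⊗[ℂ] M →ₐ[ℂ] (M ⊗[ℂ] M) ⊗[ℂ] M :=
  (Algebra.TensorProduct.assoc ℂ ℂ ℂ M M M).symm.toAlgHom.comp
    (Algebra.TensorProduct.map (AlgHom.id ℂ M) X.comulHom)

theorem iii_psiRight : Conv.map X.iii (L.psiRight A) = Conv.map X.idII (L.psiRight M) := by
  rw [psiRight, psiRight, Conv.map_map, Conv.map_map]
  congr 2
  ext <;> simp [iii, idII, ii, idI]

theorem comulHom_i (a : A) : X.comulHom (X.i a) = X.ii (Coalgebra.comul a) :=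
  AlgHom.congr_fun X.comulHom_comp_i a

theorem comulLeftHom_comp_ii : X.comulLeftHom.comp X.ii = X.iii.comp
    (Algebra.TensorProduct.map (Bialgebra.comulAlgHom ℂ A) (AlgHom.id ℂ A)) := by
  ext a <;> simp [comulLeftHom, ii, iii, comulHom_i]

theorem comulRightHom_comp_idI : X.comulRightHom.comp (X.idI M) =
    X.idII.comp (comulRight M A) := by
  have h : (Algebra.TensorProduct.assoc ℂ ℂ ℂ M M M).symm.toAlgHom.comp
      (Algebra.TensorProduct.map (AlgHom.id ℂ M) X.ii) = X.idII.comp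
      (Algebra.TensorProduct.assoc ℂ ℂ ℂ M A A).symm.toAlgHom := by
    ext <;> simp [ii, idII, idI, Algebra.TensorProduct.one_def]
  have h' : (Algebra.TensorProduct.map (AlgHom.id ℂ M) X.comulHom).comp (X.idI M) =
      (Algebra.TensorProduct.map (AlgHom.id ℂ M) X.ii).comp
        (Algebra.TensorProduct.map (AlgHom.id ℂ M) (Bialgebra.comulAlgHom ℂ A)) := by
    ext <;> simp [idI, comulHom_i]
  rw [comulRightHom, AlgHom.comp_assoc, h', ← AlgHom.comp_assoc, h, AlgHom.comp_assoc]
  rfl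

theorem comulRightHom_comp_ii : X.comulRightHom.comp X.ii =
    X.iii.comp (comulRight A A) := by
  have h : X.ii = (X.idI M).comp (Algebra.TensorProduct.map X.i (AlgHom.id ℂ A)) := by
    ext <;> simp [ii, idI]
  have h' : X.iii = X.idII.comp (Algebra.TensorProduct.map
      (Algebra.TensorProduct.map X.i (AlgHom.id ℂ A)) (AlgHom.id ℂ A)) := by
    ext <;> simp [ii, idI, iii, idII]
  have h'' : (comulRight M A).comp (Algebra.TensorProduct.map X.i (AlgHom.id ℂ A)) =
      (Algebra.TensorProduct.map (Algebra.TensorProduct.map X.i (AlgHom.id ℂ A))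
        (AlgHom.id ℂ A)).comp (comulRight A A) :=
    Algebra.TensorProduct.ext' fun a b => by
      simp [comulRight_tmul, map_sw]
  rw [h, ← AlgHom.comp_assoc, comulRightHom_comp_idI, h', AlgHom.comp_assoc, h'',
    AlgHom.comp_assoc]

theorem comulRightHom_comp_inr :
    X.comulRightHom.comp (inr M M) = (shiftRight M).comp X.comulHom := by
  have h : (Algebra.TensorProduct.assoc ℂ ℂ ℂ M M M).symm.toAlgHom.comp
      (inr M (M ⊗[ℂ] M)) = shiftRight M := by
    ext <;> simp [shiftRight, Algebra.TensorProduct.one_def]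
  rw [← h, comulRightHom, AlgHom.comp_assoc, AlgHom.comp_assoc]
  congr 1

/-- The coproduct of 1 # x is the product ψPQ. Under Δ ⊗ id the factor P becomes `hat` of ψPQ, so ψ
and ρ are iterated. The cocycle identity of ψ converts Δψ times `hat` ψ, releasing a shifted ψ that
turns the iterated coaction into Δ on the A-leg by `psiRight_mul_hat_hat`; the remaining factors
form the coproduct in the last two legs. -/
theorem map_comulLeftHom_comulJ :
    Conv.map X.comulLeftHom X.comulJ = Conv.map X.comulRightHom X.comulJ := by
  have hP : Conv.map X.comulLeftHom X.comulP = Conv.map (Algebra.TensorProduct.map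
      (AlgHom.id ℂ (M ⊗[ℂ] M)) X.i) (L.hat X.comulJ) := by
    rw [← map_comulHom_jC, map_hat, comulP, Conv.map_map, Conv.map_map]
    congr 2
    ext <;> simp [comulLeftHom, idI]
  have hψ : Conv.map (Algebra.TensorProduct.map (AlgHom.id ℂ (M ⊗[ℂ] M)) X.i)
      (L.hat (Conv.map X.ii L.psiC)) = Conv.map X.iii (L.hat L.psiC) := by
    rw [map_hat, Conv.map_map]
    congr 2
    ext <;> simp [iii]
  have hPP : Conv.map (Algebra.TensorProduct.map (AlgHom.id ℂ (M ⊗[ℂ] M)) X.i)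
      (L.hat X.comulP) = Conv.map X.idII (L.hat (L.hat X.jC)) := by
    rw [comulP, map_hat, Conv.map_map]
    congr 2
    ext <;> simp [idII]
  have hQ : Conv.map (Algebra.TensorProduct.map (AlgHom.id ℂ (M ⊗[ℂ] M)) X.i)
      (L.hat X.comulQ) = Conv.map (shiftRight M) X.comulP := by
    rw [comulQ, map_hat, comulP, Conv.map_map, Conv.map_map]
    congr 2
    ext <;> simp [shiftRight, idI]
  have hQ' : Conv.map X.comulLeftHom X.comulQ = Conv.map (shiftRight M) X.comulQ := by
    rw [comulQ, Conv.map_map, Conv.map_map]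
    congr 2
    ext
    simp [shiftRight, comulLeftHom]
  have hψ' : Conv.map X.idII (L.psiRight M) =
      Conv.map (shiftRight M) (Conv.map X.ii L.psiC) := by
    rw [psiRight, Conv.map_map, Conv.map_map]
    congr 2
    ext <;> simp [shiftRight, idII, ii, idI]
  have hQR : Conv.map X.comulRightHom X.comulQ = Conv.map (shiftRight M) X.comulJ := by
    rw [comulQ, Conv.map_map, comulRightHom_comp_inr, ← Conv.map_map, map_comulHom_jC]
  calc Conv.map X.comulLeftHom X.comulJ
      = Conv.map X.iii (Conv.map (Algebra.TensorProduct.map (Bialgebra.comulAlgHom ℂ A)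
          (AlgHom.id ℂ A)) L.psiC * L.hat L.psiC) * (Conv.map X.idII (L.hat (L.hat X.jC)) *
          (Conv.map (shiftRight M) X.comulP * Conv.map (shiftRight M) X.comulQ)) := by
        conv_lhs => rw [comulJ, comulPQ, map_mul, map_mul, hP, hQ', comulJ, comulPQ, map_mul,
          map_mul, map_mul, map_mul, hψ, hPP, hQ, Conv.map_map, comulLeftHom_comp_ii,
          ← Conv.map_map]
        rw [map_mul]
        simp only [mul_assoc]
    _ = Conv.map X.iii (Conv.map (comulRight A A) L.psiC) * (Conv.map X.idII (L.psiRight M *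
          L.hat (L.hat X.jC)) *
          (Conv.map (shiftRight M) X.comulP * Conv.map (shiftRight M) X.comulQ)) := by
        rw [map_comul_psiC_mul_hat_psiC, map_mul, map_mul, iii_psiRight]
        simp only [mul_assoc]
    _ = Conv.map X.iii (Conv.map (comulRight A A) L.psiC) * (Conv.map X.idII
          (Conv.map (comulRight M A) (L.hat X.jC)) * Conv.map (shiftRight M) X.comulJ) := by
        rw [psiRight_mul_hat_hat, map_mul, hψ', comulJ, comulPQ, map_mul, map_mul]
        simp only [mul_assoc]
    _ = Conv.map X.comulRightHom X.comulJ := by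
        rw [← hQR, Conv.map_map, Conv.map_map, ← comulRightHom_comp_ii, ← comulRightHom_comp_idI]
        rw [comulJ, comulPQ, comulP, map_mul, map_mul]
        rfl

/-- Both composites are algebra maps, so they are compared on i, where this is coassociativity of A,
and on j. -/
theorem comulHom_coassoc :
    (Algebra.TensorProduct.assoc ℂ ℂ ℂ M M M).toAlgHom.comp
      ((Algebra.TensorProduct.map X.comulHom (.id ℂ M)).comp X.comulHom) =
      (Algebra.TensorProduct.map (.id ℂ M) X.comulHom).comp X.comulHom := by
  have h : X.comulLeftHom.comp X.comulHom = X.comulRightHom.comp X.comulHom := by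
    refine X.algHom_ext ?_ ?_
    · rw [AlgHom.comp_assoc, AlgHom.comp_assoc, comulHom_comp_i, ← AlgHom.comp_assoc,
        ← AlgHom.comp_assoc, comulLeftHom_comp_ii, comulRightHom_comp_ii, AlgHom.comp_assoc,
        AlgHom.comp_assoc]
      congr 1
      refine AlgHom.ext fun a => ?_
      have := Coalgebra.coassoc_symm_apply (R := ℂ) a
      exact this.symm
    · rw [← Conv.map_map, ← Conv.map_map, map_comulHom_jC, map_comulLeftHom_comulJ]
  change (Algebra.TensorProduct.assoc ℂ ℂ ℂ M M M).toAlgHom.comp (X.comulLeftHom.comp _) = _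
  rw [h, comulRightHom]
  refine AlgHom.ext fun m => ?_
  exact (Algebra.TensorProduct.assoc ℂ ℂ ℂ M M M).apply_symm_apply _

theorem map_psiC_counit_left {R : Type*} [Ring R] [Algebra ℂ R] (φ : A ⊗[ℂ] A →ₐ[ℂ] R)
    (θ : A →ₐ[ℂ] R) (h : ∀ a b, φ (a ⊗ₜ b) = eps a • θ b) : Conv.map φ L.psiC = 1 :=
  Conv.ext' fun x => by
    have := congrArg θ (L.psi_counit_left x)
    rw [Conv.map_apply, psiC_apply, Conv.one_apply]
    simpa [map_sw, h] using this

theorem map_psiC_counit_right {R : Type*} [Ring R] [Algebra ℂ R] (φ : A ⊗[ℂ] A →ₐ[ℂ] R)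
    (θ : A →ₐ[ℂ] R) (h : ∀ a b, φ (a ⊗ₜ b) = eps b • θ a) : Conv.map φ L.psiC = 1 :=
  Conv.ext' fun x => by
    have := congrArg θ (L.psi_counit_right x)
    rw [Conv.map_apply, psiC_apply, Conv.one_apply]
    simpa [map_sw, h] using this

theorem counitHom_i (a : A) : X.counitHom (X.i a) = eps a :=
  AlgHom.congr_fun X.counitHom_comp_i a

theorem counitHom_j (x : H) : X.counitHom (X.j x) = eps x := by
  have h := LinearMap.congr_fun (congrArg ofConv X.map_counitHom_jC) x
  simpa using h

/-- The map `ε ⊗ id`. -/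
noncomputable def counitLeftHom : M ⊗[ℂ] M →ₐ[ℂ] M :=
  (Algebra.TensorProduct.lid ℂ M).toAlgHom.comp
    (Algebra.TensorProduct.map X.counitHom (AlgHom.id ℂ M))

/-- The map `id ⊗ ε`. -/
noncomputable def counitRightHom : M ⊗[ℂ] M →ₐ[ℂ] M :=
  (Algebra.TensorProduct.rid ℂ ℂ M).toAlgHom.comp
    (Algebra.TensorProduct.map (AlgHom.id ℂ M) X.counitHom)

theorem counitLeftHom_tmul (m n : M) : X.counitLeftHom (m ⊗ₜ n) = X.counitHom m • n := rfl

theorem counitRightHom_tmul (m n : M) : X.counitRightHom (m ⊗ₜ n) = X.counitHom n • m := rfl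

theorem counitLeftHom_comp_comulHom : X.counitLeftHom.comp X.comulHom = AlgHom.id ℂ M := by
  refine X.algHom_ext ?_ ?_
  · rw [AlgHom.comp_assoc, comulHom_comp_i]
    refine AlgHom.ext fun a => ?_
    conv_rhs => rw [← sw2_counit_left a]
    simp [comulAlgHom_apply_eq_sw, sw2, map_sw, ii, counitLeftHom_tmul, counitHom_i,
      -Bialgebra.comulAlgHom_apply]
  · have hP : Conv.map X.counitLeftHom X.comulP = 1 := Conv.ext' fun x => by
      have h := congrArg X.i (L.rho_counit_left x)
      rw [Conv.map_apply, comulP, Conv.map_apply, hat_apply, Conv.one_apply]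
      simpa [map_sw, idI, counitLeftHom_tmul, counitHom_j] using h
    rw [← Conv.map_map, map_comulHom_jC, comulJ, comulPQ, map_mul, map_mul, hP, one_mul,
      Conv.map_map, map_psiC_counit_left (X.counitLeftHom.comp X.ii) X.i
      fun a b => by simp [ii, counitLeftHom_tmul, counitHom_i], one_mul]
    exact Conv.ext' fun x => by simp [comulQ, counitLeftHom_tmul]

theorem counitRightHom_comp_comulHom : X.counitRightHom.comp X.comulHom = AlgHom.id ℂ M := by
  refine X.algHom_ext ?_ ?_
  · rw [AlgHom.comp_assoc, comulHom_comp_i]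
    refine AlgHom.ext fun a => ?_
    conv_rhs => rw [← sw2_counit_right a]
    simp [comulAlgHom_apply_eq_sw, sw2, map_sw, ii, counitRightHom_tmul, counitHom_i,
      -Bialgebra.comulAlgHom_apply]
  · have hQ : Conv.map X.counitRightHom X.comulQ = 1 := Conv.ext' fun x => by
      rw [Conv.one_apply]
      simp [comulQ, counitRightHom_tmul, counitHom_j]
    rw [← Conv.map_map, map_comulHom_jC, comulJ, comulPQ, map_mul, map_mul, hQ, mul_one,
      Conv.map_map, map_psiC_counit_right (X.counitRightHom.comp X.ii) X.i
      fun a b => by simp [ii, counitRightHom_tmul, counitHom_i], one_mul]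
    refine Conv.ext' fun x => ?_
    have h := congrArg X.j (L.rho_counit_right x)
    rw [Conv.map_apply, comulP, Conv.map_apply, hat_apply]
    simpa [map_sw, idI, counitRightHom_tmul, counitHom_i] using h

/-- The cocycle bismash product as a bialgebra. -/
noncomputable abbrev bialgebra : Bialgebra ℂ M :=
  Bialgebra.ofAlgHom X.comulHom X.counitHom X.comulHom_coassoc
    (AlgHom.ext fun m => (Algebra.TensorProduct.lid ℂ M).injective <| by
      have h := AlgHom.congr_fun X.counitLeftHom_comp_comulHom m
      exact h.trans ((Algebra.TensorProduct.lid ℂ M).apply_symm_apply m).symm)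
    (AlgHom.ext fun m => (Algebra.TensorProduct.rid ℂ ℂ M).injective <| by
      have h := AlgHom.congr_fun X.counitRightHom_comp_comulHom m
      exact h.trans ((Algebra.TensorProduct.rid ℂ ℂ M).apply_symm_apply m).symm)

end CrossedProduct

end CocycleLinkedPair

/-! ### Convolution invertibility as bijectivity of a shift map. -/

section ConvShift

open WithConv CocycleLinkedPair

variable {C R : Type*} [Ring C] [Bialgebra ℂ C] [Ring R] [Algebra ℂ R]

/-- The `R`-linear map `r ⊗ c ↦ ∑ r f(c₁) ⊗ c₂`. -/
noncomputable def convShift (f : Conv C R) : R ⊗[ℂ] C →ₗ[ℂ] R ⊗[ℂ] C :=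
  TensorProduct.lift ((LinearMap.mul ℂ (R ⊗[ℂ] C)).compl₁₂ (inl R C).toLinearMap
    (Conv.map (inl R C) f * Conv.map (inr R C) (toConv LinearMap.id)).ofConv)

theorem convShift_tmul (f : Conv C R) (r : R) (c : C) : convShift f (r ⊗ₜ c) =
    inl R C r * (Conv.map (inl R C) f * Conv.map (inr R C) (toConv LinearMap.id)) c := rfl

theorem convShift_tmul' (f : Conv C R) (r : R) (c : C) : convShift f (r ⊗ₜ c) =
    sw2 c fun c1 c2 => (r * f c1) ⊗ₜ[ℂ] c2 := by
  rw [convShift_tmul, Conv.mul_apply]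
  simp [sw2, mul_sw]

theorem convShift_inl_mul (f : Conv C R) (r : R) (t : R ⊗[ℂ] C) :
    convShift f (inl R C r * t) = inl R C r * convShift f t := by
  induction t with
  | zero => simp
  | add s t hs ht => simp only [map_add, mul_add, hs, ht]
  | tmul s c =>
    rw [convShift_tmul, ← mul_assoc, ← map_mul, ← convShift_tmul]
    simp

/-- The shift reverses convolution products; coassociativity enters as associativity of convolution.
-/
theorem convShift_convShift (f g : Conv C R) (t : R ⊗[ℂ] C) :
    convShift g (convShift f t) = convShift (f * g) t := by
  induction t with
  | zero => simp
  | add s t hs ht => simp only [map_add, hs, ht]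
  | tmul r c =>
    rw [convShift_tmul f, convShift_inl_mul, convShift_tmul (f * g), map_mul, mul_assoc,
      Conv.mul_apply, Conv.mul_apply]
    simp only [sw2, map_sw]
    congr 1
    refine sw_congr fun c1 c2 => ?_
    rw [Conv.map_apply, ← convShift_tmul]
    simp

theorem convShift_one (t : R ⊗[ℂ] C) : convShift (1 : Conv C R) t = t := by
  induction t with
  | zero => simp
  | add s t hs ht => simp only [map_add, hs, ht]
  | tmul r c =>
    rw [convShift_tmul, map_one, one_mul]
    simp

theorem convShift_bijective {f : Conv C R} (hf : IsUnit f) :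
    Function.Bijective (convShift f) := by
  obtain ⟨g, hfg, hgf⟩ := isUnit_iff_exists.mp hf
  refine Function.bijective_iff_has_inverse.mpr ⟨convShift g, fun t => ?_, fun t => ?_⟩
  · rw [convShift_convShift, hfg, convShift_one]
  · rw [convShift_convShift, hgf, convShift_one]

/-- The map `r ⊗ c ↦ ε(c) r`. -/
noncomputable def counitSnd (R C : Type*) [Ring C] [Bialgebra ℂ C] [Ring R] [Algebra ℂ R] :
    R ⊗[ℂ] C →ₐ[ℂ] R :=
  (Algebra.TensorProduct.rid ℂ ℂ R).toAlgHom.comp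
    (Algebra.TensorProduct.map (AlgHom.id ℂ R) (Bialgebra.counitAlgHom ℂ C))

theorem counitSnd_tmul (r : R) (c : C) : counitSnd R C (r ⊗ₜ c) = eps c • r := rfl

theorem counitSnd_convShift (f : Conv C R) (c : C) :
    counitSnd R C (convShift f (1 ⊗ₜ c)) = f c := by
  rw [convShift_tmul, map_one, one_mul, ← Conv.map_apply, map_mul, Conv.map_map, Conv.map_map]
  have h1 : (counitSnd R C).comp (inl R C) = AlgHom.id ℂ R :=
    AlgHom.ext fun r => by simp [counitSnd_tmul]
  have h2 : Conv.map ((counitSnd R C).comp (inr R C)) (toConv LinearMap.id) = 1 :=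
    Conv.ext' fun c => by
      rw [Conv.one_apply]
      simp [counitSnd_tmul]
  rw [h1, h2, mul_one]
  rfl

/-- The inverse of the shift is again left R-linear, hence determined by its values on 1 ⊗ c;
applying id ⊗ ε to them gives the convolution inverse. -/
theorem isUnit_of_convShift_bijective {f : Conv C R} (hf : Function.Bijective (convShift f)) :
    IsUnit f := by
  let k := LinearEquiv.ofBijective (convShift f) hf
  have hk (t) : k.symm (convShift f t) = t := k.symm_apply_apply t
  have hlin (r : R) (t : R ⊗[ℂ] C) : k.symm (inl R C r * t) = inl R C r * k.symm t := by
    obtain ⟨s, rfl⟩ := hf.2 t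
    rw [← convShift_inl_mul, hk, hk]
  let g : Conv C R := toConv ((counitSnd R C).toLinearMap ∘ₗ k.symm.toLinearMap ∘ₗ
    TensorProduct.mk ℂ R C 1)
  have hg (c : C) : g c = counitSnd R C (k.symm (1 ⊗ₜ c)) := rfl
  have hfg : f * g = 1 := Conv.ext' fun c => by
    rw [Conv.mul_apply]
    have h : (sw2 c fun c1 c2 => f c1 * g c2) =
        counitSnd R C (k.symm (convShift f (1 ⊗ₜ c))) := by
      rw [convShift_tmul']
      simp only [sw2, map_sw]
      refine sw_congr fun c1 c2 => ?_
      have h' : (1 * f c1) ⊗ₜ[ℂ] c2 = inl R C (f c1) * (1 ⊗ₜ c2) := by simp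
      rw [h', hlin, map_mul, hg]
      simp [counitSnd_tmul]
    rw [h, hk, counitSnd_tmul, Conv.one_apply]
  -- From f * g = 1 the shift of g is a left inverse of the shift of f; surjectivity of the latter
  -- makes it two-sided.
  have hgf : g * f = 1 := Conv.ext' fun c => by
    rw [← counitSnd_convShift, ← convShift_convShift]
    obtain ⟨s, hs⟩ := hf.2 (1 ⊗ₜ c)
    have h := convShift_convShift f g s
    rw [hfg, convShift_one] at h
    rw [← hs, h, hs, counitSnd_tmul, Conv.one_apply]
  exact isUnit_iff_exists.mpr ⟨g, hfg, hgf⟩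

end ConvShift

/-! ### Bialgebras presented as bismash products, and their projections to A and H. -/

namespace CocycleLinkedPair

open WithConv

section Counits

variable {A : Type u} {H : Type v} [Ring A] [Bialgebra ℂ A] [Ring H] [Bialgebra ℂ H]
  (L : CocycleLinkedPair A H) {Y : Type*} [AddCommGroup Y] [Module ℂ Y]

theorem sw_rho_counit_left (F : A →ₗ[ℂ] Y) (x : H) :
    (sw (L.rho x) fun h b => eps h • F b) = eps x • F 1 := by
  simpa [map_sw] using congrArg F (L.rho_counit_left x)

theorem sw_rho_counit_right (F : H →ₗ[ℂ] Y) (x : H) :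
    (sw (L.rho x) fun h b => eps b • F h) = F x := by
  simpa [map_sw] using congrArg F (L.rho_counit_right x)

end Counits

variable {A : Type u} {H : Type v} [Ring A] [Bialgebra ℂ A] [Ring H] [Bialgebra ℂ H]
  {L : CocycleLinkedPair A H}

/-- The presentation of a bialgebra `M` as the cocycle bismash product `A^ψ #_χ H`. -/
structure BismashPresentation (L : CocycleLinkedPair A H) (M : Type w) [Ring M] [Bialgebra ℂ M]
    extends L.CrossedProduct M where
  comul_i : ∀ a, Coalgebra.comul (R := ℂ) (i a) = toCrossedProduct.ii (Coalgebra.comul a)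
  comul_j : ∀ x, Coalgebra.comul (R := ℂ) (j x) = toCrossedProduct.comulJ x
  counit_i : ∀ a, eps (i a) = eps a
  counit_j : ∀ x, eps (j x) = eps x

/-- The bialgebra structure on a crossed product presents it as the bismash product. -/
noncomputable def CrossedProduct.bismashPresentation {M : Type w} [Ring M] [Algebra ℂ M]
    (X : L.CrossedProduct M) : letI := X.bialgebra; L.BismashPresentation M :=
  letI := X.bialgebra
  { X with
    comul_i := fun a => X.comulHom_i a
    comul_j := fun x => LinearMap.congr_fun (congrArg ofConv X.map_comulHom_jC) x
    counit_i := X.counitHom_i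
    counit_j := X.counitHom_j }

namespace BismashPresentation

variable {M : Type w} [Ring M] [Bialgebra ℂ M] (X : L.BismashPresentation M)

theorem counit_mul (a : A) (x : H) : eps (X.i a * X.j x) = eps a * eps x := by
  rw [eps, Bialgebra.counit_mul, X.counit_i, X.counit_j]

theorem comul_mul (a : A) (x : H) : Coalgebra.comul (R := ℂ) (X.i a * X.j x) =
    X.ii (Coalgebra.comul a) * X.comulJ x := by
  rw [Bialgebra.comul_mul, X.comul_i, X.comul_j]

/-- The map `a # x ↦ ε(x) a`. -/
noncomputable def toA : M →ₗ[ℂ] A := (counitSnd A H).toLinearMap ∘ₗ X.e.symm.toLinearMap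

theorem toA_mul (a : A) (x : H) : X.toA (X.i a * X.j x) = eps x • a := by
  rw [← X.e_tmul]
  simp [toA, counitSnd_tmul]

theorem toA_j (x : H) : X.toA (X.j x) = eps x • 1 := by
  simpa using X.toA_mul 1 x

theorem toA_i (a : A) : X.toA (X.i a) = a := by
  simpa [X.j_one] using X.toA_mul a 1

theorem toA_i_mul (a : A) (m : M) : X.toA (X.i a * m) = a * X.toA m := by
  refine LinearMap.congr_fun (f := X.toA ∘ₗ LinearMap.mulLeft ℂ (X.i a))
    (g := LinearMap.mulLeft ℂ a ∘ₗ X.toA) (X.linearMap_ext fun b x => ?_) m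
  simp only [LinearMap.comp_apply, LinearMap.mulLeft_apply]
  rw [← mul_assoc, ← map_mul, toA_mul, toA_mul, mul_smul_comm]

/-- The map `a # x ↦ ε(a) x`. -/
noncomputable def toHAlg : M →ₐ[ℂ] H :=
  X.lift ((Algebra.ofId ℂ H).comp (Bialgebra.counitAlgHom ℂ A)) (toConv LinearMap.id) rfl
    (fun a => Conv.ext' fun x => by
      have h : Conv.map ((Algebra.ofId ℂ H).comp (Bialgebra.counitAlgHom ℂ A)) (L.actBy a) =
          Conv.const H (algebraMap ℂ H (eps a)) := Conv.ext' fun x => by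
        simp [Algebra.ofId_apply, L.counit_act, Algebra.algebraMap_eq_smul_one, smul_smul, mul_comm]
      rw [h, Conv.const_mul_apply, Conv.mul_const_apply]
      exact (Algebra.commutes _ _).symm)
    (by
      have h : Conv.map ((Algebra.ofId ℂ H).comp (Bialgebra.counitAlgHom ℂ A)) L.chiC = 1 :=
        Conv.ext_tmul fun x y => by
          rw [Conv.one_apply]
          simp [Algebra.ofId_apply, L.counit_chi, Algebra.algebraMap_eq_smul_one, mul_comm]
      rw [h, one_mul]
      exact Conv.ext_tmul fun x y => Conv.comap_fst_mul_comap_snd_tmul _ _ x y)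

theorem toHAlg_mul (a : A) (x : H) : X.toHAlg (X.i a * X.j x) = eps a • x :=
  (X.lift_mul _ _ _ _ _ a x).trans (Algebra.smul_def _ _).symm

theorem toHAlg_i (a : A) : X.toHAlg (X.i a) = eps a • 1 := by
  simpa [X.j_one] using X.toHAlg_mul a 1

theorem toHAlg_j (x : H) : X.toHAlg (X.j x) = x := by
  simpa using X.toHAlg_mul 1 x

/-- The projection `a # x ↦ ε(a) x` as a bialgebra map. -/
noncomputable def toH : M →ₐc[ℂ] H :=
  BialgHom.ofAlgHom X.toHAlg
    (by
      refine X.algHom_ext (AlgHom.ext fun a => ?_) (Conv.ext' fun x => ?_)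
      · simp [toHAlg_i, X.counit_i]
      · simp [toHAlg_j, X.counit_j])
    (by
      have hi (t : A ⊗[ℂ] A) : Algebra.TensorProduct.map X.toHAlg X.toHAlg (X.ii t) =
          algebraMap ℂ _ (eps t) := by
        induction t with
        | zero => simp
        | add s t hs ht => simp only [map_add, hs, ht]
        | tmul a b =>
          simp [CrossedProduct.ii, toHAlg_i, Algebra.algebraMap_eq_smul_one,
            TensorProduct.smul_tmul', smul_smul, Algebra.TensorProduct.one_def, mul_comm]
      refine X.algHom_ext (AlgHom.ext fun a => ?_) (Conv.ext' fun x => ?_)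
      · have h : eps (Coalgebra.comul (R := ℂ) a) = eps a := by
          have := congrArg (eps (C := A)) (sw2_counit_left a)
          rw [← this, ← sw2_self a]
          simp [sw2, map_sw, mul_comm]
        simp only [AlgHom.comp_apply, Bialgebra.comulAlgHom_apply, X.comul_i, hi, h, toHAlg_i]
        simp [Algebra.algebraMap_eq_smul_one]
      · simp only [Conv.map_apply, AlgHom.comp_apply, Bialgebra.comulAlgHom_apply,
          CrossedProduct.jC_apply, X.comul_j, toHAlg_j]
        have hψ : Conv.map ((Algebra.TensorProduct.map X.toHAlg X.toHAlg).comp X.ii) L.psiC = 1 :=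
          CrossedProduct.map_psiC_counit_left _
            ((Algebra.ofId ℂ (H ⊗[ℂ] H)).comp (Bialgebra.counitAlgHom ℂ A)) fun a b => by
              rw [AlgHom.comp_apply, hi]
              simp [Algebra.ofId_apply, Algebra.algebraMap_eq_smul_one, smul_smul, mul_comm]
        have hP : Conv.map (Algebra.TensorProduct.map X.toHAlg X.toHAlg) X.comulP =
            Conv.map (inl H H) (toConv LinearMap.id) := Conv.ext' fun x => by
          rw [CrossedProduct.comulP, Conv.map_apply, Conv.map_apply, hat_apply]
          simpa [map_sw, CrossedProduct.idI, toHAlg_j, toHAlg_i] using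
            L.sw_rho_counit_right (inl H H).toLinearMap x
        have hQ : Conv.map (Algebra.TensorProduct.map X.toHAlg X.toHAlg) X.comulQ =
            Conv.map (inr H H) (toConv LinearMap.id) := Conv.ext' fun x => by
          simp [CrossedProduct.comulQ, toHAlg_j]
        have h : Conv.map (Algebra.TensorProduct.map X.toHAlg X.toHAlg) X.comulJ =
            Conv.map (inl H H) (toConv LinearMap.id) * Conv.map (inr H H) (toConv LinearMap.id) := by
          rw [CrossedProduct.comulJ, CrossedProduct.comulPQ, map_mul, map_mul, hP, hQ,
            Conv.map_map, hψ, one_mul]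
        rw [← Conv.map_apply, h, Conv.mul_apply, ← sw2_self x]
        simp [sw2])

@[simp] theorem toH_mul (a : A) (x : H) : X.toH (X.i a * X.j x) = eps a • x := X.toHAlg_mul a x

theorem toH_i (a : A) : X.toH (X.i a) = eps a • 1 := X.toHAlg_i a

theorem toH_j (x : H) : X.toH (X.j x) = x := X.toHAlg_j x

end BismashPresentation

end CocycleLinkedPair

/-! ### The antipode of the bismash product. -/

namespace CocycleLinkedPair

open WithConv

variable {A : Type u} {H : Type v} [Ring A] [Bialgebra ℂ A] [Ring H] [Bialgebra ℂ H]
  {L : CocycleLinkedPair A H}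

/-- Identify M ⊗ H with A ⊗ H ⊗ H. The shift of j becomes a ⊗ x ⊗ y ↦ ∑ aχ(x₁, y₁) ⊗ x₂y₂ ⊗ y₃,
which is the shift of χ followed by the canonical map x ⊗ y ↦ ∑ xy₁ ⊗ y₂ of H. Both are bijective.
-/
theorem CrossedProduct.isUnit_jC {M : Type w} [Ring M] [Algebra ℂ M] (X : L.CrossedProduct M)
    (hχ : IsUnit L.chiC) (hH : IsUnit (toConv LinearMap.id : Conv H H)) : IsUnit X.jC := by
  apply isUnit_of_convShift_bijective
  let E : A ⊗[ℂ] (H ⊗[ℂ] H) ≃ₗ[ℂ] M ⊗[ℂ] H :=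
    (TensorProduct.assoc ℂ A H H).symm ≪≫ₗ TensorProduct.congr X.e (LinearEquiv.refl ℂ H)
  have hE (a : A) (x y : H) : E (a ⊗ₜ (x ⊗ₜ y)) = (X.i a * X.j x) ⊗ₜ y := by
    simp [E, X.e_tmul]
  let β : A ⊗[ℂ] (H ⊗[ℂ] H) →ₗ[ℂ] A ⊗[ℂ] (H ⊗[ℂ] H) :=
    LinearMap.lTensor A (convShift (toConv LinearMap.id : Conv H H))
  have hβ : Function.Bijective β :=
    (LinearEquiv.lTensor A (LinearEquiv.ofBijective _ (convShift_bijective hH))).bijective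
  let K : Conv (H ⊗[ℂ] H) (M ⊗[ℂ] H) := Conv.comap (mulH H) (Conv.map (inl M H) X.jC) *
    Conv.comap (tensorSnd H H) (Conv.map (inr M H) (toConv LinearMap.id))
  have hK (a : A) (q : H ⊗[ℂ] H) : E (β (a ⊗ₜ q)) = inl M H (X.i a) * K q := by
    induction q with
    | zero => simp
    | add s t hs ht => simp only [map_add, mul_add, TensorProduct.tmul_add, hs, ht]
    | tmul x y =>
      simp only [β, LinearMap.lTensor_tmul, K]
      rw [convShift_tmul', Conv.mul_comap_snd_tmul]
      simp only [sw2, tmul_sw, map_sw, hE, mul_sw]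
      refine sw_congr fun y1 y2 => ?_
      simp
  have h : convShift X.jC ∘ₗ E.toLinearMap = E.toLinearMap ∘ₗ β ∘ₗ convShift L.chiC := by
    refine TensorProduct.ext' fun a q => ?_
    have h1 : Conv.map (inl M H) (Conv.map X.i L.chiC) * K =
        Conv.map (inl M H) (Conv.comap (tensorFst H H) X.jC * Conv.comap (tensorSnd H H) X.jC) *
          Conv.comap (tensorSnd H H) (Conv.map (inr M H) (toConv LinearMap.id)) := by
      rw [X.jC_mul_jC, map_mul, mul_assoc]
      rfl
    have h2 : E (β (convShift L.chiC (a ⊗ₜ q))) = inl M H (X.i a) *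
        (Conv.map (inl M H) (Conv.map X.i L.chiC) * K) q := by
      rw [convShift_tmul', Conv.mul_apply]
      simp only [sw2, map_sw, hK, mul_sw]
      refine sw_congr fun q1 q2 => ?_
      simp [← mul_assoc]
    simp only [LinearMap.comp_apply, LinearEquiv.coe_coe]
    rw [h2, h1]
    clear h2
    induction q with
    | zero => simp
    | add s t hs ht => simp only [map_add, mul_add, TensorProduct.tmul_add, hs, ht]
    | tmul x y =>
      rw [hE, convShift_tmul', Conv.mul_comap_snd_tmul]
      simp only [sw2, mul_sw]
      refine sw_congr fun y1 y2 => ?_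
      rw [Conv.map_apply, Conv.comap_fst_mul_comap_snd_tmul]
      simp [mul_assoc]
  have hb : Function.Bijective (convShift X.jC ∘ E) := by
    have := E.bijective.comp (hβ.comp (convShift_bijective hχ))
    convert this using 1
    exact congrArg DFunLike.coe h
  exact (Function.Bijective.of_comp_iff _ E.bijective).mp hb

namespace BismashPresentation

variable {M : Type w} [Ring M] [Bialgebra ℂ M] (X : L.BismashPresentation M)

theorem rTensor_toA_ii_mul (t : A ⊗[ℂ] A) (s : M ⊗[ℂ] M) :
    LinearMap.rTensor M X.toA (X.ii t * s) = X.idI A t * LinearMap.rTensor M X.toA s := by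
  induction t with
  | zero => simp
  | add t t' ht ht' => simp only [map_add, add_mul, ht, ht']
  | tmul a b =>
    induction s with
    | zero => simp
    | add s s' hs hs' => simp only [map_add, mul_add, hs, hs']
    | tmul m n => simp [CrossedProduct.ii, CrossedProduct.idI, toA_i_mul]

theorem rTensor_toA_mul_inr (s : M ⊗[ℂ] M) (n : M) :
    LinearMap.rTensor M X.toA (s * inr M M n) = LinearMap.rTensor M X.toA s * inr A M n := by
  induction s with
  | zero => simp
  | add s s' hs hs' => simp only [map_add, add_mul, hs, hs']
  | tmul m n => simp

theorem rTensor_toA_comulP (x : H) : LinearMap.rTensor M X.toA (X.comulP x) = eps x • 1 := by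
  rw [CrossedProduct.comulP, Conv.map_apply, hat_apply]
  have h := L.sw_rho_counit_left ((X.idI A).toLinearMap ∘ₗ (inr A A).toLinearMap) x
  simpa [map_sw, CrossedProduct.idI, toA_j, TensorProduct.smul_tmul',
    Algebra.TensorProduct.one_def] using h

/-- Projecting the left leg to A applies ε to the H-leg of ρ(x₁), so the coaction disappears. -/
theorem rTensor_toA_comulPQ (x : H) :
    LinearMap.rTensor M X.toA (X.comulPQ x) = inr A M (X.j x) := by
  rw [CrossedProduct.comulPQ, Conv.mul_apply]
  conv_rhs => rw [← sw2_counit_left x]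
  simp only [sw2, map_sw, CrossedProduct.comulQ, Conv.map_apply, rTensor_toA_mul_inr,
    rTensor_toA_comulP, CrossedProduct.jC_apply, smul_mul_assoc, one_mul, map_smul]

/-- The counterpart of `isUnit_jC`: on A ⊗ A ⊗ H the shift of `toA` is the canonical map c ⊗ a ↦ ∑
ca₁ ⊗ a₂ of A followed by the shift of ψ, both bijective. -/
theorem isUnit_toA (hψ : IsUnit L.psiC) (hA : IsUnit (toConv LinearMap.id : Conv A A)) :
    IsUnit (toConv X.toA : Conv M A) := by
  apply isUnit_of_convShift_bijective
  let E : (A ⊗[ℂ] A) ⊗[ℂ] H ≃ₗ[ℂ] A ⊗[ℂ] M :=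
    TensorProduct.assoc ℂ A A H ≪≫ₗ TensorProduct.congr (LinearEquiv.refl ℂ A) X.e
  have hE (t : A ⊗[ℂ] A) (x : H) : E (t ⊗ₜ x) = X.idI A t * inr A M (X.j x) := by
    induction t with
    | zero => simp
    | add s t hs ht => simp only [map_add, add_mul, TensorProduct.add_tmul, hs, ht]
    | tmul a b => simp [E, X.e_tmul, CrossedProduct.idI]
  let β : (A ⊗[ℂ] A) ⊗[ℂ] H →ₗ[ℂ] (A ⊗[ℂ] A) ⊗[ℂ] H :=
    LinearMap.rTensor H (convShift (toConv LinearMap.id : Conv A A))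
  have hβ : Function.Bijective β :=
    (LinearEquiv.rTensor H (LinearEquiv.ofBijective _ (convShift_bijective hA))).bijective
  have h1 (m : M) : (Conv.map (inl A M) (toConv X.toA) * Conv.map (inr A M) (toConv LinearMap.id) :
      Conv M (A ⊗[ℂ] M)) m = LinearMap.rTensor M X.toA (Coalgebra.comul m) := by
    rw [Conv.mul_apply, ← sw2_self m]
    simp [sw2, map_sw]
  have h2 (x : H) : LinearMap.rTensor M X.toA (X.comulJ x) =
      sw2 x fun x1 x2 => X.idI A (L.psi x1) * inr A M (X.j x2) := by
    rw [CrossedProduct.comulJ, Conv.mul_apply]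
    simp only [sw2, map_sw, Conv.map_apply, rTensor_toA_ii_mul, rTensor_toA_comulPQ]
    rfl
  have h : convShift (toConv X.toA) ∘ₗ (TensorProduct.congr (LinearEquiv.refl ℂ A) X.e).toLinearMap
      ∘ₗ (TensorProduct.assoc ℂ A A H).toLinearMap =
      E.toLinearMap ∘ₗ convShift L.psiC ∘ₗ β := by
    refine TensorProduct.ext <| TensorProduct.ext' fun c a => LinearMap.ext fun x => ?_
    have h3 : convShift (toConv LinearMap.id : Conv A A) (c ⊗ₜ a) =
        inl A A c * Coalgebra.comul a := by
      rw [convShift_tmul', ← sw2_self a]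
      simp [sw2, mul_sw]
    have h4 : X.idI A (inl A A c) = inl A M c := by simp [CrossedProduct.idI]
    simp only [LinearMap.compr₂_apply, TensorProduct.mk_apply, LinearMap.compr₂ₛₗ_apply,
      LinearMap.comp_apply, LinearEquiv.coe_coe, TensorProduct.assoc_tmul,
      TensorProduct.congr_tmul, LinearEquiv.refl_apply, β, LinearMap.rTensor_tmul]
    rw [h3, X.e_tmul, convShift_tmul, h1, X.comul_mul, rTensor_toA_ii_mul, h2, convShift_tmul']
    simp only [sw2, map_sw, mul_sw, hE, map_mul, h4]
    refine sw_congr fun x1 x2 => ?_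
    simp only [mul_assoc]
    rfl
  have hb : Function.Bijective (convShift (toConv X.toA) ∘ E) := by
    have := E.bijective.comp ((convShift_bijective hψ).comp hβ)
    convert this using 1
    exact congrArg DFunLike.coe h
  exact (Function.Bijective.of_comp_iff _ E.bijective).mp hb

/-- In the coproduct of a # x, the projections to A on the left and to H on the right reduce the
coaction and ψ to counits and leave i(a)j(x). This factorization gives the antipode and also the
description of the coinvariants. -/
theorem id_eq_mul : (toConv LinearMap.id : Conv M M) =
    Conv.map X.i (toConv X.toA) * Conv.comap (X.toH : M →ₗc[ℂ] H) X.jC := by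
  set F : M ⊗[ℂ] M →ₗ[ℂ] M := LinearMap.mul' ℂ M ∘ₗ
    TensorProduct.map (X.i.toLinearMap ∘ₗ X.toA) (X.j ∘ₗ X.toHAlg.toLinearMap) with hF
  have hFt (m n : M) : F (m ⊗ₜ n) = X.i (X.toA m) * X.j (X.toHAlg n) := rfl
  have h1 (t : A ⊗[ℂ] A) (s : M ⊗[ℂ] M) : F (X.ii t * s) = X.i (counitSnd A A t) * F s := by
    induction t with
    | zero => simp
    | add t t' ht ht' => simp only [map_add, add_mul, ht, ht']
    | tmul a b =>
      induction s with
      | zero => simp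
      | add s s' hs hs' => simp only [map_add, mul_add, hs, hs']
      | tmul m n =>
        simp [CrossedProduct.ii, hFt, toA_i_mul, toHAlg_i, counitSnd_tmul, mul_assoc]
  have h2 (x : H) : F (X.comulPQ x) = X.j x := by
    rw [CrossedProduct.comulPQ, Conv.mul_apply]
    conv_rhs => rw [← sw2_counit_left x]
    simp only [sw2, map_sw]
    refine sw_congr fun x1 x2 => ?_
    rw [CrossedProduct.comulP, Conv.map_apply, hat_apply, map_smul]
    have h := L.sw_rho_counit_left (LinearMap.toSpanSingleton ℂ M (X.j x2) ∘ₗ eps) x1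
    simp only [LinearMap.comp_apply, LinearMap.toSpanSingleton_apply, eps, Bialgebra.counit_one,
      one_smul] at h
    rw [← h]
    simp only [map_sw, sw_mul]
    refine sw_congr fun y a => ?_
    simp [CrossedProduct.idI, CrossedProduct.comulQ, hFt, toA_j, toHAlg_i, toHAlg_j]
    exact smul_comm _ _ _
  have h3 (x : H) : F (X.comulJ x) = X.j x := by
    rw [CrossedProduct.comulJ, Conv.mul_apply]
    simp only [sw2, map_sw, Conv.map_apply, h1, h2]
    have h4 : Conv.map (X.i.comp (counitSnd A A)) L.psiC = 1 :=
      CrossedProduct.map_psiC_counit_right _ X.i fun a b => by simp [counitSnd_tmul]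
    refine Eq.trans (Conv.mul_apply (Conv.map (X.i.comp (counitSnd A A)) L.psiC) X.jC x).symm ?_
    rw [h4, one_mul, CrossedProduct.jC_apply]
  refine WithConv.ext (X.linearMap_ext fun a x => ?_)
  change X.i a * X.j x = F (Coalgebra.comul (X.i a * X.j x))
  rw [X.comul_mul, h1, h3]
  congr 2
  conv_lhs => rw [← sw2_counit_right a]
  rw [← sw2_self a]
  simp [sw2, map_sw, counitSnd_tmul]

include X in
theorem isUnit_id (hχ : IsUnit L.chiC) (hψ : IsUnit L.psiC)
    (hA : IsUnit (toConv LinearMap.id : Conv A A)) (hH : IsUnit (toConv LinearMap.id : Conv H H)) :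
    IsUnit (toConv LinearMap.id : Conv M M) := by
  rw [X.id_eq_mul]
  exact ((X.isUnit_toA hψ hA).map _).mul ((X.isUnit_jC hχ hH).map _)

end BismashPresentation

/-- A bialgebra whose identity is convolution invertible is a Hopf algebra. -/
noncomputable abbrev hopfAlgebraOfIsUnit {M : Type w} [Ring M] [Bialgebra ℂ M]
    (h : IsUnit (toConv LinearMap.id : Conv M M)) : HopfAlgebra ℂ M :=
  { antipode := (↑h.unit⁻¹ : Conv M M).ofConv
    mul_antipode_rTensor_comul := congrArg ofConv h.val_inv_mul
    mul_antipode_lTensor_comul := congrArg ofConv h.mul_val_inv }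

theorem isUnit_id_of_hopfAlgebra (B : Type*) [Ring B] [HopfAlgebra ℂ B] :
    IsUnit (toConv LinearMap.id : Conv B B) :=
  isUnit_iff_exists.mpr ⟨_, LinearMap.id_mul_antipode, LinearMap.antipode_mul_id⟩

end CocycleLinkedPair

/-! ### Comparison with the explicit bismash product formulas. -/

namespace CocycleLinkedPair

open WithConv

namespace CrossedProduct

variable {A : Type u} {H : Type v} [Ring A] [Bialgebra ℂ A] [Ring H] [Bialgebra ℂ H]
  {L : CocycleLinkedPair A H} {M : Type w} [Ring M] [Algebra ℂ M] (X : L.CrossedProduct M)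

theorem comulP_apply (x : H) :
    X.comulP x = sw (L.rho x) fun xH xA => X.j xH ⊗ₜ[ℂ] X.i xA := by
  rw [comulP, Conv.map_apply, hat_apply, map_sw]
  rfl

theorem comulPQ_apply (x : H) : X.comulPQ x = sw2 x fun x1 x2 => sw (L.rho x1) fun xH xA =>
    X.j xH ⊗ₜ[ℂ] (X.i xA * X.j x2) := by
  rw [comulPQ, Conv.mul_apply]
  refine sw_congr fun x1 x2 => ?_
  rw [comulP_apply, sw_mul]
  refine sw_congr fun y a => ?_
  simp [comulQ]

theorem comulJ_apply (x : H) : X.comulJ x = sw2 x fun x1 x2 => X.ii (L.psi x1) * X.comulPQ x2 := by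
  rw [comulJ, Conv.mul_apply]
  rfl

end CrossedProduct

namespace BismashPresentation

variable {A : Type u} {H : Type v} [Ring A] [HopfAlgebra ℂ A] [Ring H] [HopfAlgebra ℂ H]
  {L : CocycleLinkedPair A H} {M : Type w} [Ring M] [HopfAlgebra ℂ M]
  (X : L.BismashPresentation M)

/-- A presented Hopf algebra is the cocycle bismash product. -/
noncomputable def bismashProduct : L.BismashProduct M where
  e := X.e
  one_eq := by rw [X.e_tmul, map_one, X.j_one, one_mul]
  mul_eq a x b y := by
    rw [X.e_tmul, X.e_tmul, mul_assoc, ← mul_assoc (X.j x), X.j_mul_i_apply]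
    simp only [sw3, sw2, sw_mul, mul_sw]
    refine sw_congr fun x1 x' => ?_
    rw [mul_assoc, X.j_mul_j_apply]
    simp only [sw3, sw2, sw_mul, mul_sw]
    refine sw_congr fun x2 x3 => ?_
    refine sw_congr fun y1 y2 => ?_
    simp only [X.e_tmul, map_mul, mul_assoc]
  counit_eq a x := by rw [X.e_tmul, X.counit_mul]
  comul_eq a x := by
    rw [X.e_tmul, X.comul_mul, X.comulJ_apply, ← sw2_self a]
    simp only [sw3, sw2, map_sw, sw_mul, mul_sw]
    rw [sw_comm]
    refine sw_congr fun a1 a2 => ?_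
    refine sw_congr fun x1 x' => ?_
    rw [X.comulPQ_apply, ← sw_self (L.psi x1)]
    simp only [sw3, sw2, map_sw, sw_mul, mul_sw]
    refine sw_congr fun x2 x3 => ?_
    rw [sw_comm]
    rw [sw_self (L.psi x1)]
    refine sw_congr fun b1 b2 => ?_
    refine sw_congr fun y c => ?_
    simp [CrossedProduct.ii, X.e_tmul, mul_assoc]

end BismashPresentation
end CocycleLinkedPair

/-! ### Contractions ∑ G(x₁)(x₂) and conjugation by the involutions. -/

section Contract

open WithConv

variable {C D R S X : Type*} [AddCommGroup C] [Module ℂ C] [Coalgebra ℂ C]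
  [AddCommGroup D] [Module ℂ D] [Coalgebra ℂ D] [Ring R] [Algebra ℂ R] [Ring S] [Algebra ℂ S]

/-- Evaluation of convolution elements as a bilinear map. -/
noncomputable def Conv.eval (C R : Type*) [AddCommGroup C] [Module ℂ C] [Ring R] [Algebra ℂ R] :
    Conv C R →ₗ[ℂ] C →ₗ[ℂ] R :=
  (WithConv.linearEquiv ℂ (C →ₗ[ℂ] R)).toLinearMap

theorem Conv.eval_apply (f : Conv C R) (x : C) : Conv.eval C R f x = f x := rfl

/-- The map `x ↦ ∑ G(x₁)(x₂)`. -/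
noncomputable def Conv.contract (G : C →ₗ[ℂ] Conv C R) : Conv C R :=
  toConv (TensorProduct.lift (Conv.eval C R ∘ₗ G) ∘ₗ Coalgebra.comul)

theorem Conv.contract_apply (G : C →ₗ[ℂ] Conv C R) (x : C) :
    Conv.contract G x = sw2 x fun x1 x2 => G x1 x2 :=
  (sw2_tmul_apply (TensorProduct.lift (Conv.eval C R ∘ₗ G)) x).symm

theorem Conv.map_contract (φ : R →ₐ[ℂ] S) (G : C →ₗ[ℂ] Conv C R) :
    Conv.map φ (Conv.contract G) = Conv.contract ((Conv.map φ).toLinearMap ∘ₗ G) :=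
  Conv.ext' fun x => by
    rw [Conv.map_apply, Conv.contract_apply, Conv.contract_apply, sw2, map_sw]
    rfl

/-- By coassociativity a trailing convolution factor can be absorbed into the contracted family. -/
theorem Conv.contract_mul (G : C →ₗ[ℂ] Conv C R) (g : Conv C R) :
    Conv.contract (LinearMap.mulRight ℂ g ∘ₗ G) = Conv.contract G * g :=
  Conv.ext' fun x => by
    let B : C ⊗[ℂ] (C ⊗[ℂ] C) →ₗ[ℂ] R := LinearMap.mul' ℂ R ∘ₗ
      TensorProduct.map (TensorProduct.lift (Conv.eval C R ∘ₗ G)) g.ofConv ∘ₗ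
      (TensorProduct.assoc ℂ C C C).symm.toLinearMap
    have h := congrArg B (Coalgebra.coassoc_apply (R := ℂ) x)
    rw [← sw2_self x] at h
    simp only [sw2, map_sw, LinearMap.rTensor_tmul, LinearMap.lTensor_tmul] at h
    rw [Conv.mul_apply, Conv.contract_apply]
    simp only [sw2] at h ⊢
    refine Eq.trans ?_ (h.symm.trans ?_)
    · refine sw_congr fun x1 x' => ?_
      rw [LinearMap.comp_apply, LinearMap.mulRight_apply, Conv.mul_apply, ← sw2_self x']
      simp only [sw2, map_sw, tmul_sw]
      rfl
    · refine sw_congr fun x1 x' => ?_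
      simp [B]
      rfl

/-- The contraction of `x ↦ ∑ Ω(x₁ ⊗ x₂)`. -/
theorem Conv.contract_comp_comul (Ω : C ⊗[ℂ] C →ₗ[ℂ] Conv C R) (x : C) :
    Conv.contract (Ω ∘ₗ Coalgebra.comul) x =
      sw2 x fun x1 x2 => Conv.contract (Ω ∘ₗ TensorProduct.mk ℂ C C x1) x2 := by
  let B : (C ⊗[ℂ] C) ⊗[ℂ] C →ₗ[ℂ] R := TensorProduct.lift (Conv.eval C R ∘ₗ Ω)
  have h := congrArg (B ∘ₗ (TensorProduct.assoc ℂ C C C).symm.toLinearMap)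
    (Coalgebra.coassoc_apply (R := ℂ) x)
  rw [← sw2_self x] at h
  simp only [sw2, map_sw, LinearMap.rTensor_tmul, LinearMap.lTensor_tmul] at h
  rw [Conv.contract_apply]
  simp only [sw2]
  refine Eq.trans ?_ (h.trans ?_)
  · refine sw_congr fun x1 x' => ?_
    simp [B]
    rfl
  · refine sw_congr fun x1 x' => ?_
    rw [← sw2_self x', Conv.contract_apply]
    simp only [sw2, map_sw, tmul_sw]
    rfl

section Star

variable {V W : Type*} [AddCommGroup V] [Module ℂ V] [StarAddMonoid V] [StarModule ℂ V]
  [AddCommGroup W] [Module ℂ W] [StarAddMonoid W] [StarModule ℂ W]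

theorem star_sw {V W : Type*} [AddCommGroup V] [Module ℂ V] [AddCommGroup W] [Module ℂ W]
    [AddCommMonoid X] [StarAddMonoid X] (t : V ⊗[ℂ] W) (F : V → W → X) :
    star (sw t F) = sw t fun v w => star (F v w) :=
  map_sw (starAddEquiv : X ≃+ X) t F

/-- The chosen decomposition of `star t` need not be the conjugate of that of `t`, so biadditivity
and balancedness of `F` are what permits the comparison. -/
theorem sw_star [AddCommGroup X] {F : V → W → X} (h1 : ∀ v v' w, F (v + v') w = F v w + F v' w)
    (h2 : ∀ v w w', F v (w + w') = F v w + F v w') (h3 : ∀ (c : ℂ) v w, F (c • v) w = F v (c • w))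
    (t : V ⊗[ℂ] W) : sw (star t) F = sw t fun v w => F (star v) (star w) := by
  let f : V →+ W →+ X := AddMonoidHom.mk' (fun v => AddMonoidHom.mk' (F v) (h2 v))
    fun v v' => AddMonoidHom.ext fun w => h1 v v' w
  refine (sw_eq_liftAddHom f h3 (star t)).trans ?_
  conv_lhs => rw [← sw_self t, star_sw, map_sw]
  rfl

variable [StarAddMonoid C] [StarModule ℂ C]

theorem sw2_star (hC : ∀ x : C, Coalgebra.comul (R := ℂ) (star x) = star (Coalgebra.comul (R := ℂ) x))
    [AddCommGroup X] {F : C → C → X} (h1 : ∀ v v' w, F (v + v') w = F v w + F v' w)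
    (h2 : ∀ v w w', F v (w + w') = F v w + F v w') (h3 : ∀ (c : ℂ) v w, F (c • v) w = F v (c • w))
    (x : C) : sw2 (star x) F = sw2 x fun x1 x2 => F (star x1) (star x2) := by
  rw [sw2, hC]
  exact sw_star h1 h2 h3 _

theorem Conv.contract_star
    (hC : ∀ x : C, Coalgebra.comul (R := ℂ) (star x) = star (Coalgebra.comul (R := ℂ) x))
    (G : C →ₗ[ℂ] Conv C R) (x : C) :
    Conv.contract G (star x) = sw2 x fun x1 x2 => G (star x1) (star x2) := by
  rw [Conv.contract_apply]
  exact sw2_star hC (by simp) (by simp) (by simp) x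

theorem Conv.mul_apply_star
    (hC : ∀ x : C, Coalgebra.comul (R := ℂ) (star x) = star (Coalgebra.comul (R := ℂ) x))
    (f g : Conv C R) (x : C) :
    (f * g) (star x) = sw2 x fun x1 x2 => f (star x1) * g (star x2) := by
  rw [Conv.mul_apply]
  exact sw2_star hC (by simp [add_mul]) (by simp [mul_add]) (by simp) x

/-- The conjugate x ↦ conj ε(x*) is again a counit, and counits are unique: the same mixed sum,
evaluated by either of the two, gives both sides. -/
theorem counit_star_of_comul_star
    (hC : ∀ x : C, Coalgebra.comul (R := ℂ) (star x) = star (Coalgebra.comul (R := ℂ) x)) (x : C) :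
    eps (star x) = conj (eps x) := by
  have h1 : (sw2 (star x) fun a b => conj (eps (star a)) * eps b) = conj (eps x) := by
    have h := congrArg (fun y : C => conj (eps (star y))) (sw2_counit_right (star x))
    simp only [sw2, star_sw, map_sw, star_smul, map_smul, star_star, smul_eq_mul, map_mul,
      RCLike.star_def, Complex.conj_conj] at h
    rw [← h]
    exact sw_congr fun a b => mul_comm _ _
  have h2 : (sw2 (star x) fun a b => conj (eps (star a)) * eps b) = eps (star x) := by
    rw [sw2_star hC (by simp [add_mul]) (by simp [mul_add]) (by simp; intros; ring)]
    have h := congrArg (fun y : C => eps (star y)) (sw2_counit_left x)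
    simp only [sw2, star_sw, map_sw, star_smul, map_smul, smul_eq_mul, RCLike.star_def] at h
    rw [← h]
    exact sw_congr fun a b => by rw [star_star]
  rw [← h1, h2]

end Star

end Contract

open WithConv in
-- The involution is bijective. Testing on x* is what matches linear convolution identities with the
-- conditions, which are written with starred arguments.
theorem Conv.ext_star {C R : Type*} [AddCommGroup C] [Module ℂ C] [Coalgebra ℂ C]
    [Ring R] [Algebra ℂ R] [InvolutiveStar C] {f g : Conv C R} : f = g ↔ ∀ x, f (star x) = g (star x) :=
  ⟨fun h x => by rw [h], fun h => Conv.ext' fun x => by simpa using h (star x)⟩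

section

variable {C D X : Type*} [AddCommGroup C] [Module ℂ C] [Coalgebra ℂ C] [StarAddMonoid C]
  [StarModule ℂ C] [AddCommGroup D] [Module ℂ D] [Coalgebra ℂ D] [StarAddMonoid D]
  [StarModule ℂ D] [AddCommGroup X] [Module ℂ X]

theorem sw2_tmul_star
    (hC : ∀ x : C, Coalgebra.comul (R := ℂ) (star x) = star (Coalgebra.comul (R := ℂ) x))
    (hD : ∀ x : D, Coalgebra.comul (R := ℂ) (star x) = star (Coalgebra.comul (R := ℂ) x))
    (g : (C ⊗[ℂ] D) ⊗[ℂ] (C ⊗[ℂ] D) →ₗ[ℂ] X) (y : C) (x : D) :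
    (sw2 (star y ⊗ₜ[ℂ] star x) fun p q => g (p ⊗ₜ q)) = sw2 x fun x1 x2 => sw2 y fun y1 y2 =>
      g ((star y1 ⊗ₜ star x1) ⊗ₜ (star y2 ⊗ₜ star x2)) := by
  have h (v1 v2 : C) := sw2_star hD (F := fun u1 u2 => g ((v1 ⊗ₜ u1) ⊗ₜ (v2 ⊗ₜ u2)))
    (by simp [TensorProduct.add_tmul, TensorProduct.tmul_add])
    (by simp [TensorProduct.add_tmul, TensorProduct.tmul_add])
    (by simp [← TensorProduct.smul_tmul']) x
  rw [sw2_tmul]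
  simp only [h]
  simp only [sw2]
  rw [sw_comm]
  refine sw_congr fun x1 x2 => ?_
  exact sw2_star hC (F := fun v1 v2 => g ((v1 ⊗ₜ star x1) ⊗ₜ (v2 ⊗ₜ star x2)))
    (by simp [TensorProduct.add_tmul, TensorProduct.tmul_add])
    (by simp [TensorProduct.add_tmul, TensorProduct.tmul_add])
    (by simp [← TensorProduct.smul_tmul']) y

end

/-! ### Conditions (cero), (uno) and (dos) as convolution identities. -/

namespace CocycleLinkedPair

open WithConv

variable {A : Type u} {H : Type v} [Ring A] [HopfAlgebra ℂ A] [StarRing A] [IsStarBialgebra A]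
  [Ring H] [HopfAlgebra ℂ H] [StarRing H] [IsStarBialgebra H]
  (L : CocycleLinkedPair A H) (γ : H →ₗ[ℂ] A)

/-- The map `b ↦ (x ↦ ∑ γ(x₁) (x₂ ▸ b))`. -/
noncomputable def twistedAct : A →ₗ[ℂ] Conv H A := LinearMap.mulLeft ℂ (toConv γ) ∘ₗ L.actBy

theorem twistedAct_eq (b : A) : L.twistedAct γ b = toConv γ * L.actBy b := rfl

theorem twistedAct_mul (a b : A) :
    L.twistedAct γ (a * b) = L.twistedAct γ a * L.actBy b := by
  rw [twistedAct_eq, twistedAct_eq, actBy_mul, mul_assoc]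

theorem twistedAct_star (b : A) (x : H) : L.twistedAct γ b (star x) =
    sw2 x fun x1 x2 => γ (star x1) * L.act (star x2) b :=
  Conv.mul_apply_star IsStarBialgebra.comul_star _ _ x

/-- The term γ(x₁)* is conjugate linear in x₁, but it is the value at x₁* of the linear map x ↦
γ(x*)*, the convolution `star` of γ. Hence both sides are values at x* of linear maps; the other
conditions are treated in the same way. -/
theorem cero_iff : (∀ x, (sw3 x fun x1 x2 x3 => γ (star x2) * L.act (star x3) (star (γ x1))) =
      eps (star x) • (1 : A)) ↔
    Conv.contract (L.twistedAct γ ∘ₗ (star (toConv γ)).ofConv) = 1 := by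
  rw [Conv.ext_star]
  refine forall_congr' fun x => ?_
  rw [Conv.one_apply, Conv.contract_star IsStarBialgebra.comul_star]
  refine Eq.congr_left ?_
  simp only [sw3, sw2]
  refine sw_congr fun x1 x' => ?_
  refine (L.twistedAct_star γ _ x').symm.trans ?_
  change _ = L.twistedAct γ (star (γ (star (star x1)))) _
  rw [star_star x1]

/-- The conjugate `x ↦ (x* ▸ b*)*` of the action on `b`. -/
noncomputable def actStar (b : A) : Conv H A := star (L.actBy (star b))

theorem uno_iff : (∀ x a, (sw3 x fun x1 x2 x3 =>
      γ (star x2) * L.act (star x3) (star (L.act x1 a))) = star a * γ (star x)) ↔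
    ∀ b, Conv.contract (L.twistedAct γ ∘ₗ (L.actStar b).ofConv) = Conv.const H b * toConv γ := by
  have h (b : A) : Conv.contract (L.twistedAct γ ∘ₗ (L.actStar b).ofConv) =
      Conv.const H b * toConv γ ↔ ∀ x, (sw3 x fun x1 x2 x3 =>
      γ (star x2) * L.act (star x3) (star (L.act x1 (star b)))) = b * γ (star x) := by
    rw [Conv.ext_star]
    refine forall_congr' fun x => ?_
    rw [Conv.const_mul_apply, Conv.contract_star IsStarBialgebra.comul_star]
    refine Eq.congr_left ?_
    simp only [sw3, sw2]
    refine sw_congr fun x1 x' => ?_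
    refine Eq.trans ?_ (L.twistedAct_star γ _ x')
    change L.twistedAct γ (star (L.act (star (star x1)) (star b))) _ = _
    rw [star_star x1]
  simp only [h]
  refine ⟨fun k b x => ?_, fun k x a => ?_⟩
  · simpa using k x (star b)
  · simpa using k (star a) x

/-- The map `y ⊗ x ↦ ∑ γ(y₁) (y₂ ▸ γ(x))`. -/
noncomputable def twistedActGamma : Conv (H ⊗[ℂ] H) A := Conv.uncurry (L.twistedAct γ ∘ₗ γ)

theorem twistedActGamma_eq : L.twistedActGamma γ =
    Conv.comap (tensorFst H H) (toConv γ) * L.actOn γ :=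
  Conv.ext_slice fun y => by
    rw [Conv.slice_comap_fst_mul, slice_actOn]
    rfl

/-- The map `y ⊗ x ↦ ((q ⊗ p) ↦ ∑ γ(q₁p₁) (q₂p₂ ▸ χ(x*, y*)*))`. -/
noncomputable def twistedChi : H ⊗[ℂ] H →ₗ[ℂ] Conv (H ⊗[ℂ] H) A :=
  (Conv.comap (mulH H)).toLinearMap ∘ₗ L.twistedAct γ ∘ₗ (star L.chiC).ofConv ∘ₗ
    (TensorProduct.comm ℂ H H).toLinearMap

theorem twistedChi_tmul (y x : H) : L.twistedChi γ (y ⊗ₜ x) = Conv.comap (mulH H) (toConv γ) *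
    Conv.comap (mulH H) (L.actBy (star (L.chi (star x ⊗ₜ star y)))) := by
  rw [← map_mul]
  rfl

/-- The star reverses products, so the identity for the pair x, y is tested on y* ⊗ x*. -/
theorem dos_iff : (∀ x y, (sw2 x fun x1 x2 => sw3 y fun y1 y2 y3 =>
      γ (star y1) * L.act (star y2) (γ (star x1)) * L.chi (star y3 ⊗ₜ star x2)) =
      sw3 x fun x1 x2 x3 => sw3 y fun y1 y2 y3 =>
        γ (star y2 * star x2) * L.act (star y3 * star x3) (star (L.chi (x1 ⊗ₜ y1)))) ↔
    L.twistedActGamma γ * L.chiC = Conv.contract (L.twistedChi γ) := by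
  have h1 (x y : H) : (L.twistedActGamma γ * L.chiC) (star y ⊗ₜ star x) =
      sw2 x fun x1 x2 => sw3 y fun y1 y2 y3 =>
      γ (star y1) * L.act (star y2) (γ (star x1)) * L.chi (star y3 ⊗ₜ star x2) := by
    rw [twistedActGamma_eq, mul_assoc, Conv.comap_fst_mul_tmul,
      sw2_star IsStarBialgebra.comul_star (by simp [add_mul])
        (by simp [TensorProduct.add_tmul, mul_add]) (by simp [← TensorProduct.smul_tmul'])]
    simp only [sw3, sw2]
    conv_rhs => rw [sw_comm]
    refine sw_congr fun y1 y' => ?_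
    rw [Conv.mul_apply]
    refine (congrArg _ (sw2_tmul_star IsStarBialgebra.comul_star IsStarBialgebra.comul_star
      (LinearMap.mul' ℂ A ∘ₗ TensorProduct.map (L.actOn γ).ofConv L.chiC.ofConv) y' x)).trans ?_
    simp only [sw2, mul_sw, mul_assoc]
    rfl
  have h2 (x y : H) : Conv.contract (L.twistedChi γ) (star y ⊗ₜ star x) =
      sw3 x fun x1 x2 x3 => sw3 y fun y1 y2 y3 =>
        γ (star y2 * star x2) * L.act (star y3 * star x3) (star (L.chi (x1 ⊗ₜ y1))) := by
    rw [Conv.contract_apply]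
    refine (sw2_tmul_star IsStarBialgebra.comul_star IsStarBialgebra.comul_star
      (TensorProduct.lift (Conv.eval _ _ ∘ₗ L.twistedChi γ)) y x).trans ?_
    simp only [sw3, sw2]
    refine sw_congr fun x1 x' => ?_
    conv_rhs => rw [sw_comm]
    refine sw_congr fun y1 y' => ?_
    rw [TensorProduct.lift.tmul, LinearMap.comp_apply, Conv.eval_apply, twistedChi_tmul, star_star,
      star_star, Conv.mul_apply]
    exact sw2_tmul_star IsStarBialgebra.comul_star IsStarBialgebra.comul_star
      (LinearMap.mul' ℂ A ∘ₗ TensorProduct.map (Conv.comap (mulH H) (toConv γ)).ofConv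
      (Conv.comap (mulH H) (L.actBy (star (L.chi (x1 ⊗ₜ y1))))).ofConv) y' x'
  simp only [← h1, ← h2]
  refine ⟨fun k => Conv.ext_tmul fun y x => ?_, fun k x y => by rw [k]⟩
  simpa using k (star x) (star y)

end CocycleLinkedPair

/-! ### Post-composition and linearity of contractions. -/

section

open WithConv

variable {C R S : Type*} [AddCommGroup C] [Module ℂ C] [Coalgebra ℂ C] [Ring R] [Algebra ℂ R]
  [Ring S] [Algebra ℂ S]

/-- Composition with a linear map. -/
noncomputable def Conv.postcomp (f : R →ₗ[ℂ] S) : Conv C R →ₗ[ℂ] Conv C S where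
  toFun g := toConv (f ∘ₗ g.ofConv)
  map_add' g h := Conv.ext' fun x => by simp
  map_smul' c g := Conv.ext' fun x => by simp

@[simp] theorem Conv.postcomp_apply (f : R →ₗ[ℂ] S) (g : Conv C R) (x : C) :
    Conv.postcomp f g x = f (g x) := rfl

theorem Conv.postcomp_contract (f : R →ₗ[ℂ] S) (G : C →ₗ[ℂ] Conv C R) :
    Conv.postcomp f (Conv.contract G) = Conv.contract (Conv.postcomp f ∘ₗ G) :=
  Conv.ext' fun x => by
    rw [Conv.postcomp_apply, Conv.contract_apply, Conv.contract_apply, sw2, map_sw]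
    rfl

theorem Conv.contract_add (G G' : C →ₗ[ℂ] Conv C R) :
    Conv.contract (G + G') = Conv.contract G + Conv.contract G' :=
  Conv.ext' fun x =>
    have h (t : C ⊗[ℂ] C) : TensorProduct.lift (Conv.eval C R ∘ₗ (G + G')) t =
        TensorProduct.lift (Conv.eval C R ∘ₗ G) t + TensorProduct.lift (Conv.eval C R ∘ₗ G') t := by
      induction t with
      | zero => simp
      | add s t hs ht => simp only [map_add, hs, ht]; abel
      | tmul a b => simp
    h (Coalgebra.comul x)

theorem Conv.contract_smul (c : ℂ) (G : C →ₗ[ℂ] Conv C R) :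
    Conv.contract (c • G) = c • Conv.contract G :=
  Conv.ext' fun x =>
    have h (t : C ⊗[ℂ] C) : TensorProduct.lift (Conv.eval C R ∘ₗ (c • G)) t =
        c • TensorProduct.lift (Conv.eval C R ∘ₗ G) t := by
      induction t with
      | zero => simp
      | add s t hs ht => simp only [map_add, hs, ht, smul_add]
      | tmul a b => simp
    h (Coalgebra.comul x)

end

/-! ### Conditions (tres) and (cuatro) as convolution identities. -/

namespace CocycleLinkedPair

open WithConv

variable {A : Type u} {H : Type v} [Ring A] [HopfAlgebra ℂ A] [StarRing A] [IsStarBialgebra A]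
  [Ring H] [HopfAlgebra ℂ H] [StarRing H] [IsStarBialgebra H]
  (L : CocycleLinkedPair A H) (γ : H →ₗ[ℂ] A)

/-- The conjugate `x ↦ ρ(x*)*` of the coaction. -/
noncomputable def rhoStar : H →ₗ[ℂ] H ⊗[ℂ] A := (star (toConv L.rho)).ofConv

theorem rhoStar_star (x : H) : L.rhoStar (star x) =
    sw (L.rho x) fun h a => star h ⊗ₜ[ℂ] star a := by
  change star (L.rho (star (star x))) = _
  rw [star_star, ← sw_self (L.rho x), star_sw, sw_self]
  rfl

/-- The map `c ⊗ a ↦ (x ↦ ∑ c ⊗ γ(x₁) (x₂ ▸ a b))`. -/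
noncomputable def legTwist (R : Type*) [Ring R] [Algebra ℂ R] (b : A) :
    R ⊗[ℂ] A →ₗ[ℂ] Conv H (R ⊗[ℂ] A) :=
  LinearMap.mul' ℂ _ ∘ₗ TensorProduct.map (Conv.const H ∘ₗ (inl R A).toLinearMap)
    ((Conv.map (inr R A)).toLinearMap ∘ₗ L.twistedAct γ ∘ₗ LinearMap.mulRight ℂ b)

theorem legTwist_tmul {R : Type*} [Ring R] [Algebra ℂ R] (b : A) (r : R) (a : A) :
    L.legTwist γ R b (r ⊗ₜ a) =
      Conv.const H (inl R A r) * Conv.map (inr R A) (L.twistedAct γ (a * b)) := rfl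

theorem legTwist_tmul_apply {R : Type*} [Ring R] [Algebra ℂ R] (b : A) (r : R) (a : A) (x : H) :
    L.legTwist γ R b (r ⊗ₜ a) x = r ⊗ₜ L.twistedAct γ (a * b) x := by
  rw [legTwist_tmul, Conv.const_mul_apply]
  simp

/-- The map `x ↦ ∑ (x₁*_H)* ⊗ γ(x₂) (x₃ ▸ (x₁*_A)*)`. -/
noncomputable def rhoTwist : Conv H (H ⊗[ℂ] A) := Conv.contract (L.legTwist γ H 1 ∘ₗ L.rhoStar)

theorem tres_iff : (∀ x,
    (sw2 x fun x1 x2 => sw (L.rho (star x2)) fun zH zA => zH ⊗ₜ[ℂ] (γ (star x1) * zA)) =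
      sw3 x fun x1 x2 x3 => sw (L.rho x1) fun x1H x1A =>
        star x1H ⊗ₜ[ℂ] (γ (star x2) * L.act (star x3) (star x1A))) ↔
    Conv.map (inr H A) (toConv γ) * L.hat (toConv LinearMap.id) = L.rhoTwist γ := by
  rw [Conv.ext_star]
  refine forall_congr' fun x => ?_
  have h1 : (Conv.map (inr H A) (toConv γ) * L.hat (toConv LinearMap.id)) (star x) =
      sw2 x fun x1 x2 => sw (L.rho (star x2)) fun zH zA => zH ⊗ₜ[ℂ] (γ (star x1) * zA) := by
    rw [Conv.mul_apply_star IsStarBialgebra.comul_star]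
    simp [hat_apply, mul_sw]
  have h2 : L.rhoTwist γ (star x) = sw3 x fun x1 x2 x3 => sw (L.rho x1) fun x1H x1A =>
        star x1H ⊗ₜ[ℂ] (γ (star x2) * L.act (star x3) (star x1A)) := by
    rw [rhoTwist, Conv.contract_star IsStarBialgebra.comul_star]
    simp only [sw3, sw2]
    refine sw_congr fun x1 x' => ?_
    rw [sw_comm]
    rw [LinearMap.comp_apply, rhoStar_star, map_sw, Conv.sw_apply]
    refine sw_congr fun h a => ?_
    rw [legTwist_tmul_apply, mul_one, twistedAct_star, sw2, tmul_sw]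
  rw [h1, h2]

/-- The map `(x ⊗ y) ↦ ∑ x_H ⊗ y_H ⊗ y_A x_A` for the conjugate coaction. -/
noncomputable def rhoStarMul : H ⊗[ℂ] H →ₗ[ℂ] (H ⊗[ℂ] H) ⊗[ℂ] A :=
  LinearMap.mul' ℂ _ ∘ₗ TensorProduct.map
    ((Algebra.TensorProduct.map (inr H H) (AlgHom.id ℂ A)).toLinearMap ∘ₗ L.rhoStar)
    ((Algebra.TensorProduct.map (inl H H) (AlgHom.id ℂ A)).toLinearMap ∘ₗ L.rhoStar) ∘ₗ
    (TensorProduct.comm ℂ H H).toLinearMap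

theorem rhoStarMul_star (x y : H) : L.rhoStarMul (star x ⊗ₜ star y) =
    sw (L.rho x) fun xH xA => sw (L.rho y) fun yH yA =>
      (star xH ⊗ₜ[ℂ] star yH) ⊗ₜ[ℂ] (star yA * star xA) := by
  simp only [rhoStarMul, LinearMap.comp_apply, LinearEquiv.coe_coe, TensorProduct.comm_tmul,
    TensorProduct.map_tmul, LinearMap.mul'_apply, rhoStar_star, map_sw, sw_mul, mul_sw]
  refine sw_congr fun a b => ?_
  refine sw_congr fun c d => ?_
  simp

/-- This is the conjugate of `rho_comul`; the A-legs appear in reversed order because the star is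
antimultiplicative. -/
theorem rTensor_comul_rhoStar (y : H) :
    LinearMap.rTensor A Coalgebra.comul (L.rhoStar y) = L.rhoStarMul (Coalgebra.comul y) := by
  obtain ⟨x, rfl⟩ : ∃ x, star x = y := ⟨star y, star_star y⟩
  have h := congrArg star (L.rho_comul x)
  simp only [sw2, star_sw, TensorProduct.star_tmul, star_mul] at h
  rw [rhoStar_star, map_sw, IsStarBialgebra.comul_star, ← sw2_self x]
  simp only [sw2, star_sw, map_sw, TensorProduct.star_tmul, rhoStarMul_star]
  rw [← h]
  refine sw_congr fun h a => ?_
  rw [LinearMap.rTensor_tmul, IsStarBialgebra.comul_star, ← sw_self (Coalgebra.comul (R := ℂ) h)]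
  simp only [sw2, star_sw, sw_tmul, TensorProduct.star_tmul]
  rw [sw_self]

/-- The conjugate `x ↦ ψ(x*)*` of `ψ`. -/
noncomputable def psiStar : H →ₗ[ℂ] A ⊗[ℂ] A := (star L.psiC).ofConv

theorem psiStar_star (x : H) : L.psiStar (star x) =
    sw (L.psi x) fun b c => star b ⊗ₜ[ℂ] star c := by
  change star (L.psi (star (star x))) = _
  rw [star_star, ← sw_self (L.psi x), star_sw, sw_self]
  rfl

/-- The map `b ⊗ c ↦ (x ↦ ∑ γ(x_{1H}) (x_{2H} ▸ b) ⊗ …)` in the conjugate of (cuatro). -/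
noncomputable def tensorTwist : A ⊗[ℂ] A →ₗ[ℂ] Conv H (A ⊗[ℂ] A) :=
  LinearMap.mul' ℂ _ ∘ₗ TensorProduct.map
    { toFun := fun b => Conv.postcomp (LinearMap.rTensor A (L.twistedAct γ b).ofConv) (L.rhoTwist γ)
      map_add' := fun b c => Conv.ext' fun x => by simp [LinearMap.rTensor_add]
      map_smul' := fun r b => Conv.ext' fun x => by simp [LinearMap.rTensor_smul] }
    ((Conv.map (inr A A)).toLinearMap ∘ₗ L.actBy)

theorem tensorTwist_tmul (b c : A) : L.tensorTwist γ (b ⊗ₜ c) =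
    Conv.postcomp (LinearMap.rTensor A (L.twistedAct γ b).ofConv) (L.rhoTwist γ) *
      Conv.map (inr A A) (L.actBy c) := rfl

/-- `tensorTwist` is built on `rhoTwist` so that (tres) can be substituted into it. Splitting the
H-leg of the conjugate coaction recovers from it the nested sum that occurs in (cuatro). -/
theorem tensorTwist_tmul_star (b c : A) (x : H) : L.tensorTwist γ (b ⊗ₜ c) (star x) =
    sw4 x fun x1 x2 x3 x4 => sw (L.rho x1) fun x1H x1A => sw (L.rho x2) fun x2H x2A =>
      (γ (star x1H) * L.act (star x2H) b) ⊗ₜ[ℂ]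
        (γ (star x3) * L.act (star x4) (star x2A * star x1A * c)) := by
  let m : H ⊗[ℂ] H →ₗ[ℂ] A := LinearMap.mul' ℂ A ∘ₗ TensorProduct.map γ (L.actBy b).ofConv
  have hm : (L.twistedAct γ b).ofConv = m ∘ₗ Coalgebra.comul := rfl
  have h : L.tensorTwist γ (b ⊗ₜ c) = Conv.contract
      ((L.legTwist γ A c ∘ₗ LinearMap.rTensor A m ∘ₗ L.rhoStarMul) ∘ₗ Coalgebra.comul) := by
    rw [tensorTwist_tmul, rhoTwist, Conv.postcomp_contract, ← Conv.contract_mul]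
    congr 1
    refine LinearMap.ext fun y => ?_
    simp only [LinearMap.comp_apply, ← rTensor_comul_rhoStar]
    induction L.rhoStar y with
    | zero => simp
    | add s t hs ht => simp only [map_add, hs, ht]
    | tmul h a =>
      have h3 : Conv.postcomp (LinearMap.rTensor A (L.twistedAct γ b).ofConv)
          (L.legTwist γ H 1 (h ⊗ₜ a)) = Conv.const H (inl A A (L.twistedAct γ b h)) *
            Conv.map (inr A A) (L.twistedAct γ a) := Conv.ext' fun z => by
        rw [Conv.postcomp_apply, legTwist_tmul_apply, Conv.const_mul_apply]
        simp
      rw [LinearMap.mulRight_apply, h3, mul_assoc, ← map_mul, ← twistedAct_mul,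
        LinearMap.rTensor_tmul, LinearMap.rTensor_tmul, legTwist_tmul]
      rfl
  rw [h, Conv.contract_comp_comul, sw2_star IsStarBialgebra.comul_star 
    (fun v w z => by simp only [map_add, LinearMap.comp_add, Conv.contract_add]; rfl) (by simp)
    (fun r v z => by simp only [map_smul, LinearMap.comp_smul, Conv.contract_smul]; rfl)]
  simp only [sw4, sw3]
  refine sw_congr fun x1 x' => ?_
  rw [Conv.contract_star IsStarBialgebra.comul_star]
  refine sw_congr fun x2 x'' => ?_
  simp only [LinearMap.comp_apply, TensorProduct.mk_apply, rhoStarMul_star, map_sw, Conv.sw_apply,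
    LinearMap.rTensor_tmul, legTwist_tmul_apply, twistedAct_star]
  simp only [sw2, tmul_sw]
  simp only [sw_comm _ (Coalgebra.comul x'')]
  rfl

theorem cuatro_iff : (∀ x,
    (sw2 x fun x1 x2 => sw2 (γ (star x1)) fun g1 g2 => sw (L.psi (star x2)) fun zI zII =>
      (g1 * zI) ⊗ₜ[ℂ] (g2 * zII)) =
      sw5 x fun x1 x2 x3 x4 x5 => sw (L.psi x1) fun x1I x1II =>
        sw (L.rho x2) fun x2H x2A => sw (L.rho x3) fun x3H x3A =>
          (γ (star x2H) * L.act (star x3H) (star x1I)) ⊗ₜ[ℂ]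
            (γ (star x4) * L.act (star x5) (star (x1II * x2A * x3A)))) ↔
    Conv.map (Bialgebra.comulAlgHom ℂ A) (toConv γ) * L.psiC =
      Conv.contract (L.tensorTwist γ ∘ₗ L.psiStar) := by
  rw [Conv.ext_star]
  refine forall_congr' fun x => ?_
  have h1 : (Conv.map (Bialgebra.comulAlgHom ℂ A) (toConv γ) * L.psiC) (star x) =
      sw2 x fun x1 x2 => sw2 (γ (star x1)) fun g1 g2 => sw (L.psi (star x2)) fun zI zII =>
      (g1 * zI) ⊗ₜ[ℂ] (g2 * zII) := by
    rw [Conv.mul_apply_star IsStarBialgebra.comul_star]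
    refine sw_congr fun x1 x2 => ?_
    rw [psiC_apply, Conv.map_toConv, Bialgebra.comulAlgHom_apply, ← sw2_self (γ (star x1))]
    simp only [sw2, mul_sw, sw_mul, Algebra.TensorProduct.tmul_mul_tmul]
    first | rfl | rw [sw_comm]
  have h2 : Conv.contract (L.tensorTwist γ ∘ₗ L.psiStar) (star x) =
      sw5 x fun x1 x2 x3 x4 x5 => sw (L.psi x1) fun x1I x1II =>
        sw (L.rho x2) fun x2H x2A => sw (L.rho x3) fun x3H x3A =>
          (γ (star x2H) * L.act (star x3H) (star x1I)) ⊗ₜ[ℂ]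
            (γ (star x4) * L.act (star x5) (star (x1II * x2A * x3A))) := by
    rw [Conv.contract_star IsStarBialgebra.comul_star]
    simp only [sw5]
    refine sw_congr fun x1 x' => ?_
    rw [LinearMap.comp_apply, psiStar_star, map_sw, Conv.sw_apply]
    simp only [tensorTwist_tmul_star]
    simp only [sw4, sw3, sw2, star_mul, mul_assoc, sw_comm _ (L.psi x1)]
  rw [h1, h2]

end CocycleLinkedPair

/-! ### The candidate involution and its compatibility with the product. -/

namespace CocycleLinkedPair

open WithConv

variable {A : Type u} {H : Type v} [Ring A] [HopfAlgebra ℂ A] [StarRing A] [IsStarBialgebra A]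
  [Ring H] [HopfAlgebra ℂ H] [StarRing H] [IsStarBialgebra H]
  {L : CocycleLinkedPair A H}

namespace BismashPresentation

variable {M : Type w} [Ring M] [Bialgebra ℂ M] (X : L.BismashPresentation M) (γ : H →ₗ[ℂ] A)

/-- M is free over A along j, so the A-coefficient can be recovered. This is what permits identities
in M to be compared by their coefficients in A. -/
theorem toA_map_i_mul_jC {C : Type*} [AddCommGroup C] [Module ℂ C] [Coalgebra ℂ C]
    (φ : C →ₗc[ℂ] H) (f : Conv C A) (c : C) :
    X.toA ((Conv.map X.i f * Conv.comap φ X.jC) c) = f c := by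
  rw [Conv.mul_apply]
  conv_rhs => rw [← sw2_counit_right c]
  simp only [sw2, map_sw]
  refine sw_congr fun c1 c2 => ?_
  rw [Conv.map_apply, Conv.comap_apply, CrossedProduct.jC_apply, toA_mul, map_smul]
  congr 1
  exact LinearMap.congr_fun φ.counit_comp c2

theorem map_i_mul_comap_jC_inj {C : Type*} [AddCommGroup C] [Module ℂ C] [Coalgebra ℂ C]
    (φ : C →ₗc[ℂ] H) {f g : Conv C A} :
    Conv.map X.i f * Conv.comap φ X.jC = Conv.map X.i g * Conv.comap φ X.jC ↔ f = g :=
  ⟨fun h => Conv.ext' fun c => by rw [← X.toA_map_i_mul_jC φ, h, X.toA_map_i_mul_jC],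
    fun h => by rw [h]⟩

theorem map_i_mul_jC_inj {f g : Conv H A} :
    Conv.map X.i f * X.jC = Conv.map X.i g * X.jC ↔ f = g :=
  X.map_i_mul_comap_jC_inj (CoalgHom.id ℂ H)

/-- The map `x ↦ ∑ γ(x₁) # x₂`. -/
noncomputable def theta : Conv H M := Conv.map X.i (toConv γ) * X.jC

theorem theta_apply (x : H) : X.theta γ x = sw2 x fun x1 x2 => X.i (γ x1) * X.j x2 := by
  rw [theta, Conv.mul_apply]
  rfl

theorem theta_mul_const (b : A) : X.theta γ * Conv.const H (X.i b) =
    Conv.map X.i (L.twistedAct γ b) * X.jC := by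
  rw [theta, mul_assoc, CrossedProduct.jC_mul_const, ← mul_assoc, ← map_mul]
  rfl

theorem theta_mul_i (b : A) (x : H) : X.theta γ x * X.i b =
    (Conv.map X.i (L.twistedAct γ b) * X.jC) x := by
  rw [← theta_mul_const, Conv.mul_const_apply]

theorem theta_one (h : γ 1 = 1) : X.theta γ 1 = 1 := by
  rw [theta, conv_mul_apply_one, Conv.map_toConv, h, CrossedProduct.jC_apply, X.j_one, map_one,
    one_mul]

/-- The involution `a # x ↦ ∑ γ(x₁*) (x₂* ▸ a*) # x₃*`. -/
noncomputable def starMap : M →+ M :=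
  (TensorProduct.lift ((LinearMap.mul ℂ M).flip.compl₁₂ X.i.toLinearMap
    (X.theta γ).ofConv)).toAddMonoidHom.comp
    ((starAddEquiv : A ⊗[ℂ] H ≃+ A ⊗[ℂ] H).toAddMonoidHom.comp
      X.e.symm.toLinearMap.toAddMonoidHom)

theorem starMap_mul (a : A) (x : H) :
    X.starMap γ (X.i a * X.j x) = X.theta γ (star x) * X.i (star a) := by
  rw [← X.e_tmul]
  simp [starMap]

theorem addMonoidHom_ext {Y : Type*} [AddCommGroup Y] {f g : M →+ Y}
    (h : ∀ a x, f (X.i a * X.j x) = g (X.i a * X.j x)) : f = g := by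
  ext m
  obtain ⟨t, rfl⟩ := X.e.surjective m
  induction t with
  | zero => simp
  | add s t hs ht => simp only [map_add, hs, ht]
  | tmul a x => rw [X.e_tmul, h]

theorem starMap_smul (c : ℂ) (m : M) : X.starMap γ (c • m) = conj c • X.starMap γ m := by
  simp [starMap]

theorem starMap_j (x : H) : X.starMap γ (X.j x) = X.theta γ (star x) := by
  simpa using X.starMap_mul γ 1 x

theorem starMap_i (h : γ 1 = 1) (a : A) : X.starMap γ (X.i a) = X.i (star a) := by
  simpa [X.j_one, X.theta_one γ h] using X.starMap_mul γ a 1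

theorem starMap_theta (x : H) : X.starMap γ (X.theta γ x) = (Conv.map X.i
    (Conv.contract (L.twistedAct γ ∘ₗ (star (toConv γ)).ofConv)) * X.jC) (star x) := by
  rw [theta_apply, sw2, map_sw, Conv.map_contract, ← Conv.contract_mul,
    Conv.contract_star IsStarBialgebra.comul_star]
  refine sw_congr fun x1 x2 => ?_
  rw [starMap_mul, theta_mul_i]
  change _ = (Conv.map X.i (L.twistedAct γ (star (γ (star (star x1))))) * X.jC) _
  rw [star_star]

/-- The coefficient form of (cero): by `starMap_theta`, the contraction is the coefficient of j in
the twofold image of j(x). -/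
theorem contract_eq_one_iff :
    Conv.contract (L.twistedAct γ ∘ₗ (star (toConv γ)).ofConv) = 1 ↔
      ∀ x, X.starMap γ (X.starMap γ (X.j x)) = X.j x := by
  rw [← X.map_i_mul_jC_inj, map_one, one_mul, Conv.ext_star, star_involutive.surjective.forall]
  refine forall_congr' fun x => ?_
  rw [starMap_j, starMap_theta, star_star, CrossedProduct.jC_apply]

/-- The coefficient form of (uno): expanding j(x)i(a) as ∑ i(x₁ ▸ a)j(x₂) before applying the map
produces the contraction. -/
theorem contract_actStar_iff : (∀ b, Conv.contract (L.twistedAct γ ∘ₗ (L.actStar b).ofConv) =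
      Conv.const H b * toConv γ) ↔
    ∀ x a, X.starMap γ (X.j x * X.i a) = X.i (star a) * X.theta γ (star x) := by
  have h (a : A) (x : H) : X.starMap γ (X.j x * X.i a) = (Conv.map X.i
      (Conv.contract (L.twistedAct γ ∘ₗ (L.actStar (star a)).ofConv)) * X.jC) (star x) := by
    rw [CrossedProduct.j_mul_i_apply, sw2, map_sw, Conv.map_contract, ← Conv.contract_mul,
      Conv.contract_star IsStarBialgebra.comul_star]
    refine sw_congr fun x1 x2 => ?_
    rw [starMap_mul, theta_mul_i]
    change _ = (Conv.map X.i (L.twistedAct γ (star (L.act (star (star x1)) (star (star a))))) *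
      X.jC) _
    rw [star_star, star_star]
  simp only [h, ← X.map_i_mul_jC_inj]
  rw [star_involutive.surjective.forall, forall_comm]
  refine forall_congr' fun a => ?_
  rw [Conv.ext_star]
  refine forall_congr' fun x => ?_
  rw [map_mul, Conv.map_const, mul_assoc, Conv.const_mul_apply]
  rfl

theorem theta_mul_theta : Conv.comap (tensorFst H H) (X.theta γ) *
      Conv.comap (tensorSnd H H) (X.theta γ) =
    Conv.map X.i (L.twistedActGamma γ * L.chiC) * Conv.comap (mulH H) X.jC := by
  have h : Conv.comap (tensorFst H H) (X.theta γ) *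
      Conv.map X.i (Conv.comap (tensorSnd H H) (toConv γ)) =
      Conv.map X.i (L.twistedActGamma γ) * Conv.comap (tensorFst H H) X.jC :=
    Conv.ext_slice fun y => by
      rw [Conv.slice_comap_fst_mul, Conv.slice_mul_comap_fst, Conv.map_comap, Conv.slice_comap_snd]
      exact X.theta_mul_const γ (γ y)
  conv_lhs => rw [theta, map_mul (Conv.comap (tensorSnd H H)), ← mul_assoc]
  refine Eq.trans (congrArg (· * _) h) ?_
  rw [mul_assoc, CrossedProduct.jC_mul_jC, ← mul_assoc, ← map_mul]

/-- The coefficient form of (dos): the image of j(x)j(y) is computed through χ and the product of H,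
the product of the images by `theta_mul_theta`; both are coefficients in front of j of the product.
-/
theorem twistedActGamma_mul_chiC_iff :
    L.twistedActGamma γ * L.chiC = Conv.contract (L.twistedChi γ) ↔
      ∀ x y, X.starMap γ (X.j x * X.j y) = X.theta γ (star y) * X.theta γ (star x) := by
  rw [← X.map_i_mul_comap_jC_inj (mulH H), ← theta_mul_theta]
  have h (x y : H) : X.starMap γ (X.j x * X.j y) = (Conv.map X.i
      (Conv.contract (L.twistedChi γ)) * Conv.comap (mulH H) X.jC) (star y ⊗ₜ star x) := by
    rw [Conv.map_contract, ← Conv.contract_mul, Conv.contract_apply]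
    refine Eq.trans ?_ (sw2_tmul_star IsStarBialgebra.comul_star IsStarBialgebra.comul_star
      (TensorProduct.lift (Conv.eval _ _ ∘ₗ (LinearMap.mulRight ℂ (Conv.comap (mulH H) X.jC) ∘ₗ
        (Conv.map X.i).toLinearMap ∘ₗ L.twistedChi γ))) y x).symm
    rw [CrossedProduct.j_mul_j_apply]
    simp only [sw2, map_sw]
    refine sw_congr fun x1 x2 => ?_
    refine sw_congr fun y1 y2 => ?_
    rw [starMap_mul, star_mul, theta_mul_i]
    change _ = (Conv.map X.i (L.twistedChi γ (star y1 ⊗ₜ star x1)) *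
      Conv.comap (mulH H) X.jC) (star y2 ⊗ₜ star x2)
    rw [twistedChi_tmul, star_star, star_star, ← map_mul, Conv.map_comap, ← map_mul]
    rfl
  simp only [h]
  refine ⟨fun k x y => ?_, fun k => Conv.ext_tmul fun y x => ?_⟩
  · rw [← k, Conv.comap_fst_mul_comap_snd_tmul]
  · have := k (star x) (star y)
    rw [star_star, star_star] at this
    rw [this, Conv.comap_fst_mul_comap_snd_tmul]

end BismashPresentation

end CocycleLinkedPair

theorem TensorProduct.star_mul' {R S : Type*} [Ring R] [Algebra ℂ R] [StarRing R] [StarModule ℂ R]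
    [Ring S] [Algebra ℂ S] [StarRing S] [StarModule ℂ S] (s t : R ⊗[ℂ] S) :
    star (s * t) = star t * star s := by
  induction s with
  | zero => simp
  | add s s' hs hs' => simp only [add_mul, star_add, mul_add, hs, hs']
  | tmul a b =>
    induction t with
    | zero => simp
    | add t t' ht ht' => simp only [add_mul, star_add, mul_add, ht, ht']
    | tmul c d => simp

/-! ### Compatibility of the involution with the coproduct. -/

namespace CocycleLinkedPair

open WithConv

variable {A : Type u} {H : Type v} [Ring A] [HopfAlgebra ℂ A] [Ring H] [HopfAlgebra ℂ H]
  {L : CocycleLinkedPair A H}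

namespace BismashPresentation

variable {M : Type w} [Ring M] [Bialgebra ℂ M] (X : L.BismashPresentation M) (γ : H →ₗ[ℂ] A)

/-- The map `x ↦ ∑ x_{1H} ⊗ (x_{1A} # x₂)`. -/
noncomputable def comulH : Conv H (H ⊗[ℂ] M) :=
  Conv.map (X.idI H) (L.hat (toConv LinearMap.id)) * Conv.map (inr H M) X.jC

theorem comulH_apply (x : H) : X.comulH x = sw2 x fun x1 x2 => sw (L.rho x1) fun h a =>
    h ⊗ₜ[ℂ] (X.i a * X.j x2) := by
  rw [comulH, Conv.mul_apply]
  refine sw_congr fun x1 x2 => ?_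
  rw [Conv.map_apply, hat_apply, map_sw, sw_mul]
  refine sw_congr fun h a => ?_
  simp [CrossedProduct.idI]

theorem lTensor_toA_idI_mul_inr {R : Type*} [Ring R] [Algebra ℂ R] (t : R ⊗[ℂ] A) (x : H) :
    LinearMap.lTensor R X.toA (X.idI R t * inr R M (X.j x)) = eps x • t := by
  induction t with
  | zero => simp
  | add s t hs ht => simp only [map_add, add_mul, smul_add, hs, ht]
  | tmul r a => simp [CrossedProduct.idI, toA_mul]

theorem lTensor_toA_map_idI_mul {R : Type*} [Ring R] [Algebra ℂ R] (f : Conv H (R ⊗[ℂ] A))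
    (x : H) : LinearMap.lTensor R X.toA
      ((Conv.map (X.idI R) f * Conv.map (inr R M) X.jC) x) = f x := by
  rw [Conv.mul_apply]
  conv_rhs => rw [← sw2_counit_right x]
  simp only [sw2, map_sw, map_smul, Conv.map_apply]
  exact sw_congr fun x1 x2 => X.lTensor_toA_idI_mul_inr _ _

theorem map_idI_mul_inj {R : Type*} [Ring R] [Algebra ℂ R] {f g : Conv H (R ⊗[ℂ] A)} :
    Conv.map (X.idI R) f * Conv.map (inr R M) X.jC =
      Conv.map (X.idI R) g * Conv.map (inr R M) X.jC ↔ f = g :=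
  ⟨fun h => Conv.ext' fun x => by
    rw [← X.lTensor_toA_map_idI_mul, h, X.lTensor_toA_map_idI_mul], fun h => by rw [h]⟩

/-- Projecting both legs to A reduces the factor `comulPQ` to a counit, so it can be cancelled. -/
theorem map_ii_mul_comulPQ_inj {f g : Conv H (A ⊗[ℂ] A)} :
    Conv.map X.ii f * X.comulPQ = Conv.map X.ii g * X.comulPQ ↔ f = g := by
  have h (f : Conv H (A ⊗[ℂ] A)) (x : H) : LinearMap.lTensor A X.toA (LinearMap.rTensor M X.toA
      ((Conv.map X.ii f * X.comulPQ) x)) = f x := by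
    rw [Conv.mul_apply]
    conv_rhs => rw [← sw2_counit_right x]
    simp only [sw2, map_sw, map_smul, Conv.map_apply, rTensor_toA_ii_mul, rTensor_toA_comulPQ]
    exact sw_congr fun x1 x2 => X.lTensor_toA_idI_mul_inr _ _
  exact ⟨fun k => Conv.ext' fun x => by rw [← h, k, h], fun k => by rw [k]⟩

/-- The map `π ⊗ id`. -/
noncomputable def toHFst : M ⊗[ℂ] M →ₐ[ℂ] H ⊗[ℂ] M :=
  Algebra.TensorProduct.map X.toHAlg (AlgHom.id ℂ M)

/-- Under π the first leg of ψ is reduced to its counit, so ψ drops out and only the coaction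
remains; this isolates (tres) from (cuatro). -/
theorem map_toHFst_comulJ : Conv.map X.toHFst X.comulJ = X.comulH := by
  have h1 : Conv.map (X.toHFst.comp X.ii) L.psiC = 1 :=
    CrossedProduct.map_psiC_counit_left _ ((inr H M).comp X.i) fun a b => by
      simp [toHFst, CrossedProduct.ii, toHAlg_i, TensorProduct.smul_tmul']
  have h2 : Conv.map X.toHFst X.comulP = Conv.map (X.idI H) (L.hat (toConv LinearMap.id)) :=
    Conv.ext' fun x => by
      simp only [Conv.map_apply, CrossedProduct.comulP_apply, hat_apply, map_sw]
      refine sw_congr fun h a => ?_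
      simp [toHFst, CrossedProduct.idI, toHAlg_j]
  have h3 : Conv.map X.toHFst X.comulQ = Conv.map (inr H M) X.jC := Conv.ext' fun x => by
    simp [toHFst, CrossedProduct.comulQ]
  rw [CrossedProduct.comulJ, CrossedProduct.comulPQ, map_mul, map_mul, Conv.map_map, h1, h2, h3,
    one_mul, comulH]

theorem map_comul_jC : Conv.map (Bialgebra.comulAlgHom ℂ M) X.jC = X.comulJ :=
  Conv.ext' X.comul_j

theorem comul_comp_i :
    (Bialgebra.comulAlgHom ℂ M).comp X.i = X.ii.comp (Bialgebra.comulAlgHom ℂ A) :=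
  AlgHom.ext X.comul_i

theorem toHFst_comp_comul_comp_i :
    (X.toHFst.comp (Bialgebra.comulAlgHom ℂ M)).comp X.i = (inr H M).comp X.i :=
  AlgHom.ext fun a => by
    rw [AlgHom.comp_assoc, comul_comp_i, AlgHom.comp_apply, AlgHom.comp_apply, AlgHom.comp_apply,
      Bialgebra.comulAlgHom_apply, ← sw2_self a]
    conv_rhs => rw [← sw2_counit_left a]
    simp [sw2, map_sw, toHFst, CrossedProduct.ii, toHAlg_i, TensorProduct.smul_tmul']

theorem map_comul_theta : Conv.map (Bialgebra.comulAlgHom ℂ M) (X.theta γ) =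
    Conv.map X.ii (Conv.map (Bialgebra.comulAlgHom ℂ A) (toConv γ) * L.psiC) * X.comulPQ := by
  rw [theta, map_mul, map_comul_jC, Conv.map_map, comul_comp_i, map_mul, CrossedProduct.comulJ,
    ← mul_assoc, Conv.map_map]

theorem map_toHFst_comul_theta :
    Conv.map X.toHFst (Conv.map (Bialgebra.comulAlgHom ℂ M) (X.theta γ)) =
      Conv.map (X.idI H) (Conv.map (inr H A) (toConv γ) * L.hat (toConv LinearMap.id)) *
        Conv.map (inr H M) X.jC := by
  have h : (X.idI H).comp (inr H A) = (inr H M).comp X.i := AlgHom.ext fun a => by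
    simp [CrossedProduct.idI]
  rw [theta, map_mul, map_comul_jC, map_mul, map_toHFst_comulJ, Conv.map_map, Conv.map_map,
    toHFst_comp_comul_comp_i, map_mul, Conv.map_map, h, comulH, mul_assoc]

/-- The map `x ↦ ∑ γ(x_{2H}) ⊗ γ(x₁) x_{2A}`. -/
noncomputable def _root_.CocycleLinkedPair.gammaTensor (L : CocycleLinkedPair A H)
    (γ : H →ₗ[ℂ] A) : Conv H (A ⊗[ℂ] A) :=
  Conv.map (inr A A) (toConv γ) * L.hat (toConv γ)

theorem comulPQ_eq_rTensor (x : H) : X.comulPQ x = LinearMap.rTensor M X.j (X.comulH x) := by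
  rw [CrossedProduct.comulPQ_apply, comulH_apply]
  simp [sw2, map_sw]

theorem rTensor_comulH {R : Type*} [Ring R] [Algebra ℂ R] (f : Conv H R) :
    Conv.postcomp (LinearMap.rTensor M f.ofConv) X.comulH =
      Conv.map (X.idI R) (L.hat f) * Conv.map (inr R M) X.jC := Conv.ext' fun x => by
  rw [Conv.postcomp_apply, comulH_apply, Conv.mul_apply]
  simp only [sw2, map_sw]
  refine sw_congr fun x1 x2 => ?_
  rw [Conv.map_apply, hat_apply, map_sw, sw_mul]
  refine sw_congr fun h a => ?_
  simp [CrossedProduct.idI]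

variable [StarRing A] [IsStarBialgebra A] [StarRing H] [IsStarBialgebra H]

/-- Substituting (tres) for `rhoTwist` separates the dependence on γ from the twisted diagonal
action on A ⊗ A. -/
theorem tensorTwist_eq
    (h : Conv.map (inr H A) (toConv γ) * L.hat (toConv LinearMap.id) = L.rhoTwist γ)
    (t : A ⊗[ℂ] A) : L.tensorTwist γ t = L.gammaTensor γ * L.actTensor t := by
  induction t with
  | zero => simp
  | add s t hs ht => simp only [map_add, mul_add, hs, ht]
  | tmul b c =>
    have h1 : Conv.postcomp (LinearMap.rTensor A (L.twistedAct γ b).ofConv) (L.rhoTwist γ) =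
        Conv.map (inr A A) (toConv γ) * L.hat (L.twistedAct γ b) := Conv.ext' fun x => by
      rw [← h, Conv.postcomp_apply, Conv.mul_apply, Conv.mul_apply]
      simp only [sw2, map_sw, hat_apply, mul_sw]
      refine sw_congr fun x1 x2 => ?_
      refine sw_congr fun h a => ?_
      simp
    rw [tensorTwist_tmul, h1, twistedAct_eq, map_mul, actTensor_tmul, gammaTensor]
    simp only [mul_assoc]

section Star

variable [StarRing M] [StarModule ℂ M] (hs : ∀ m : M, star m = X.starMap γ m)

include hs

theorem star_mul_eq (a : A) (x : H) : star (X.i a * X.j x) = X.theta γ (star x) * X.i (star a) := by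
  rw [hs, starMap_mul]

theorem star_j (x : H) : star (X.j x) = X.theta γ (star x) := by
  rw [hs, starMap_j]

theorem star_ii (h1 : γ 1 = 1) (t : A ⊗[ℂ] A) : star (X.ii t) = X.ii (star t) := by
  induction t with
  | zero => simp
  | add s t hs ht => simp only [map_add, star_add, hs, ht]
  | tmul a b => simp [CrossedProduct.ii, hs, starMap_i, h1]

/-- Because ε ∘ γ = ε, the map π sends θ(y) to y. -/
theorem toHAlg_star (hγ : ∀ x, eps (γ x) = eps x) (m : M) :
    X.toHAlg (star m) = star (X.toHAlg m) := by
  have hθ (y : H) : X.toHAlg (X.theta γ y) = y := by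
    conv_rhs => rw [← sw2_counit_left y]
    rw [theta_apply]
    simp only [sw2, map_sw, toHAlg_mul, hγ]
  refine DFunLike.congr_fun (X.addMonoidHom_ext
    (f := X.toHAlg.toAddMonoidHom.comp (starAddEquiv : M ≃+ M).toAddMonoidHom)
    (g := (starAddEquiv : H ≃+ H).toAddMonoidHom.comp X.toHAlg.toAddMonoidHom)
    fun a x => ?_) m
  change X.toHAlg (star (X.i a * X.j x)) = star (X.toHAlg (X.i a * X.j x))
  rw [X.star_mul_eq γ hs, map_mul, hθ, toHAlg_i, toHAlg_mul, star_smul,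
    counit_star_of_comul_star IsStarBialgebra.comul_star]
  simp

theorem star_comulH (x : H) : star (X.comulH x) =
    (Conv.map (X.idI H) (L.rhoTwist γ) * Conv.map (inr H M) X.jC) (star x) := by
  rw [rhoTwist, Conv.map_contract, ← Conv.contract_mul,
    Conv.contract_star IsStarBialgebra.comul_star, comulH_apply]
  simp only [sw2, star_sw]
  refine sw_congr fun x1 x2 => ?_
  simp only [LinearMap.comp_apply, rhoStar_star, map_sw, Conv.sw_apply]
  refine sw_congr fun h a => ?_
  have h1 : (Conv.map (X.idI H)) (Conv.map (inr H A) (L.twistedAct γ (star a))) =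
      Conv.map (inr H M) (Conv.map X.i (L.twistedAct γ (star a))) := Conv.ext' fun z => by
    simp [CrossedProduct.idI]
  rw [TensorProduct.star_tmul, X.star_mul_eq γ hs, legTwist_tmul, mul_one, AlgHom.toLinearMap_apply,
    LinearMap.mulRight_apply, map_mul, h1, mul_assoc, ← map_mul, Conv.map_const,
    Conv.const_mul_apply, Conv.map_apply, ← theta_mul_i]
  simp [CrossedProduct.idI]

theorem star_comulPQ
    (h : Conv.map (inr H A) (toConv γ) * L.hat (toConv LinearMap.id) = L.rhoTwist γ) (x : H) :
    star (X.comulPQ x) = (Conv.map X.ii (L.gammaTensor γ) * X.comulPQ) (star x) := by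
  have h1 (t : H ⊗[ℂ] M) : star (LinearMap.rTensor M X.j t) =
      LinearMap.rTensor M (X.theta γ).ofConv (star t) := by
    induction t with
    | zero => simp
    | add s t hs ht => simp only [map_add, star_add, hs, ht]
    | tmul y m => simp [X.star_j γ hs]
  have h2 : Conv.map (X.idI H) (L.rhoTwist γ) * Conv.map (inr H M) X.jC =
      Conv.map (inr H M) (Conv.map X.i (toConv γ)) * X.comulH := by
    rw [← h, map_mul, comulH, mul_assoc]
    congr 1
  have h3 : Conv.postcomp (LinearMap.rTensor M (X.theta γ).ofConv)
      (Conv.map (inr H M) (Conv.map X.i (toConv γ)) * X.comulH) =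
      Conv.map (inr M M) (Conv.map X.i (toConv γ)) *
        Conv.postcomp (LinearMap.rTensor M (X.theta γ).ofConv) X.comulH := Conv.ext' fun z => by
    rw [Conv.postcomp_apply, Conv.mul_apply, Conv.mul_apply]
    simp only [sw2, map_sw]
    refine sw_congr fun z1 z2 => ?_
    rw [Conv.postcomp_apply]
    induction X.comulH z2 with
    | zero => simp
    | add s t hs ht => simp only [map_add, mul_add, hs, ht]
    | tmul y m => simp
  have h4 : Conv.map (X.idI M) (L.hat (Conv.map X.i (toConv γ))) =
      Conv.map X.ii (L.hat (toConv γ)) := Conv.ext' fun z => by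
    simp only [Conv.map_apply, hat_apply, map_sw]
    refine sw_congr fun y a => ?_
    simp [CrossedProduct.idI, CrossedProduct.ii]
  have h5 : Conv.map (inr M M) (Conv.map X.i (toConv γ)) =
      Conv.map X.ii (Conv.map (inr A A) (toConv γ)) := Conv.ext' fun z => by
    simp [CrossedProduct.ii]
  rw [comulPQ_eq_rTensor, h1, X.star_comulH γ hs, h2]
  refine (LinearMap.congr_fun (congrArg ofConv h3) (star x)).trans ?_
  rw [rTensor_comulH, theta, map_mul L.hat, map_mul, h4, h5, gammaTensor, map_mul (Conv.map X.ii)]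
  simp only [mul_assoc]
  rfl

/-- The star reverses ψ(x₁) · PQ(x₂), leaving the conjugate of ψ on the right. It passes `comulPQ`
by the twisted action, and the A ⊗ A coefficient that results is `tensorTwist` by (tres). -/
theorem star_comulJ (hγ : γ 1 = 1)
    (h : Conv.map (inr H A) (toConv γ) * L.hat (toConv LinearMap.id) = L.rhoTwist γ) (x : H) :
    star (X.comulJ x) = (Conv.map X.ii (Conv.contract (L.tensorTwist γ ∘ₗ L.psiStar)) *
      X.comulPQ) (star x) := by
  rw [Conv.map_contract, ← Conv.contract_mul, Conv.contract_star IsStarBialgebra.comul_star,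
    CrossedProduct.comulJ_apply, sw2, star_sw]
  refine sw_congr fun x1 x2 => ?_
  have h1 : L.psiStar (star x1) = star (L.psi x1) := by
    change star (L.psi (star (star x1))) = _
    rw [star_star]
  rw [TensorProduct.star_mul', X.star_ii γ hs hγ, X.star_comulPQ γ hs h, ← Conv.mul_const_apply,
    mul_assoc, CrossedProduct.comulPQ_mul_const_ii, ← mul_assoc, ← map_mul, ← tensorTwist_eq γ h,
    ← h1]
  rfl

/-- Applying π ⊗ id to the left-hand condition and comparing coefficients of j gives (tres). With
(tres) both sides become an A ⊗ A coefficient times `comulPQ`, and cancelling this factor leaves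
(cuatro). Every step after (tres) can be reversed. -/
theorem comul_star_j_iff (hγ : γ 1 = 1) (hε : ∀ x, eps (γ x) = eps x) :
    (∀ x, Coalgebra.comul (R := ℂ) (star (X.j x)) = star (Coalgebra.comul (R := ℂ) (X.j x))) ↔
      Conv.map (inr H A) (toConv γ) * L.hat (toConv LinearMap.id) = L.rhoTwist γ ∧
      Conv.map (Bialgebra.comulAlgHom ℂ A) (toConv γ) * L.psiC =
        Conv.contract (L.tensorTwist γ ∘ₗ L.psiStar) := by
  have h1 (x : H) : Coalgebra.comul (R := ℂ) (star (X.j x)) =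
      Conv.map (Bialgebra.comulAlgHom ℂ M) (X.theta γ) (star x) := by
    rw [X.star_j γ hs]
    rfl
  have h2 (t : M ⊗[ℂ] M) : X.toHFst (star t) = star (X.toHFst t) := by
    induction t with
    | zero => simp
    | add s t hs ht => simp only [map_add, star_add, hs, ht]
    | tmul m n => simp [toHFst, X.toHAlg_star γ hs hε]
  simp only [h1, X.comul_j]
  constructor
  · intro k
    have h : Conv.map (inr H A) (toConv γ) * L.hat (toConv LinearMap.id) = L.rhoTwist γ := by
      rw [← X.map_idI_mul_inj, ← map_toHFst_comul_theta, Conv.ext_star]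
      intro x
      rw [Conv.map_apply, k, h2, ← Conv.map_apply, map_toHFst_comulJ, X.star_comulH γ hs]
    refine ⟨h, ?_⟩
    rw [← X.map_ii_mul_comulPQ_inj, ← map_comul_theta, Conv.ext_star]
    intro x
    rw [k, X.star_comulJ γ hs hγ h]
  · rintro ⟨h, k⟩ x
    rw [X.star_comulJ γ hs hγ h, ← k, map_comul_theta]

/-- Both composites reverse products, so the products i(a)j(x) reduce to j, which is `h`, and to i,
where it is the star compatibility of A. -/
theorem isStarBialgebra (hγ : γ 1 = 1)
    (h : ∀ x, Coalgebra.comul (R := ℂ) (star (X.j x)) = star (Coalgebra.comul (R := ℂ) (X.j x))) :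
    IsStarBialgebra M where
  comul_star := DFunLike.congr_fun (X.addMonoidHom_ext
    (f := (Bialgebra.comulAlgHom ℂ M).toAddMonoidHom.comp (starAddEquiv : M ≃+ M).toAddMonoidHom)
    (g := (starAddEquiv : M ⊗[ℂ] M ≃+ M ⊗[ℂ] M).toAddMonoidHom.comp
      (Bialgebra.comulAlgHom ℂ M).toAddMonoidHom) fun a x => by
        change Bialgebra.comulAlgHom ℂ M (star (X.i a * X.j x)) =
          star (Bialgebra.comulAlgHom ℂ M (X.i a * X.j x))
        rw [star_mul, map_mul, map_mul, TensorProduct.star_mul']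
        congr 1
        · exact h x
        · rw [hs, starMap_i _ _ hγ, Bialgebra.comulAlgHom_apply, Bialgebra.comulAlgHom_apply,
            X.comul_i, X.comul_i, IsStarBialgebra.comul_star, X.star_ii γ hs hγ])

end Star

end BismashPresentation

end CocycleLinkedPair

/-! ### Bialgebra maps commute with antipodes. -/

section

open WithConv

/-- One composite is a left and the other a right convolution inverse of `f`. -/
theorem BialgHom.map_antipode {B C : Type*} [Ring B] [HopfAlgebra ℂ B] [Ring C] [HopfAlgebra ℂ C]
    (f : B →ₐc[ℂ] C) (b : B) :
    f (HopfAlgebra.antipode ℂ b) = HopfAlgebra.antipode ℂ (f b) := by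
  have h1 : Conv.map (f : B →ₐ[ℂ] C) (toConv (HopfAlgebra.antipode ℂ)) *
      Conv.map (f : B →ₐ[ℂ] C) (toConv LinearMap.id) = 1 := by
    rw [← map_mul, LinearMap.antipode_mul_id, map_one]
  have h2 : Conv.comap (f : B →ₗc[ℂ] C) (toConv LinearMap.id) *
      Conv.comap (f : B →ₗc[ℂ] C) (toConv (HopfAlgebra.antipode ℂ)) = 1 := by
    rw [← map_mul, LinearMap.id_mul_antipode, map_one]
  exact LinearMap.congr_fun (congrArg ofConv (left_inv_eq_right_inv h1 h2)) b

end

/-! ### The star structure, the extension and the main theorem. -/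

namespace CocycleLinkedPair

open WithConv

variable {A : Type u} {H : Type v} [Ring A] [HopfAlgebra ℂ A] [StarRing A] [IsStarBialgebra A]
  [Ring H] [HopfAlgebra ℂ H] [StarRing H] [IsStarBialgebra H]
  {L : CocycleLinkedPair A H}

theorem starConditions_iff (L : CocycleLinkedPair A H) (γ : H →ₗ[ℂ] A) : L.StarConditions γ ↔
    Conv.contract (L.twistedAct γ ∘ₗ (star (toConv γ)).ofConv) = 1 ∧
    (∀ b, Conv.contract (L.twistedAct γ ∘ₗ (L.actStar b).ofConv) = Conv.const H b * toConv γ) ∧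
    L.twistedActGamma γ * L.chiC = Conv.contract (L.twistedChi γ) ∧
    Conv.map (inr H A) (toConv γ) * L.hat (toConv LinearMap.id) = L.rhoTwist γ ∧
    Conv.map (Bialgebra.comulAlgHom ℂ A) (toConv γ) * L.psiC =
      Conv.contract (L.tensorTwist γ ∘ₗ L.psiStar) := by
  rw [← cero_iff, ← uno_iff, ← dos_iff, ← tres_iff, ← cuatro_iff]
  exact ⟨fun h => ⟨h.cero, h.uno, h.dos, h.tres, h.cuatro⟩,
    fun ⟨h0, h1, h2, h3, h4⟩ => ⟨h0, h1, h2, h3, h4⟩⟩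

namespace BismashPresentation

variable {M : Type w} [Ring M]

section Bialgebra

variable [Bialgebra ℂ M] (X : L.BismashPresentation M) (γ : H →ₗ[ℂ] A)

theorem starMap_i_mul (a : A) (m : M) :
    X.starMap γ (X.i a * m) = X.starMap γ m * X.i (star a) :=
  DFunLike.congr_fun (X.addMonoidHom_ext
    (f := (X.starMap γ).comp (AddMonoidHom.mulLeft (X.i a)))
    (g := (AddMonoidHom.mulRight (X.i (star a))).comp (X.starMap γ)) fun b x => by
      simp only [AddMonoidHom.comp_apply, AddMonoidHom.coe_mulLeft, AddMonoidHom.coe_mulRight]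
      rw [← mul_assoc, ← map_mul, starMap_mul, starMap_mul, star_mul, map_mul, mul_assoc]) m

section Conditions

variable
  (h0 : ∀ x, X.starMap γ (X.starMap γ (X.j x)) = X.j x)
  (h1 : ∀ x a, X.starMap γ (X.j x * X.i a) = X.i (star a) * X.theta γ (star x))
  (h2 : ∀ x y, X.starMap γ (X.j x * X.j y) = X.theta γ (star y) * X.theta γ (star x))

include h1 h2

/-- For m = i(b)j(y), move i(b) to the left of j(x), apply `h2` to each product j(x₂)j(y), and
reassemble with `h1`. -/
theorem starMap_j_mul (x : H) (m : M) :
    X.starMap γ (X.j x * m) = X.starMap γ m * X.theta γ (star x) :=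
  DFunLike.congr_fun (X.addMonoidHom_ext
    (f := (X.starMap γ).comp (AddMonoidHom.mulLeft (X.j x)))
    (g := (AddMonoidHom.mulRight (X.theta γ (star x))).comp (X.starMap γ)) fun b y => by
      simp only [AddMonoidHom.comp_apply, AddMonoidHom.coe_mulLeft, AddMonoidHom.coe_mulRight]
      rw [starMap_mul, mul_assoc, ← h1, ← mul_assoc, CrossedProduct.j_mul_i_apply]
      simp only [sw2, sw_mul, map_sw, mul_sw]
      refine sw_congr fun x1 x2 => ?_
      rw [mul_assoc, starMap_i_mul, h2, starMap_mul, mul_assoc]) m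

theorem starMap_mul_rev (m n : M) : X.starMap γ (m * n) = X.starMap γ n * X.starMap γ m :=
  DFunLike.congr_fun (X.addMonoidHom_ext
    (f := (X.starMap γ).comp (AddMonoidHom.mulRight n))
    (g := (AddMonoidHom.mulLeft (X.starMap γ n)).comp (X.starMap γ)) fun b y => by
      simp only [AddMonoidHom.comp_apply, AddMonoidHom.coe_mulLeft, AddMonoidHom.coe_mulRight]
      rw [mul_assoc, starMap_i_mul, X.starMap_j_mul γ h1 h2, starMap_mul, mul_assoc]) m

include h0 in
theorem starMap_involutive (hγ : γ 1 = 1) (m : M) : X.starMap γ (X.starMap γ m) = m :=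
  DFunLike.congr_fun (X.addMonoidHom_ext
    (f := (X.starMap γ).comp (X.starMap γ)) (g := AddMonoidHom.id M) fun b y => by
      simp only [AddMonoidHom.comp_apply, AddMonoidHom.id_apply]
      rw [starMap_i_mul, X.starMap_mul_rev γ h1 h2, h0, starMap_i _ _ hγ, star_star]) m

/-- The star structure given by `starMap`. -/
noncomputable abbrev starRing (hγ : γ 1 = 1) : StarRing M where
  star := X.starMap γ
  star_involutive := X.starMap_involutive γ h0 h1 h2 hγ
  star_mul := X.starMap_mul_rev γ h1 h2
  star_add := map_add _

end Conditions

end Bialgebra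

section HopfAlgebra

variable [HopfAlgebra ℂ M] (X : L.BismashPresentation M) (γ : H →ₗ[ℂ] A)

theorem starMap_bismashProduct_e (a : A) (x : H) :
    X.starMap γ (X.bismashProduct.e (a ⊗ₜ x)) = sw3 x fun x1 x2 x3 =>
      X.bismashProduct.e ((γ (star x1) * L.act (star x2) (star a)) ⊗ₜ star x3) := by
  change X.starMap γ (X.e (a ⊗ₜ x)) =
    sw3 x fun x1 x2 x3 => X.e ((γ (star x1) * L.act (star x2) (star a)) ⊗ₜ star x3)
  rw [X.e_tmul, starMap_mul, theta, Conv.mul_apply_star IsStarBialgebra.comul_star]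
  simp only [sw3, sw2, sw_mul]
  refine sw_congr fun x1 x' => ?_
  have h : X.jC (star x') * X.i (star a) =
      (Conv.map X.i (L.actBy (star a)) * X.jC) (star x') := by
    rw [← CrossedProduct.jC_mul_const, Conv.mul_const_apply]
  rw [mul_assoc, h, Conv.mul_apply_star IsStarBialgebra.comul_star]
  simp only [sw2, mul_sw, X.e_tmul, map_mul, mul_assoc]
  rfl

theorem starFormula_iff (S : StarRing M) :
    X.bismashProduct.StarFormula γ S ↔ ∀ m, S.star m = X.starMap γ m := by
  refine ⟨fun h => ?_, fun h a x => ?_⟩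
  · exact DFunLike.congr_fun (X.addMonoidHom_ext
      (f := (starAddEquiv : M ≃+ M).toAddMonoidHom) (g := X.starMap γ) fun a x => by
        rw [← X.e_tmul]
        exact (h a x).trans (X.starMap_bismashProduct_e γ a x).symm)
  · rw [h, starMap_bismashProduct_e]

theorem starConditions_of_starRing (hγ : γ 1 = 1) (hε : ∀ x, eps (γ x) = eps x)
    [StarRing M] [IsStarBialgebra M] (hs : ∀ m : M, star m = X.starMap γ m) :
    L.StarConditions γ := by
  rw [starConditions_iff, X.contract_eq_one_iff, X.contract_actStar_iff,
    X.twistedActGamma_mul_chiC_iff, ← X.comul_star_j_iff γ hs hγ hε]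
  refine ⟨fun x => ?_, fun x a => ?_, fun x y => ?_, fun x => IsStarBialgebra.comul_star _⟩
  · rw [← hs, ← hs, star_star]
  · rw [← hs, star_mul, X.star_j γ hs, hs, starMap_i _ _ hγ]
  · rw [← hs, star_mul, X.star_j γ hs, X.star_j γ hs]

theorem exists_starRing (hγ : γ 1 = 1) (hε : ∀ x, eps (γ x) = eps x) (h : L.StarConditions γ) :
    ∃ S : StarRing M, IsStarBialgebra M ∧ ∀ m, S.star m = X.starMap γ m := by
  rw [starConditions_iff, X.contract_eq_one_iff, X.contract_actStar_iff,
    X.twistedActGamma_mul_chiC_iff] at h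
  obtain ⟨h0, h1, h2, h34⟩ := h
  let S := X.starRing γ h0 h1 h2 hγ
  have : StarModule ℂ M := ⟨X.starMap_smul γ⟩
  rw [← X.comul_star_j_iff γ (fun _ => rfl) hγ hε] at h34
  exact ⟨S, X.isStarBialgebra γ (fun _ => rfl) hγ h34, fun _ => rfl⟩

/-- The inclusion `a ↦ a # 1` as a bialgebra map. -/
noncomputable def incl : A →ₐc[ℂ] M :=
  BialgHom.ofAlgHom X.i (AlgHom.ext X.counit_i) X.comul_comp_i.symm

theorem incl_apply (a : A) : X.incl a = X.i a := rfl

/-- By `id_eq_mul`, m = ∑ i(p(m₁))j(π(m₂)) with p = `toA`; for a coinvariant m this is i(p(m))j(1),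
so p(m) is the preimage. -/
theorem mem_range_incl_iff (m : M) : m ∈ Set.range X.incl ↔
    (sw2 m fun m1 m2 => m1 ⊗ₜ[ℂ] X.toH m2) = m ⊗ₜ[ℂ] 1 := by
  constructor
  · rintro ⟨a, rfl⟩
    have h := sw2_tmul_apply (LinearMap.lTensor M X.toHAlg.toLinearMap) (X.i a)
    refine h.trans ?_
    rw [X.comul_i, ← sw2_self a]
    conv_rhs => rw [incl_apply, ← sw2_counit_right a]
    simp [sw2, map_sw, sw_tmul, CrossedProduct.ii, toHAlg_i, TensorProduct.smul_tmul']
  · intro h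
    refine ⟨X.toA m, ?_⟩
    have h1 := congrArg (LinearMap.mul' ℂ M ∘ₗ
      TensorProduct.map (X.i.toLinearMap ∘ₗ X.toA) X.j) h
    simp only [sw2, map_sw] at h1
    have h2 : m = sw2 m fun m1 m2 => X.i (X.toA m1) * X.j (X.toH m2) := by
      refine (LinearMap.congr_fun (congrArg ofConv X.id_eq_mul) m).trans ?_
      exact Conv.mul_apply _ _ _
    conv_rhs => rw [h2]
    refine Eq.trans ?_ h1.symm
    simp [X.j_one, incl_apply]

/-- The presentation i(a)j(x) has its A-coefficient on the left, while M ι(A⁺) needs it on the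
right. The star makes the change: n* is congruent to θ(π(n)*) modulo M ι(A⁺), and n = m* gives the
claim when π(m) = 0. -/
theorem toH_eq_zero_iff (hε : ∀ x, eps (γ x) = eps x)
    [StarRing M] [IsStarBialgebra M] (hs : ∀ m : M, star m = X.starMap γ m) (m : M) :
    X.toH m = 0 ↔ m ∈ Submodule.span ℂ {n : M | ∃ (m' : M) (a : A), eps a = 0 ∧
      n = m' * X.incl a} := by
  set N := Submodule.span ℂ {n : M | ∃ (m' : M) (a : A), eps a = 0 ∧ n = m' * X.incl a} with hN
  constructor
  · intro h
    have h1 (n : M) : star n - X.theta γ (star (X.toH n)) ∈ N := by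
      obtain ⟨t, rfl⟩ := X.e.surjective n
      induction t with
      | zero => simp
      | add s t hs ht =>
        have := N.add_mem hs ht
        simp only [map_add, star_add]
        convert this using 1
        abel
      | tmul a x =>
        rw [X.e_tmul, X.star_mul_eq γ hs, toH_mul, star_smul]
        -- The star of a # x is θ(x*)i(a*), and subtracting ε(a*)θ(x*) replaces a* by its component
        -- in A⁺.
        refine Submodule.subset_span ⟨X.theta γ (star x), star a - algebraMap ℂ A (eps (star a)),
          ?_, ?_⟩
        · simp [Algebra.algebraMap_eq_smul_one]
        · rw [incl_apply, map_sub, AlgHomClass.commutes, mul_sub,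
            counit_star_of_comul_star IsStarBialgebra.comul_star, Algebra.algebraMap_eq_smul_one,
            mul_smul_comm, mul_one]
          congr 1
          exact (map_smul (X.theta γ).ofConv _ _)
    have h2 := h1 (star m)
    have h3 : X.toH (star m) = star (X.toH m) := X.toHAlg_star γ hs hε m
    rw [star_star, h3, h, star_zero, star_zero] at h2
    simpa using h2
  · intro h
    induction h using Submodule.span_induction with
    | mem n hn =>
      obtain ⟨m', a, ha, rfl⟩ := hn
      rw [map_mul, incl_apply, toH_i, ha, zero_smul, mul_zero]
    | zero => exact map_zero _
    | add s t _ _ hs ht => rw [map_add, hs, ht, add_zero]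
    | smul c s _ hs => rw [map_smul, hs, smul_zero]

theorem isStarHopfExtension (hγ : γ 1 = 1) (hε : ∀ x, eps (γ x) = eps x)
    [StarRing M] [IsStarBialgebra M] (hs : ∀ m : M, star m = X.starMap γ m) :
    IsStarHopfExtension X.incl X.toH where
  antipode_ι := X.incl.map_antipode
  antipode_π := X.toH.map_antipode
  injective a b h := by
    rw [incl_apply, incl_apply] at h
    rw [← X.toA_i a, h, X.toA_i]
  surjective x := ⟨X.j x, X.toH_j x⟩
  range_eq_coinvariants := X.mem_range_incl_iff
  ker_eq := X.toH_eq_zero_iff γ hε hs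
  star_left := inferInstance
  star_mid := inferInstance
  star_right := inferInstance
  ι_star a := by rw [incl_apply, incl_apply, hs, starMap_i _ _ hγ]
  π_star := X.toHAlg_star γ hs hε

end HopfAlgebra

end BismashPresentation

end CocycleLinkedPair

theorem mainTheorem4 {A : Type u} {H : Type v}
    [Ring A] [HopfAlgebra ℂ A] [StarRing A] [IsStarBialgebra A]
    [Ring H] [HopfAlgebra ℂ H] [StarRing H] [IsStarBialgebra H]
    (L : CocycleLinkedPair A H)
    (hχ : IsUnit (WithConv.toConv L.chi)) (hψ : IsUnit (WithConv.toConv L.psi))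
    (γ : H →ₗ[ℂ] A) (hγ_one : γ 1 = 1) (hγ_counit : ∀ x, eps (γ x) = eps x) :
    ∃ (M : Type (max u v)) (_ : Ring M) (_ : HopfAlgebra ℂ M) (B : L.BismashProduct M),
      ((∃ S : StarRing M, IsStarBialgebra M ∧ B.StarFormula γ S) ↔ L.StarConditions γ) ∧
      (L.StarConditions γ → ∃ S : StarRing M, IsStarBialgebra M ∧ B.StarFormula γ S ∧
        ∃ (ι : A →ₐc[ℂ] M) (π : M →ₐc[ℂ] H),
          (∀ a, ι a = B.e (a ⊗ₜ 1)) ∧ (∀ a x, π (B.e (a ⊗ₜ x)) = eps a • x) ∧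
          IsStarHopfExtension ι π) := by
  -- The bialgebra structure comes first and involves no γ; the antipode is then the convolution
  -- inverse of the identity for that structure.
  let _ := L.crossedSubalgebraPresentation.bialgebra
  let X₀ := L.crossedSubalgebraPresentation.bismashPresentation
  let _ := CocycleLinkedPair.hopfAlgebraOfIsUnit (X₀.isUnit_id hχ hψ
    (CocycleLinkedPair.isUnit_id_of_hopfAlgebra A) (CocycleLinkedPair.isUnit_id_of_hopfAlgebra H))
  let X : L.BismashPresentation L.crossedSubalgebra := X₀
  have key (h : L.StarConditions γ) := X.exists_starRing γ hγ_one hγ_counit h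
  refine ⟨L.crossedSubalgebra, inferInstance, inferInstance, X.bismashProduct, ⟨?_, fun h => ?_⟩,
    fun h => ?_⟩
  · rintro ⟨S, hS, hf⟩
    exact X.starConditions_of_starRing γ hγ_one hγ_counit ((X.starFormula_iff γ S).mp hf)
  · obtain ⟨S, hS, hs⟩ := key h
    exact ⟨S, hS, (X.starFormula_iff γ S).mpr hs⟩
  · obtain ⟨S, hS, hs⟩ := key h
    refine ⟨S, hS, (X.starFormula_iff γ S).mpr hs, X.incl, X.toH, fun a => ?_, fun a x => ?_,
      X.isStarHopfExtension γ hγ_one hγ_counit hs⟩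
    · exact (by rw [X.incl_apply, X.e_tmul, X.j_one, mul_one] : X.incl a = X.e (a ⊗ₜ 1))
    · exact (by rw [X.e_tmul, X.toH_mul] : X.toH (X.e (a ⊗ₜ x)) = eps a • x)
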